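/- Let $Q$ be a probability distribution on $\mathbb{R}$ with $$\int x\,Q(dx)=0,\qquad \int x^2\,Q(dx)=\tfrac12,\qquad b:=\int x^4\,Q(dx)<\infty .$$ Let $(X_{ii}/\sqrt2)_{i\in\mathbb{N}}$, $(X^{\mathrm{Re}}_{ij})_{i<j}$ and $(X^{\mathrm{Im}}_{ij})_{i<j}$ ($i,j\in\mathbb{N}$) be real random variables on a probability space $(\Omega,\mathcal{F},\mathbb{P})$, all with distribution $Q$ and all jointly independent. For $i<j$ put $X_{ij}:=X^{\mathrm{Re}}_{ij}+\mathrm{i}\,X^{\mathrm{Im}}_{ij}$ and $X_{ji}:=X^{\mathrm{Re}}_{ij}-\mathrm{i}\,X^{\mathrm{Im}}_{ij}$, and let $X_N:=(X_{ij})_{1\le i,j\le N}$ be the $N\times N$ Hermitian Wigner matrix. Then $\det(X_N-xI_N)$ is square-integrable for all $N$ and all $x\in\mathbb{R}$. For $x,y\in\mathbb{R}$ let $$\widetilde f(N;x,y):=\mathbb{E}\Big(\big(\det(X_N-xI_N)-\mathbb{E}\det(X_N-xI_N)\big)\cdot\big(\det(X_N-yI_N)-\mathbb{E}\det(X_N-yI_N)\big)\Big).$$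 Let $\xi\in(-2,2)$, let $\mu,\nu\in\mathbb{R}$, and let $\varrho(\xi):=\frac1{2\pi}\sqrt{4-\xi^2}$. Then $$\lim_{N\to\infty}\sqrt{\frac1{2\pi N}}\cdot\frac1{N!}\cdot e^{-N\xi^2/2}\cdot\widetilde f\Big(N;\sqrt N\,\xi+\frac{\mu}{\sqrt N\,\varrho(\xi)},\sqrt N\,\xi+\frac{\nu}{\sqrt N\,\varrho(\xi)}\Big)=\exp\big(b-\tfrac34\big)\cdot e^{\xi(\mu+\nu)/(2\varrho(\xi))}\cdot\varrho(\xi)\cdot\frac{\sin\pi(\mu-\nu)}{\pi(\mu-\nu)},$$ where $\sin 0/0:=1$. -/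

import Mathlib

open MeasureTheory ProbabilityTheory Filter Topology

noncomputable section

/-- Index set of the strictly upper triangular entries. -/
abbrev UpperIndex : Type := {p : ℕ × ℕ // p.1 < p.2}

/-- The `(i, j)` entry of the infinite Hermitian Wigner array. Here `D i` is the `i`-th diagonal
entry divided by `√2`, and `R`, `J` are the real and imaginary parts of the entries above the
diagonal; the entries below it are the complex conjugates. -/
def wignerEntry {Ω : Type*} (D : ℕ → Ω → ℝ) (R J : UpperIndex → Ω → ℝ) (i j : ℕ) (ω : Ω) : ℂ :=
  if h : i < j then (R ⟨(i, j), h⟩ ω : ℂ) + Complex.I * (J ⟨(i, j), h⟩ ω : ℂ)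
  else if h : j < i then (R ⟨(j, i), h⟩ ω : ℂ) - Complex.I * (J ⟨(j, i), h⟩ ω : ℂ)
  else ((Real.sqrt 2 * D i ω : ℝ) : ℂ)

/-- The `N × N` Hermitian Wigner matrix. -/
def wignerMatrix {Ω : Type*} (D : ℕ → Ω → ℝ) (R J : UpperIndex → Ω → ℝ) (N : ℕ) (ω : Ω) :
    Matrix (Fin N) (Fin N) ℂ :=
  Matrix.of fun i j => wignerEntry D R J i j ω

/-- The random variable `det (X_N - x I_N)`. -/
def wignerCharDet {Ω : Type*} (D : ℕ → Ω → ℝ) (R J : UpperIndex → Ω → ℝ) (N : ℕ) (x : ℝ)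
    (ω : Ω) : ℂ :=
  (wignerMatrix D R J N ω - (x : ℂ) • (1 : Matrix (Fin N) (Fin N) ℂ)).det

/-- The covariance of `det (X_N - x I_N)` and `det (X_N - y I_N)`. The determinants are
real-valued, although they are typed as complex numbers, so no conjugation is needed. -/
def wignerDetCov {Ω : Type*} [MeasurableSpace Ω] (P : Measure Ω) (D : ℕ → Ω → ℝ)
    (R J : UpperIndex → Ω → ℝ) (N : ℕ) (x y : ℝ) : ℂ :=
  ∫ ω, (wignerCharDet D R J N x ω - ∫ ω', wignerCharDet D R J N x ω' ∂P) *
    (wignerCharDet D R J N y ω - ∫ ω', wignerCharDet D R J N y ω' ∂P) ∂P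

/-- The density of the semicircle law on `(-2, 2)`. -/
def semicircleDensity (ξ : ℝ) : ℝ := 1 / (2 * Real.pi) * Real.sqrt (4 - ξ ^ 2)

end

/-! Exact moments. Split off the first row and column of the matrix. They are independent of the
remaining minor, so only their moments up to order four matter, and beyond mean and variance `Q`
enters only through κ = E|X_ij|^4 - 2 = 2b - 3/2. Averaging over the border leaves traces of
adjugates, which are derivatives of the characteristic polynomial; a trace of a product of two
adjugates, which the resolvent identity reduces to such derivatives; and κ times products of
diagonal cofactors, which are determinants of matrices one size smaller again. Hence E det(X_N - x)
satisfies the Hermite recursion and equals (-1)^N He_N(x), while E det(X_N - x) det(X_N - y)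
satisfies a closed recursion in N (`integral_det_mul_det_succ`). For κ = 0, as in the Gaussian case,
its solution is N! times the kernel K_N, the sum of He_k(x) He_k(y) / k! over k ≤ N. The κ term
multiplies the generating function of the K_N by exp(c z^2) with c = κ/2 = b - 3/4, which is what
`expConv` encodes.

Asymptotics. By Mehler's formula (`circleCoeff_mehler`) the second moment divided by N! is the
coefficient of z^N in exp(c z^2) M(z) / (1 - z), with M the Mehler function, and the product of the
means divided by N! is the coefficient of z^N in M alone. Both are integrated over the circle of
radius exp(-1/N), where z^(-N) has modulus e. There exp(-N ξ^2/2) |M(z)| is at most a constant times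
|1 - z^2|^(-1/2), uniformly in N (`norm_scaledMehler_le`). After multiplication by N^(-1/2),
singularities of order 1/2 disappear: the one at z = -1, and all of the product of the means. Only
the singularity (1 - z)^(-3/2) at z = 1 survives.

With z = exp(-w/N), w = 1 - it, the rescaled integrand converges, up to constants, to w^(-3/2) exp(a
w - δ^2/w), where a = 1 - ξ^2/4 = (π ϱ(ξ))^2 and δ is half the difference of the offsets. Its
inverse Laplace transform is a sine kernel (`integral_cpow_mul_cexp`), and exp(c z^2) contributes
the factor exp(b - 3/4). -/

/-! ### Hermite polynomials, their kernel, and its recursion -/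

/-- The probabilists' Hermite polynomial as a function on `ℂ`. -/
noncomputable def hermiteFun (n : ℕ) (x : ℂ) : ℂ := Polynomial.aeval x (Polynomial.hermite n)

@[simp] lemma hermiteFun_zero (x : ℂ) : hermiteFun 0 x = 1 := by simp [hermiteFun]

@[simp] lemma hermiteFun_one (x : ℂ) : hermiteFun 1 x = x := by simp [hermiteFun]

lemma Polynomial.derivative_hermite_succ (n : ℕ) :
    Polynomial.derivative (Polynomial.hermite (n + 1)) =
      ((n : Polynomial ℤ) + 1) * Polynomial.hermite n := by
  induction n with
  | zero => simp
  | succ n ih =>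
    rw [Polynomial.hermite_succ (n + 1), Polynomial.derivative_sub, Polynomial.derivative_mul, ih]
    simp only [Polynomial.derivative_X, Polynomial.derivative_mul, Polynomial.derivative_add,
      Polynomial.derivative_natCast, Polynomial.derivative_one]
    rw [Polynomial.hermite_succ n]
    push_cast
    ring

lemma hermiteFun_add_two (n : ℕ) (x : ℂ) :
    hermiteFun (n + 2) x = x * hermiteFun (n + 1) x - (n + 1) * hermiteFun n x := by
  simp only [hermiteFun]
  rw [Polynomial.hermite_succ (n + 1), Polynomial.derivative_hermite_succ]
  simp

/-- The derivative of `hermiteFun n`. -/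
noncomputable def hermiteDeriv : ℕ → ℂ → ℂ
  | 0, _ => 0
  | n + 1, x => (n + 1) * hermiteFun n x

lemma hasDerivAt_hermiteFun (n : ℕ) (x : ℂ) :
    HasDerivAt (hermiteFun n) (hermiteDeriv n x) x := by
  refine ((Polynomial.hermite n).hasDerivAt_aeval x).congr_deriv ?_
  cases n with
  | zero => simp [hermiteDeriv]
  | succ n =>
    rw [Polynomial.derivative_hermite_succ]
    simp [hermiteDeriv, hermiteFun]

lemma hermiteFun_succ (n : ℕ) (x : ℂ) :
    hermiteFun (n + 1) x = x * hermiteFun n x - hermiteDeriv n x := by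
  cases n with
  | zero => simp [hermiteDeriv]
  | succ n => rw [hermiteFun_add_two, hermiteDeriv]

/-- The term of index `k` in the Hermite kernel. -/
noncomputable def hermiteTerm (k : ℕ) (x y : ℂ) : ℂ :=
  hermiteFun k x * hermiteFun k y / k.factorial

/-- The Hermite kernel `∑ k ≤ n, He_k(x) He_k(y) / k!`. -/
noncomputable def hermiteKernel (n : ℕ) (x y : ℂ) : ℂ :=
  ∑ k ∈ Finset.range (n + 1), hermiteTerm k x y

/-- `hermiteKernel` differentiated in the first variable. -/
noncomputable def hermiteKernelX (n : ℕ) (x y : ℂ) : ℂ :=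
  ∑ k ∈ Finset.range (n + 1), hermiteDeriv k x * hermiteFun k y / k.factorial

/-- `hermiteKernel` differentiated in the second variable. -/
noncomputable def hermiteKernelY (n : ℕ) (x y : ℂ) : ℂ :=
  ∑ k ∈ Finset.range (n + 1), hermiteFun k x * hermiteDeriv k y / k.factorial

/-- `hermiteKernel` differentiated in both variables. -/
noncomputable def hermiteKernelXY (n : ℕ) (x y : ℂ) : ℂ :=
  ∑ k ∈ Finset.range (n + 1), hermiteDeriv k x * hermiteDeriv k y / k.factorial

lemma hermiteKernel_succ (n : ℕ) (x y : ℂ) :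
    hermiteKernel (n + 1) x y = hermiteKernel n x y + hermiteTerm (n + 1) x y :=
  Finset.sum_range_succ _ _

/-- By the three-term recurrence in each variable, passing from n to n + 1 changes both sides by (x
- y) He_{n+1}(x) He_{n+1}(y) / (n+1)!. -/
lemma christoffel_darboux (n : ℕ) (x y : ℂ) :
    (x - y) * hermiteKernel n x y =
      (hermiteFun (n + 1) x * hermiteFun n y - hermiteFun n x * hermiteFun (n + 1) y) /
        n.factorial := by
  induction n with
  | zero => simp [hermiteKernel, hermiteTerm]
  | succ n ih =>
    rw [hermiteKernel_succ, mul_add, ih, hermiteTerm, hermiteFun_add_two, hermiteFun_add_two,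
      Nat.factorial_succ]
    have h1 : (n.factorial : ℂ) ≠ 0 := by exact_mod_cast n.factorial_ne_zero
    have h2 : (n + 1 : ℂ) ≠ 0 := by exact_mod_cast n.succ_ne_zero
    push_cast
    field_simp
    ring

/-- Since He_k' = k He_{k-1}, the new term at k = n + 1 is the Christoffel–Darboux expression of
index n. The difference of derivatives is what a trace of a product of two adjugates produces after
multiplication by x - y. -/
lemma hermiteKernelY_sub_X (n : ℕ) (x y : ℂ) :
    hermiteKernelY n x y - hermiteKernelX n x y =
      (x - y) * ∑ k ∈ Finset.range n, hermiteKernel k x y := by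
  induction n with
  | zero => simp [hermiteKernelY, hermiteKernelX, hermiteDeriv]
  | succ n ih =>
    rw [Finset.sum_range_succ, mul_add, ← ih, christoffel_darboux, hermiteKernelY, hermiteKernelX,
      Finset.sum_range_succ, Finset.sum_range_succ _ (n + 1), ← hermiteKernelX, ← hermiteKernelY]
    have h1 : (n.factorial : ℂ) ≠ 0 := by exact_mod_cast n.factorial_ne_zero
    have h2 : (n + 1 : ℂ) ≠ 0 := by exact_mod_cast n.succ_ne_zero
    simp only [hermiteDeriv, Nat.factorial_succ]
    push_cast
    field_simp
    ring

/-- The recursion of the Hermite kernel in the form met by the second moment of the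
characteristic polynomial. -/
lemma hermiteKernel_recursion (n : ℕ) (x y : ℂ) :
    (x - y) * ((n + 1) * hermiteKernel (n + 1) x y) =
      (x - y) * ((1 + x * y) * hermiteKernel n x y - x * hermiteKernelY n x y
        - y * hermiteKernelX n x y + hermiteKernelXY n x y)
      + (hermiteKernelY n x y - hermiteKernelX n x y) := by
  rw [hermiteKernelY_sub_X, ← mul_add]
  congr 1
  -- The relation He_{k+1} = x He_k - He_k', used in both variables, factors each summand.
  have hprod : x * y * hermiteKernel n x y - x * hermiteKernelY n x y - y * hermiteKernelX n x y
      + hermiteKernelXY n x y =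
      ∑ k ∈ Finset.range (n + 1), (k + 1) * hermiteTerm (k + 1) x y := by
    simp only [hermiteKernel, hermiteKernelX, hermiteKernelY, hermiteKernelXY, Finset.mul_sum,
      ← Finset.sum_sub_distrib, ← Finset.sum_add_distrib]
    refine Finset.sum_congr rfl fun k _ => ?_
    simp only [hermiteTerm, hermiteFun_succ, Nat.factorial_succ]
    have h1 : (k.factorial : ℂ) ≠ 0 := by exact_mod_cast k.factorial_ne_zero
    have h2 : (k + 1 : ℂ) ≠ 0 := by exact_mod_cast k.succ_ne_zero
    push_cast
    field_simp
    ring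
  -- Abel summation: the term of index j is counted j times by its weight and n + 1 - j times by the
  -- kernels of index j, ..., n.
  have hsum : ∀ n : ℕ, (n + 1) * hermiteKernel (n + 1) x y = hermiteKernel n x y +
      ∑ k ∈ Finset.range (n + 1), (k + 1) * hermiteTerm (k + 1) x y +
      ∑ k ∈ Finset.range n, hermiteKernel k x y := by
    intro n
    induction n with
    | zero => simp [hermiteKernel_succ]
    | succ n ih =>
      rw [Finset.sum_range_succ _ (n + 1), Finset.sum_range_succ (fun k => hermiteKernel k x y) n,
        hermiteKernel_succ (n + 1)]
      push_cast
      linear_combination ih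
  rw [hsum, ← hprod]
  ring

lemma hasDerivAt_hermiteKernel_left (n : ℕ) (x y : ℂ) :
    HasDerivAt (fun x => hermiteKernel n x y) (hermiteKernelX n x y) x := by
  unfold hermiteKernel hermiteKernelX hermiteTerm
  exact HasDerivAt.fun_sum fun k _ => ((hasDerivAt_hermiteFun k x).mul_const _).div_const _

lemma hasDerivAt_hermiteKernel_right (n : ℕ) (x y : ℂ) :
    HasDerivAt (fun y => hermiteKernel n x y) (hermiteKernelY n x y) y := by
  unfold hermiteKernel hermiteKernelY hermiteTerm
  exact HasDerivAt.fun_sum fun k _ => ((hasDerivAt_hermiteFun k y).const_mul _).div_const _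

lemma hasDerivAt_hermiteKernelY_left (n : ℕ) (x y : ℂ) :
    HasDerivAt (fun x => hermiteKernelY n x y) (hermiteKernelXY n x y) x := by
  unfold hermiteKernelY hermiteKernelXY
  exact HasDerivAt.fun_sum fun k _ => ((hasDerivAt_hermiteFun k x).mul_const _).div_const _

/-! ### Convolution with the coefficients of exp(c z^2) -/

/-- The weighted sum `∑ 2 j ≤ n, c ^ j / j! * S (n - 2 j)`. -/
noncomputable def expConv (c : ℂ) (S : ℕ → ℂ) (n : ℕ) : ℂ :=
  ∑ j ∈ Finset.range (n + 1), if 2 * j ≤ n then c ^ j / j.factorial * S (n - 2 * j) else 0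

/-- Coefficient form of the product rule for z d/dz applied to exp(c z^2) times the generating
function of `S`. -/
lemma expConv_weighted (c : ℂ) (S : ℕ → ℂ) (n : ℕ) :
    (n + 2) * expConv c S (n + 2) =
      expConv c (fun m => m * S m) (n + 2) + 2 * c * expConv c S n := by
  have key : (n + 2) * expConv c S (n + 2) - expConv c (fun m => m * S m) (n + 2) =
      ∑ j ∈ Finset.range (n + 3), if 2 * j ≤ n + 2 then
        c ^ j / j.factorial * (2 * j) * S (n + 2 - 2 * j) else 0 := by
    unfold expConv
    rw [Finset.mul_sum, ← Finset.sum_sub_distrib]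
    refine Finset.sum_congr rfl fun j _ => ?_
    split_ifs with h
    · push_cast [h]
      ring
    · simp
  -- The term j = 0 carries the weight 2j = 0, and the top index j = n + 2 violates 2j ≤ n + 2; what
  -- lies between is the shifted sum.
  rw [← sub_eq_iff_eq_add', key, Finset.sum_range_succ', Finset.sum_range_succ]
  simp only [expConv, Finset.mul_sum]
  rw [if_neg (by omega)]
  simp only [Nat.cast_zero, mul_zero, zero_mul, ite_self, add_zero]
  refine Finset.sum_congr rfl fun j _ => ?_
  by_cases h : 2 * j ≤ n
  · rw [if_pos h, if_pos (by omega), show n + 2 - 2 * (j + 1) = n - 2 * j by omega,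
      Nat.factorial_succ]
    have h1 : (j.factorial : ℂ) ≠ 0 := by exact_mod_cast j.factorial_ne_zero
    have h2 : (j + 1 : ℂ) ≠ 0 := by exact_mod_cast j.succ_ne_zero
    push_cast
    field_simp
    ring
  · rw [if_neg h, if_neg (by omega), mul_zero]

/-- Dividing the generating function by z commutes with multiplication by exp(c z^2); `S 0 = 0`
makes the division possible. -/
lemma expConv_shift (c : ℂ) (S : ℕ → ℂ) (hS : S 0 = 0) (n : ℕ) :
    expConv c S (n + 1) = expConv c (fun m => S (m + 1)) n := by
  unfold expConv
  rw [Finset.sum_range_succ, if_neg (by omega), add_zero]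
  refine Finset.sum_congr rfl fun j _ => ?_
  by_cases h : 2 * j ≤ n
  · rw [if_pos h, if_pos (by omega), show n + 1 - 2 * j = n - 2 * j + 1 by omega]
  · rw [if_neg h]
    split_ifs with h'
    · rw [show n + 1 - 2 * j = 0 by omega, hS, mul_zero]
    · rfl

lemma expConv_add (c : ℂ) (S S' : ℕ → ℂ) (n : ℕ) :
    expConv c (fun m => S m + S' m) n = expConv c S n + expConv c S' n := by
  unfold expConv
  rw [← Finset.sum_add_distrib]
  refine Finset.sum_congr rfl fun j _ => ?_
  split_ifs <;> ring

lemma expConv_const_mul (c a : ℂ) (S : ℕ → ℂ) (n : ℕ) :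
    expConv c (fun m => a * S m) n = a * expConv c S n := by
  unfold expConv
  rw [Finset.mul_sum]
  refine Finset.sum_congr rfl fun j _ => ?_
  split_ifs <;> ring

lemma hasDerivAt_expConv (c : ℂ) (S S' : ℕ → ℂ → ℂ) (x : ℂ) (n : ℕ)
    (h : ∀ m, HasDerivAt (S m) (S' m x) x) :
    HasDerivAt (fun x => expConv c (fun m => S m x) n) (expConv c (fun m => S' m x) n) x := by
  unfold expConv
  refine HasDerivAt.fun_sum fun j _ => ?_
  split_ifs
  · exact (h _).const_mul _
  · exact hasDerivAt_const _ _

/-- The recursion for the second moment of the characteristic polynomial, solved by `expConv`. -/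
lemma expConv_hermiteKernel_recursion (c : ℂ) (n : ℕ) (x y : ℂ) :
    (x - y) * ((n + 1) * expConv c (fun m => hermiteKernel m x y) (n + 1)) =
      (x - y) * ((1 + x * y) * expConv c (fun m => hermiteKernel m x y) n
        - x * expConv c (fun m => hermiteKernelY m x y) n
        - y * expConv c (fun m => hermiteKernelX m x y) n
        + expConv c (fun m => hermiteKernelXY m x y) n
        + 2 * c * (if n = 0 then 0 else expConv c (fun m => hermiteKernel m x y) (n - 1)))
      + (expConv c (fun m => hermiteKernelY m x y) n
        - expConv c (fun m => hermiteKernelX m x y) n) := by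
  have h1 : (n + 1) * expConv c (fun m => hermiteKernel m x y) (n + 1) =
      expConv c (fun m => (m + 1) * hermiteKernel (m + 1) x y) n +
      2 * c * (if n = 0 then 0 else expConv c (fun m => hermiteKernel m x y) (n - 1)) := by
    have h0 := expConv_shift c (fun m => m * hermiteKernel m x y) (by simp) n
    push_cast at h0
    rw [← h0]
    cases n with
    | zero => simp [expConv, Finset.sum_range_succ]
    | succ n =>
      have := expConv_weighted c (fun m => hermiteKernel m x y) n
      simp only [Nat.add_eq_zero_iff, one_ne_zero, and_false, if_false, Nat.add_sub_cancel]
      push_cast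
      linear_combination this
  have h2 : (x - y) * expConv c (fun m => (m + 1) * hermiteKernel (m + 1) x y) n =
      expConv c (fun m => (x - y) * (1 + x * y) * hermiteKernel m x y
        + ((-(x - y) * x + 1) * hermiteKernelY m x y
        + ((-(x - y) * y - 1) * hermiteKernelX m x y + (x - y) * hermiteKernelXY m x y))) n := by
    rw [← expConv_const_mul]
    congr 1
    funext m
    rw [hermiteKernel_recursion]
    ring
  rw [h1, mul_add, h2, expConv_add, expConv_add, expConv_add, expConv_const_mul,
    expConv_const_mul, expConv_const_mul, expConv_const_mul]
  ring

/-! ### Determinants and adjugates -/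

namespace Matrix

/-- Expansion of a determinant along its first row and its first column. -/
lemma det_bordered {R : Type*} [CommRing R] {n : ℕ} (A : Matrix (Fin (n + 1)) (Fin (n + 1)) R) :
    A.det = A 0 0 * (A.submatrix Fin.succ Fin.succ).det -
      ∑ i : Fin n, ∑ j : Fin n,
        A 0 i.succ * (A.submatrix Fin.succ Fin.succ).adjugate i j * A j.succ 0 := by
  rw [det_succ_row_zero, Fin.sum_univ_succ]
  have h0 : A.submatrix Fin.succ (Fin.succAbove 0) = A.submatrix Fin.succ Fin.succ := by
    simp
  rw [h0, sub_eq_add_neg, ← Finset.sum_neg_distrib]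
  congr 1
  · simp
  refine Finset.sum_congr rfl fun i _ => ?_
  cases n with
  | zero => exact i.elim0
  | succ n =>
    rw [det_succ_column_zero, Finset.mul_sum, ← Finset.sum_neg_distrib]
    refine Finset.sum_congr rfl fun j _ => ?_
    rw [adjugate_fin_succ_eq_det_submatrix]
    have h1 : (A.submatrix Fin.succ (Fin.succAbove i.succ)).submatrix j.succAbove Fin.succ =
        (A.submatrix Fin.succ Fin.succ).submatrix j.succAbove i.succAbove := by
      ext k l
      simp
    rw [h1]
    simp only [submatrix_apply, Fin.succ_succAbove_zero, Fin.val_succ]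
    ring

lemma adjugate_apply_self {R : Type*} [CommRing R] {n : ℕ}
    (A : Matrix (Fin (n + 1)) (Fin (n + 1)) R) (i : Fin (n + 1)) :
    A.adjugate i i = (A.submatrix i.succAbove i.succAbove).det := by
  rw [adjugate_fin_succ_eq_det_submatrix, ← two_mul, pow_mul]
  simp

/-- The resolvent identity multiplied by both determinants, so that it needs no invertibility. -/
lemma adjugate_mul_adjugate {R : Type*} [CommRing R] {n : Type*} [Fintype n] [DecidableEq n]
    (A B : Matrix n n R) :
    A.adjugate * (B - A) * B.adjugate = B.det • A.adjugate - A.det • B.adjugate := by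
  rw [Matrix.mul_sub, Matrix.sub_mul, Matrix.mul_assoc, mul_adjugate, adjugate_mul]
  simp

lemma sub_smul_one_adjugate_trace {R : Type*} [CommRing R] {n : Type*} [Fintype n] [DecidableEq n]
    (A : Matrix n n R) (x y : R) :
    (x - y) * ((A - x • 1).adjugate * (A - y • 1).adjugate).trace =
      (A - y • 1).det * (A - x • 1).adjugate.trace -
        (A - x • 1).det * (A - y • 1).adjugate.trace := by
  have h := congrArg trace (adjugate_mul_adjugate (A - x • 1) (A - y • 1))
  rw [show A - y • (1 : Matrix n n R) - (A - x • 1) = (x - y) • 1 by rw [sub_smul]; abel] at h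
  simpa using h

/-- Jacobi's formula: differentiating one row at a time replaces it by minus a basis vector, and the
resulting determinants are the diagonal cofactors. -/
lemma hasDerivAt_det_sub_smul_one {n : Type*} [Fintype n] [DecidableEq n]
    (A : Matrix n n ℂ) (x : ℂ) :
    HasDerivAt (fun x => (A - x • 1).det) (-(A - x • 1).adjugate.trace) x := by
  -- The transposed Leibniz formula indexes each product by rows, as `updateRow` requires.
  have hdet : ∀ B : Matrix n n ℂ,
      B.det = ∑ σ : Equiv.Perm n, ((Equiv.Perm.sign σ : ℤ) : ℂ) * ∏ j, B j (σ j) := fun B => by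
    rw [← det_transpose, det_apply']
    rfl
  have h : HasDerivAt (fun x => (A - x • 1).det)
      (∑ σ : Equiv.Perm n, ((Equiv.Perm.sign σ : ℤ) : ℂ) * ∑ i,
        (∏ j ∈ Finset.univ.erase i, (A - x • 1) j (σ j)) • (-(1 : Matrix n n ℂ) i (σ i))) x := by
    simp only [hdet]
    refine HasDerivAt.fun_sum fun σ _ => HasDerivAt.const_mul _ ?_
    refine HasDerivAt.fun_finsetProd fun i _ => ?_
    simp only [sub_apply, smul_apply, smul_eq_mul]
    simpa using ((hasDerivAt_id x).mul_const ((1 : Matrix n n ℂ) i (σ i))).const_sub (A i (σ i))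
  refine h.congr_deriv ?_
  simp only [trace, diag_apply, adjugate_apply, Finset.mul_sum]
  rw [Finset.sum_comm, ← Finset.sum_neg_distrib]
  refine Finset.sum_congr rfl fun i _ => ?_
  rw [hdet, ← Finset.sum_neg_distrib]
  refine Finset.sum_congr rfl fun σ _ => ?_
  have hp : ∏ j ∈ Finset.univ.erase i, (A - x • 1).updateRow i (Pi.single i 1) j (σ j) =
      ∏ j ∈ Finset.univ.erase i, (A - x • 1) j (σ j) :=
    Finset.prod_congr rfl fun j hj => by rw [updateRow_ne (Finset.ne_of_mem_erase hj)]
  rw [← Finset.prod_erase_mul Finset.univ _ (Finset.mem_univ i), updateRow_self, smul_eq_mul, hp]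
  rw [one_apply, Pi.single_apply]
  simp only [eq_comm (a := i)]
  ring

/-- A determinant is bounded through the product of all its entries. -/
lemma norm_det_le {n : ℕ} (A : Matrix (Fin n) (Fin n) ℂ) {w : Fin n → Fin n → ℝ} {K : ℝ}
    (hK : 1 ≤ K) (hw : ∀ i j, 1 ≤ w i j) (h : ∀ i j, ‖A i j‖ ≤ K * w i j) :
    ‖A.det‖ ≤ n.factorial * K ^ (n * n) * ∏ i, ∏ j, w i j := by
  have hterm : ∀ σ : Equiv.Perm (Fin n), ‖((Equiv.Perm.sign σ : ℤ) : ℂ) * ∏ i, A (σ i) i‖ ≤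
      K ^ (n * n) * ∏ i, ∏ j, w i j := by
    intro σ
    have hs : ‖((Equiv.Perm.sign σ : ℤ) : ℂ)‖ = 1 := by
      rcases Int.units_eq_one_or (Equiv.Perm.sign σ) with h | h <;> simp [h]
    rw [norm_mul, hs, one_mul, norm_prod, Finset.prod_comm]
    have hKw : K ^ (n * n) * ∏ j, ∏ i, w i j = ∏ j, ∏ i, K * w i j := by
      simp [Finset.prod_mul_distrib, pow_mul]
    rw [hKw]
    refine Finset.prod_le_prod (fun _ _ => norm_nonneg _) fun j _ => ?_
    refine (h _ _).trans ?_
    -- Of column j only the factor in row `σ j` is needed; all the others are at least 1.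
    rw [← Finset.mul_prod_erase Finset.univ _ (Finset.mem_univ (σ j))]
    refine le_mul_of_one_le_right ?_ ?_
    · have := hw (σ j) j
      positivity
    · exact Finset.prod_induction _ (fun a => (1 : ℝ) ≤ a)
        (fun _ _ => one_le_mul_of_one_le_of_one_le) le_rfl
        fun i _ => one_le_mul_of_one_le_of_one_le hK (hw _ _)
  rw [det_apply', mul_assoc]
  refine (norm_sum_le _ _).trans ((Finset.sum_le_card_nsmul _ _ _ fun σ _ => hterm σ).trans ?_)
  simp [Fintype.card_perm]

lemma norm_adjugate_le {n : ℕ} (A : Matrix (Fin n) (Fin n) ℂ) {w : Fin n → Fin n → ℝ} {K : ℝ}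
    (hK : 1 ≤ K) (hw : ∀ i j, 1 ≤ w i j) (h : ∀ i j, ‖A i j‖ ≤ K * w i j) (i j : Fin n) :
    ‖A.adjugate i j‖ ≤ n.factorial * K ^ (n * n) * ∏ i, ∏ j, w i j := by
  rw [adjugate_apply]
  refine norm_det_le _ hK hw fun k l => ?_
  rw [updateRow_apply]
  split_ifs with hk
  · have h1 := one_le_mul_of_one_le_of_one_le hK (hw k l)
    rw [Pi.single_apply]
    split_ifs <;> simp <;> linarith
  · exact h k l

end Matrix

/-! ### Blocks of independent variables -/

section Independence

variable {Ω : Type*} [MeasurableSpace Ω] {P : Measure Ω}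

/-- Functions of disjoint blocks of independent random variables are independent. -/
lemma ProbabilityTheory.iIndepFun.of_blocks {ι κ β γ : Type*} [MeasurableSpace β]
    [MeasurableSpace γ] {Y : ι → Ω → β} (hY : iIndepFun Y P) (hm : ∀ i, Measurable (Y i))
    (b : ι → κ) {Z : κ → Ω → γ}
    (hZ : ∀ k, Measurable[⨆ i ∈ b ⁻¹' {k}, MeasurableSpace.comap (Y i) inferInstance] (Z k)) :
    iIndepFun Z P := by
  classical
  have := hY.isProbabilityMeasure
  rw [iIndepFun_iff]
  intro S
  induction S using Finset.induction_on with
  | empty => simp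
  | insert k S hk ih =>
    intro f hf
    rw [Finset.set_biInter_insert, Finset.prod_insert hk,
      ← ih fun i hi => hf i (Finset.mem_insert_of_mem hi)]
    -- The block of k is disjoint from the union of the blocks in S, so the event attached to k
    -- splits off from the intersection handled by induction.
    have hdis : Disjoint (b ⁻¹' {k}) (b ⁻¹' (S : Set κ)) := by
      refine Disjoint.preimage _ ?_
      simpa using hk
    have hind := indep_iSup_of_disjoint (fun i => (hm i).comap_le) hY.iIndep hdis
    refine (Indep_iff _ _ _).1 hind _ _ ?_ ?_
    · exact (hZ k).comap_le _ (hf k (Finset.mem_insert_self _ _))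
    · refine Finset.measurableSet_biInter _ fun i hi => ?_
      have hle : (⨆ j ∈ b ⁻¹' {i}, MeasurableSpace.comap (Y j) inferInstance) ≤
          ⨆ j ∈ b ⁻¹' (S : Set κ), MeasurableSpace.comap (Y j) inferInstance :=
        biSup_mono fun j hj => by
          have : b j = i := hj
          simpa [this] using hi
      exact hle _ ((hZ i).comap_le _ (hf i (Finset.mem_insert_of_mem hi)))

/-- Independence makes the joint law a product measure, to which Fubini applies. -/
lemma ProbabilityTheory.iIndepFun.integrable_fintype_prod {ι β : Type*} [Fintype ι]
    [MeasurableSpace β] {Y : ι → Ω → β} (hY : iIndepFun Y P) (hm : ∀ i, Measurable (Y i))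
    {f : β → ℝ} (hf : Measurable f) (hint : ∀ i, Integrable (fun ω => f (Y i ω)) P) :
    Integrable (fun ω => ∏ i, f (Y i ω)) P := by
  have := hY.isProbabilityMeasure
  have hmap := hY.map_fun_eq_pi_map fun i => (hm i).aemeasurable
  have : ∀ i, IsProbabilityMeasure (P.map (Y i)) := fun i =>
    Measure.isProbabilityMeasure_map (hm i).aemeasurable
  have h : Integrable (fun y : ι → β => ∏ i, f (y i)) (P.map fun ω i => Y i ω) := by
    rw [hmap]
    refine Integrable.fintype_prod fun i => ?_
    rw [integrable_map_measure hf.aestronglyMeasurable (hm i).aemeasurable]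
    exact hint i
  rwa [integrable_map_measure (by
    exact (Finset.measurable_prod _ fun i _ =>
      hf.comp (measurable_pi_apply i)).aestronglyMeasurable)
    (measurable_pi_lambda _ hm).aemeasurable] at h

end Independence

/-! ### Wigner arrays: generated σ-algebras and the integrable envelope -/

/-- The pairs indexing the diagonal and upper triangular entries. -/
abbrev UpperPair : Type := {p : ℕ × ℕ // p.1 ≤ p.2}

/-- An infinite Hermitian array of complex random variables with independent entries on and above
the diagonal, with the moments of a Wigner matrix whose entries above the diagonal have
fourth absolute moment `2 + κ`. -/
structure IsWignerArray {Ω : Type*} [MeasurableSpace Ω] (P : Measure Ω) (κ : ℂ)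
    (H : ℕ → ℕ → Ω → ℂ) : Prop where
  measurable : ∀ i j, Measurable (H i j)
  conj : ∀ i j ω, H j i ω = (starRingEnd ℂ) (H i j ω)
  indep : iIndepFun (fun p : UpperPair => H p.1.1 p.1.2) P
  memLp : ∀ i j, MemLp (H i j) 4 P
  integral_diag : ∀ i, ∫ ω, H i i ω ∂P = 0
  integral_diag_sq : ∀ i, ∫ ω, H i i ω * H i i ω ∂P = 1
  integral_eq_zero : ∀ i j, i < j → ∫ ω, H i j ω ∂P = 0
  integral_sq : ∀ i j, i < j → ∫ ω, H i j ω * H i j ω ∂P = 0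
  integral_normSq : ∀ i j, i < j → ∫ ω, H i j ω * H j i ω ∂P = 1
  integral_normSq_sq : ∀ i j, i < j → ∫ ω, H i j ω * H j i ω * (H i j ω * H j i ω) ∂P = 2 + κ

namespace IsWignerArray

/-- The product of all `1 + |H (s i) (s j)|`. -/
noncomputable def envelope {Ω : Type*} (H : ℕ → ℕ → Ω → ℂ) {n : ℕ} (s : Fin n → ℕ) (ω : Ω) : ℝ :=
  ∏ i, ∏ j, (1 + ‖H (s i) (s j) ω‖)

lemma one_le_envelope {Ω : Type*} (H : ℕ → ℕ → Ω → ℂ) {n : ℕ} (s : Fin n → ℕ) (ω : Ω) :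
    1 ≤ envelope H s ω :=
  Finset.prod_induction _ (fun a => (1 : ℝ) ≤ a) (fun _ _ => one_le_mul_of_one_le_of_one_le) le_rfl
    fun _ _ => Finset.prod_induction _ (fun a => (1 : ℝ) ≤ a)
      (fun _ _ => one_le_mul_of_one_le_of_one_le) le_rfl fun _ _ => by simp

variable {Ω : Type*} [MeasurableSpace Ω] {P : Measure Ω} {κ : ℂ} {H : ℕ → ℕ → Ω → ℂ}

/-- The `σ`-algebra generated by the entries with indices in `S`. -/
@[reducible]
noncomputable def sigma (H : ℕ → ℕ → Ω → ℂ) (S : Set UpperPair) : MeasurableSpace Ω :=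
  ⨆ p ∈ S, MeasurableSpace.comap (H p.1.1 p.1.2) inferInstance

lemma measurable_sigma (hH : IsWignerArray P κ H) {S : Set UpperPair} {i j : ℕ}
    (h : ∀ hij : i ≤ j, (⟨(i, j), hij⟩ : UpperPair) ∈ S)
    (h' : ∀ hij : j ≤ i, (⟨(j, i), hij⟩ : UpperPair) ∈ S) :
    Measurable[sigma H S] (H i j) := by
  have key : ∀ p : UpperPair, p ∈ S → Measurable[sigma H S] (H p.1.1 p.1.2) := fun p hp =>
    Measurable.of_comap_le (le_biSup (fun p : UpperPair =>
      MeasurableSpace.comap (H p.1.1 p.1.2) inferInstance) hp)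
  rcases le_total i j with hij | hij
  · exact key _ (h hij)
  · have := (Complex.continuous_conj.measurable).comp (key _ (h' hij))
    have he : H i j = (starRingEnd ℂ) ∘ H j i := funext fun ω => hH.conj j i ω
    rw [he]
    exact this

lemma indepFun (hH : IsWignerArray P κ H) {S T : Set UpperPair} (hST : Disjoint S T)
    {f g : Ω → ℂ} (hf : Measurable[sigma H S] f) (hg : Measurable[sigma H T] g) :
    IndepFun f g P := by
  have := indep_iSup_of_disjoint (fun p : UpperPair => (hH.measurable p.1.1 p.1.2).comap_le)
    hH.indep.iIndep hST
  rw [IndepFun_iff_Indep]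
  exact indep_of_indep_of_le_left (indep_of_indep_of_le_right this hg.comap_le) hf.comap_le

lemma sigma_le (hH : IsWignerArray P κ H) (S : Set UpperPair) : sigma H S ≤ ‹MeasurableSpace Ω› :=
  iSup₂_le fun p _ => (hH.measurable p.1.1 p.1.2).comap_le

lemma integral_mul (hH : IsWignerArray P κ H) {S T : Set UpperPair} (hST : Disjoint S T)
    {f g : Ω → ℂ} (hf : Measurable[sigma H S] f) (hg : Measurable[sigma H T] g) :
    ∫ ω, f ω * g ω ∂P = (∫ ω, f ω ∂P) * ∫ ω, g ω ∂P :=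
  (hH.indepFun hST hf hg).integral_fun_mul_eq_mul_integral
    (hf.mono (hH.sigma_le S) le_rfl).aestronglyMeasurable
    (hg.mono (hH.sigma_le T) le_rfl).aestronglyMeasurable

lemma integrable_mul (hH : IsWignerArray P κ H) {S T : Set UpperPair} (hST : Disjoint S T)
    {f g : Ω → ℂ} (hf : Measurable[sigma H S] f) (hg : Measurable[sigma H T] g)
    (hf' : Integrable f P) (hg' : Integrable g P) : Integrable (fun ω => f ω * g ω) P :=
  (hH.indepFun hST hf hg).integrable_mul hf' hg'

lemma norm_symm (hH : IsWignerArray P κ H) (i j : ℕ) (ω : Ω) : ‖H j i ω‖ = ‖H i j ω‖ := by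
  rw [hH.conj i j, RCLike.norm_conj]

lemma measurable_envelope (hH : IsWignerArray P κ H) {n : ℕ} (s : Fin n → ℕ) :
    Measurable (envelope H s) :=
  Finset.measurable_prod _ fun _ _ => Finset.measurable_prod _ fun _ _ =>
    measurable_const.add (hH.measurable _ _).norm

lemma integrable_one_add_norm_pow (hH : IsWignerArray P κ H) (i j : ℕ) :
    Integrable (fun ω => (1 + ‖H i j ω‖) ^ 4) P := by
  have := hH.indep.isProbabilityMeasure
  have h4 : MemLp (fun ω => 1 + ‖H i j ω‖) ((4 : ℕ) : ENNReal) P := by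
    have := (memLp_const (p := 4) (μ := P) (1 : ℝ)).add (hH.memLp i j).norm
    exact_mod_cast this
  refine (h4.integrable_norm_pow (by norm_num)).congr (ae_of_all _ fun ω => ?_)
  simp only [Real.norm_eq_abs]
  rw [abs_of_nonneg (by positivity)]

lemma integrable_envelope_sq (hH : IsWignerArray P κ H) {n : ℕ} {s : Fin n → ℕ}
    (hs : StrictMono s) : Integrable (fun ω => envelope H s ω ^ 2) P := by
  have := hH.indep.isProbabilityMeasure
  let Q := {q : Fin n × Fin n // q.1 ≤ q.2}
  have hind : iIndepFun (fun q : Q => H (s q.1.1) (s q.1.2)) P := by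
    refine hH.indep.precomp (g := fun q : Q => (⟨(s q.1.1, s q.1.2), hs.monotone q.2⟩ : UpperPair))
      fun q q' h => ?_
    simp only [Subtype.mk.injEq, Prod.mk.injEq, hs.injective.eq_iff] at h
    exact Subtype.ext (Prod.ext h.1 h.2)
  have hint := hind.integrable_fintype_prod (fun q => hH.measurable _ _)
    (f := fun z => (1 + ‖z‖) ^ 4) (by fun_prop) fun q => hH.integrable_one_add_norm_pow _ _
  refine hint.mono' ((hH.measurable_envelope s).pow_const 2).aestronglyMeasurable
    (ae_of_all _ fun ω => ?_)
  have h0 : 0 ≤ envelope H s ω := zero_le_one.trans (one_le_envelope H s ω)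
  rw [Real.norm_eq_abs, abs_of_nonneg (by positivity)]
  -- An off-diagonal modulus occurs twice in the envelope, once for each order of the indices, so
  -- the squared envelope contains only fourth powers of independent entries. On the diagonal the
  -- bound gives away one factor that is at least 1.
  have hle : envelope H s ω ≤ ∏ q : Q, (1 + ‖H (s q.1.1) (s q.1.2) ω‖) ^ 2 := by
    let w : Fin n → Fin n → ℝ := fun i j => 1 + ‖H (s i) (s j) ω‖
    have hw : ∀ i j, w i j = w j i := fun i j => by simp only [w, hH.norm_symm (s j) (s i)]
    have hw1 : ∀ i j, 1 ≤ w i j := fun i j => by simp [w]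
    have h1 : ∏ q : Q, w q.1.1 q.1.2 = ∏ i, ∏ j, if i ≤ j then w i j else 1 := by
      rw [← Fintype.prod_prod_type', ← Finset.prod_filter]
      exact (Finset.prod_subtype (p := fun q : Fin n × Fin n => q.1 ≤ q.2) _
        (fun q => by simp) (fun q => w q.1 q.2)).symm
    have h2 : envelope H s ω = (∏ i, ∏ j, if i ≤ j then w i j else 1) *
        ∏ i, ∏ j, if j < i then w i j else 1 := by
      simp only [← Finset.prod_mul_distrib, envelope]
      refine Finset.prod_congr rfl fun i _ => Finset.prod_congr rfl fun j _ => ?_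
      rcases le_or_gt i j with h | h
      · simp [h, h.not_gt, w]
      · simp [h, h.not_ge, w]
    have h3 : (∏ i, ∏ j, if j < i then w i j else 1) ≤ ∏ i, ∏ j, if i ≤ j then w i j else 1 := by
      rw [Finset.prod_comm]
      refine Finset.prod_le_prod (fun i _ => Finset.prod_nonneg fun j _ => ?_) fun i _ =>
        Finset.prod_le_prod (fun j _ => ?_) fun j _ => ?_
      · have := hw1 j i; split_ifs <;> linarith
      · have := hw1 j i; split_ifs <;> linarith
      · have := hw1 i j
        rw [hw j i]
        by_cases h : i < j
        · simp [h, h.le]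
        · simp only [h, if_false]; split_ifs <;> linarith
    rw [Finset.prod_pow, sq, h1, h2]
    refine mul_le_mul_of_nonneg_left h3 (Finset.prod_nonneg fun i _ => Finset.prod_nonneg
      fun j _ => ?_)
    have := hw1 i j; split_ifs <;> linarith
  calc envelope H s ω ^ 2 ≤ (∏ q : Q, (1 + ‖H (s q.1.1) (s q.1.2) ω‖) ^ 2) ^ 2 := by gcongr
    _ = _ := by rw [← Finset.prod_pow]; refine Finset.prod_congr rfl fun q _ => ?_; ring

end IsWignerArray

/-! ### Shifted minors and domination by the envelope -/

namespace Matrix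

variable {Ω n : Type*} [Fintype n] [DecidableEq n]

lemma measurable_det_of_entries {m : MeasurableSpace Ω} {A : Ω → Matrix n n ℂ}
    (h : ∀ i j, Measurable[m] fun ω => A ω i j) : Measurable[m] fun ω => (A ω).det := by
  simp only [det_apply']
  exact Finset.measurable_sum _ fun σ _ => (Finset.measurable_prod _ fun i _ => h _ _).const_mul _

lemma measurable_adjugate_of_entries {m : MeasurableSpace Ω} {A : Ω → Matrix n n ℂ}
    (h : ∀ i j, Measurable[m] fun ω => A ω i j) (i j : n) :
    Measurable[m] fun ω => (A ω).adjugate i j := by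
  simp only [adjugate_apply]
  refine measurable_det_of_entries fun k l => ?_
  simp only [updateRow_apply]
  split_ifs
  · exact measurable_const
  · exact h k l

end Matrix

namespace IsWignerArray

/-- The matrix `(H (s i) (s j) - x δ i j)`. -/
noncomputable def shifted {Ω : Type*} (H : ℕ → ℕ → Ω → ℂ) {n : ℕ} (s : Fin n → ℕ) (x : ℂ) (ω : Ω) :
    Matrix (Fin n) (Fin n) ℂ :=
  Matrix.of (fun i j => H (s i) (s j) ω) - x • 1

lemma shifted_submatrix {Ω : Type*} (H : ℕ → ℕ → Ω → ℂ) {n m : ℕ} (s : Fin n → ℕ) (x : ℂ) (ω : Ω)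
    {e : Fin m → Fin n} (he : e.Injective) :
    (shifted H s x ω).submatrix e e = shifted H (s ∘ e) x ω := by
  ext i j
  simp [shifted, Matrix.one_apply, he.eq_iff]

lemma norm_shifted_apply_le {Ω : Type*} (H : ℕ → ℕ → Ω → ℂ) {n : ℕ} (s : Fin n → ℕ) (x : ℂ) (ω : Ω)
    (i j : Fin n) : ‖shifted H s x ω i j‖ ≤ (1 + ‖x‖) * (1 + ‖H (s i) (s j) ω‖) := by
  have h1 : ‖shifted H s x ω i j‖ ≤ ‖H (s i) (s j) ω‖ + ‖x‖ := by
    refine (norm_sub_le _ _).trans (add_le_add le_rfl ?_)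
    rw [Matrix.smul_apply, Matrix.one_apply]
    split_ifs <;> simp
  nlinarith [norm_nonneg x, norm_nonneg (H (s i) (s j) ω)]

lemma norm_det_shifted_le {Ω : Type*} (H : ℕ → ℕ → Ω → ℂ) {n : ℕ} (s : Fin n → ℕ) (x : ℂ) (ω : Ω) :
    ‖(shifted H s x ω).det‖ ≤ n.factorial * (1 + ‖x‖) ^ (n * n) * envelope H s ω :=
  Matrix.norm_det_le _ (by simp) (fun _ _ => by simp) (norm_shifted_apply_le H s x ω)

lemma norm_adjugate_shifted_le {Ω : Type*} (H : ℕ → ℕ → Ω → ℂ) {n : ℕ} (s : Fin n → ℕ) (x : ℂ)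
    (ω : Ω) (i j : Fin n) :
    ‖(shifted H s x ω).adjugate i j‖ ≤ n.factorial * (1 + ‖x‖) ^ (n * n) * envelope H s ω :=
  Matrix.norm_adjugate_le _ (by simp) (fun _ _ => by simp) (norm_shifted_apply_le H s x ω) i j

lemma norm_trace_adjugate_shifted_le {Ω : Type*} (H : ℕ → ℕ → Ω → ℂ) {n : ℕ} (s : Fin n → ℕ) (x : ℂ)
    (ω : Ω) :
    ‖(shifted H s x ω).adjugate.trace‖ ≤
      n * (n.factorial * (1 + ‖x‖) ^ (n * n)) * envelope H s ω := by
  refine (norm_sum_le _ _).trans ((Finset.sum_le_card_nsmul _ _ _ fun i _ =>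
    norm_adjugate_shifted_le H s x ω i i).trans ?_)
  simp [mul_assoc]

variable {Ω : Type*} [MeasurableSpace Ω] {P : Measure Ω} {κ : ℂ} {H : ℕ → ℕ → Ω → ℂ}

/-- Random variables bounded by a multiple of the envelope. -/
def Dominated (H : ℕ → ℕ → Ω → ℂ) {n : ℕ} (s : Fin n → ℕ) (f : Ω → ℂ) : Prop :=
  Measurable f ∧ ∃ C : ℝ, ∀ ω, ‖f ω‖ ≤ C * envelope H s ω

/-- One envelope for each factor: this is what four moments pay for, and second moments of
determinants need no more. -/
lemma Dominated.integrable_mul (hH : IsWignerArray P κ H) {n : ℕ} {s : Fin n → ℕ}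
    (hs : StrictMono s) {f g : Ω → ℂ} (hf : Dominated H s f) (hg : Dominated H s g) :
    Integrable (fun ω => f ω * g ω) P := by
  obtain ⟨hfm, C, hC⟩ := hf
  obtain ⟨hgm, C', hC'⟩ := hg
  refine ((hH.integrable_envelope_sq hs).const_mul (C * C')).mono'
    (hfm.mul hgm).aestronglyMeasurable (ae_of_all _ fun ω => ?_)
  rw [norm_mul]
  calc ‖f ω‖ * ‖g ω‖ ≤ (C * envelope H s ω) * (C' * envelope H s ω) :=
        mul_le_mul (hC ω) (hC' ω) (norm_nonneg _) ((norm_nonneg _).trans (hC ω))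
    _ = _ := by ring

lemma Dominated.memLp (hH : IsWignerArray P κ H) {n : ℕ} {s : Fin n → ℕ}
    (hs : StrictMono s) {f : Ω → ℂ} (hf : Dominated H s f) : MemLp f 2 P := by
  rw [memLp_two_iff_integrable_sq_norm hf.1.aestronglyMeasurable]
  refine (Dominated.integrable_mul hH hs hf hf).norm.congr (ae_of_all _ fun ω => ?_)
  simp [sq]

lemma dominated_one {n : ℕ} (s : Fin n → ℕ) : Dominated H s fun _ => 1 :=
  ⟨measurable_const, 1, fun ω => by simpa using one_le_envelope H s ω⟩

lemma measurable_shifted_apply (hH : IsWignerArray P κ H) {n : ℕ} (s : Fin n → ℕ) (x : ℂ)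
    (i j : Fin n) : Measurable fun ω => shifted H s x ω i j :=
  (hH.measurable _ _).sub_const _

lemma dominated_det (hH : IsWignerArray P κ H) {n : ℕ} (s : Fin n → ℕ) (x : ℂ) :
    Dominated H s fun ω => (shifted H s x ω).det :=
  ⟨Matrix.measurable_det_of_entries (hH.measurable_shifted_apply s x), _,
    norm_det_shifted_le H s x⟩

lemma dominated_adjugate (hH : IsWignerArray P κ H) {n : ℕ} (s : Fin n → ℕ) (x : ℂ)
    (i j : Fin n) : Dominated H s fun ω => (shifted H s x ω).adjugate i j :=
  ⟨Matrix.measurable_adjugate_of_entries (hH.measurable_shifted_apply s x) i j, _,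
    fun ω => norm_adjugate_shifted_le H s x ω i j⟩

lemma dominated_trace (hH : IsWignerArray P κ H) {n : ℕ} (s : Fin n → ℕ) (x : ℂ) :
    Dominated H s fun ω => (shifted H s x ω).adjugate.trace :=
  ⟨Finset.measurable_sum _ fun i _ => (hH.dominated_adjugate s x i i).1, _,
    norm_trace_adjugate_shifted_le H s x⟩

/-- Differentiation of the characteristic polynomial under the integral sign. -/
lemma hasDerivAt_integral_det_mul (hH : IsWignerArray P κ H) {n : ℕ} {s : Fin n → ℕ}
    (hs : StrictMono s) {Z : Ω → ℂ} (hZ : Dominated H s Z) (x : ℂ) :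
    HasDerivAt (fun x => ∫ ω, (shifted H s x ω).det * Z ω ∂P)
      (-∫ ω, (shifted H s x ω).adjugate.trace * Z ω ∂P) x := by
  obtain ⟨hZm, C, hC⟩ := hZ
  have h := hasDerivAt_integral_of_dominated_loc_of_deriv_le (μ := P) (𝕜 := ℂ)
    (F := fun x ω => (shifted H s x ω).det * Z ω)
    (F' := fun x ω => -(shifted H s x ω).adjugate.trace * Z ω) (x₀ := x)
    -- On the unit ball around x one has 1 + ‖y‖ ≤ 2 + ‖x‖, which makes the bound for the trace
    -- uniform in y.
    (bound := fun ω => n * (n.factorial * (2 + ‖x‖) ^ (n * n)) * C * envelope H s ω ^ 2)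
    (Metric.ball_mem_nhds x zero_lt_one)
    (Eventually.of_forall fun x => ((hH.dominated_det s x).1.mul hZm).aestronglyMeasurable)
    (Dominated.integrable_mul hH hs (hH.dominated_det s x) ⟨hZm, C, hC⟩)
    ((hH.dominated_trace s x).1.neg.mul hZm).aestronglyMeasurable
    (ae_of_all _ fun ω y hy => by
      have hy' : ‖y‖ ≤ 1 + ‖x‖ := by
        have h1 := norm_sub_norm_le y x
        rw [Metric.mem_ball, dist_eq_norm] at hy
        linarith
      have h0 := zero_le_one.trans (one_le_envelope H s ω)
      have h1 := norm_trace_adjugate_shifted_le H s y ω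
      have h2 : n * (n.factorial * (1 + ‖y‖) ^ (n * n)) * envelope H s ω ≤
          n * (n.factorial * (2 + ‖x‖) ^ (n * n)) * envelope H s ω := by
        have h3 : (1 + ‖y‖) ^ (n * n) ≤ (2 + ‖x‖) ^ (n * n) :=
          pow_le_pow_left₀ (by positivity) (by linarith) _
        gcongr
      rw [norm_mul, norm_neg]
      calc _ ≤ (n * (n.factorial * (2 + ‖x‖) ^ (n * n)) * envelope H s ω) *
            (C * envelope H s ω) := mul_le_mul (h1.trans h2) (hC ω) (norm_nonneg _) (by positivity)
        _ = _ := by ring)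
    ((hH.integrable_envelope_sq hs).const_mul _)
    (ae_of_all _ fun ω y _ => (Matrix.hasDerivAt_det_sub_smul_one _ y).mul_const _)
  refine h.2.congr_deriv ?_
  simp [integral_neg]

/-! ### Moments of the border row -/

section Moments

variable {n : ℕ} {a : ℕ} {t : Fin n → ℕ}

lemma measurable_upper (hH : IsWignerArray P κ H) (ha : ∀ i, a < t i) {S : Set UpperPair}
    {i : Fin n} (hi : (⟨(a, t i), (ha i).le⟩ : UpperPair) ∈ S) :
    Measurable[sigma H S] (H a (t i)) ∧ Measurable[sigma H S] (H (t i) a) :=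
  ⟨hH.measurable_sigma (fun _ => hi) fun h => absurd (ha i) h.not_gt,
    hH.measurable_sigma (fun h => absurd (ha i) h.not_gt) fun _ => hi⟩

lemma integral_lower (hH : IsWignerArray P κ H) (ha : ∀ i, a < t i) (i : Fin n) :
    ∫ ω, H (t i) a ω ∂P = 0 := by
  have h : ∀ ω, H (t i) a ω = (starRingEnd ℂ) (H a (t i) ω) := hH.conj _ _
  simp only [h]
  rw [integral_conj, hH.integral_eq_zero _ _ (ha i), map_zero]

lemma integral_border_sq (hH : IsWignerArray P κ H) (ha : ∀ i, a < t i) (ht : t.Injective)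
    (i j : Fin n) : ∫ ω, H a (t i) ω * H (t j) a ω ∂P = if i = j then 1 else 0 := by
  split_ifs with h
  · rw [h]
    exact hH.integral_normSq _ _ (ha j)
  · rw [hH.integral_mul (S := {⟨(a, t i), (ha i).le⟩}) (T := {⟨(a, t j), (ha j).le⟩}) ?_
      (hH.measurable_upper ha (by simp)).1 (hH.measurable_upper ha (by simp)).2,
      hH.integral_eq_zero _ _ (ha i), zero_mul]
    simpa [ht.eq_iff] using h

/-- Only pairings of an entry with a conjugate survive: i = j, k = l and i = l, k = j. When all four
indices agree, both pairings count, giving 2, and κ supplies the rest of the fourth absolute moment.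
-/
lemma integral_border_four (hH : IsWignerArray P κ H) (ha : ∀ i, a < t i) (ht : t.Injective)
    (i j k l : Fin n) :
    ∫ ω, H a (t i) ω * H (t j) a ω * (H a (t k) ω * H (t l) a ω) ∂P =
      (if i = j then (if k = l then 1 else 0) else 0) +
      (if i = l then (if k = j then 1 else 0) else 0) +
      κ * (if i = j then (if k = l then (if i = k then 1 else 0) else 0) else 0) := by
  let p : Fin n → UpperPair := fun i => ⟨(a, t i), (ha i).le⟩
  have hp : ∀ i j, p i = p j ↔ i = j := fun i j => by simp [p, ht.eq_iff]
  have hu : ∀ i, Measurable[sigma H {p i}] (H a (t i)) := fun i =>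
    (hH.measurable_upper ha (by simp [p])).1
  have hl : ∀ i, Measurable[sigma H {p i}] (H (t i) a) := fun i =>
    (hH.measurable_upper ha (by simp [p])).2
  have hu' : ∀ i j, j ≠ i → Measurable[sigma H {p i}ᶜ] (H a (t j)) := fun i j hij =>
    (hH.measurable_upper ha (by simpa [p, ht.eq_iff] using hij)).1
  have hl' : ∀ i j, j ≠ i → Measurable[sigma H {p i}ᶜ] (H (t j) a) := fun i j hij =>
    (hH.measurable_upper ha (by simpa [p, ht.eq_iff] using hij)).2
  have hu0 : ∀ i, ∫ ω, H a (t i) ω ∂P = 0 := fun i => hH.integral_eq_zero _ _ (ha i)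
  have hl0 := hH.integral_lower ha
  -- This removes a factor that is centred and independent of everything else.
  have peel : ∀ (i : Fin n) (f g h : Ω → ℂ), Measurable[sigma H {p i}] f →
      Measurable[sigma H {p i}ᶜ] g → ∫ ω, f ω ∂P = 0 → (∀ ω, h ω = f ω * g ω) →
      ∫ ω, h ω ∂P = 0 := fun i f g h hf hg h0 he => by
    simp only [he]
    rw [hH.integral_mul disjoint_compl_right hf hg, h0, zero_mul]
  have pair : ∀ (i j : Fin n) (f g h : Ω → ℂ), j ≠ i → Measurable[sigma H {p i}] f →
      Measurable[sigma H {p j}] g → (∀ ω, h ω = f ω * g ω) →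
      ∫ ω, h ω ∂P = (∫ ω, f ω ∂P) * ∫ ω, g ω ∂P := fun i j f g h hij hf hg he => by
    simp only [he]
    exact hH.integral_mul (by simpa [hp] using hij.symm) hf hg
  by_cases hij : i = j
  · subst hij
    by_cases hkl : k = l
    · subst hkl
      by_cases hik : i = k
      · subst hik
        simp [hH.integral_normSq_sq _ _ (ha i)]
        norm_num
      · rw [pair i k (fun ω => H a (t i) ω * H (t i) a ω) (fun ω => H a (t k) ω * H (t k) a ω) _
          (Ne.symm hik) ((hu i).mul (hl i)) ((hu k).mul (hl k)) fun ω => rfl,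
          hH.integral_normSq _ _ (ha i), hH.integral_normSq _ _ (ha k)]
        simp [hik]
    · by_cases hik : i = k
      · subst hik
        rw [peel l _ (fun ω => H a (t i) ω * H (t i) a ω * H a (t i) ω) _ (hl l)
          (((hu' l i hkl).mul (hl' l i hkl)).mul (hu' l i hkl)) (hl0 l) fun ω => by ring]
        simp [hkl]
      · rw [peel k _ (fun ω => H a (t i) ω * H (t i) a ω * H (t l) a ω) _ (hu k)
          (((hu' k i hik).mul (hl' k i hik)).mul (hl' k l (Ne.symm hkl))) (hu0 k)
          fun ω => by ring]
        simp [hkl, Ne.symm hik]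
  · by_cases hil : i = l
    · subst hil
      by_cases hkj : k = j
      · subst hkj
        rw [pair i k (fun ω => H a (t i) ω * H (t i) a ω) (fun ω => H a (t k) ω * H (t k) a ω) _
          (Ne.symm hij) ((hu i).mul (hl i)) ((hu k).mul (hl k)) fun ω => by ring,
          hH.integral_normSq _ _ (ha i), hH.integral_normSq _ _ (ha k)]
        simp [hij]
      · by_cases hki : k = i
        · subst hki
          rw [peel j _ (fun ω => H a (t k) ω * H (t k) a ω * H a (t k) ω) _ (hl j)
            (((hu' j k hij).mul (hl' j k hij)).mul (hu' j k hij)) (hl0 j) fun ω => by ring]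
          simp [hij]
        · rw [peel k _ (fun ω => H a (t i) ω * H (t j) a ω * H (t i) a ω) _ (hu k)
            (((hu' k i (Ne.symm hki)).mul (hl' k j (Ne.symm hkj))).mul (hl' k i (Ne.symm hki)))
            (hu0 k) fun ω => by ring]
          simp [hij, hkj]
    · by_cases hik : i = k
      · subst hik
        by_cases hjl : j = l
        · subst hjl
          -- The remaining pairing i = k, j = l vanishes because the square of an off-diagonal entry
          -- has mean zero; real symmetric matrices would differ here.
          rw [pair i j (fun ω => H a (t i) ω * H a (t i) ω) (fun ω => H (t j) a ω * H (t j) a ω) _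
            (Ne.symm hij) ((hu i).mul (hu i)) ((hl j).mul (hl j)) fun ω => by ring,
            hH.integral_sq _ _ (ha i), zero_mul]
          simp [hij]
        · rw [peel j _ (fun ω => H a (t i) ω * H a (t i) ω * H (t l) a ω) _ (hl j)
            (((hu' j i hij).mul (hu' j i hij)).mul (hl' j l (Ne.symm hjl))) (hl0 j)
            fun ω => by ring]
          simp [hij, hil]
      · rw [peel i _ (fun ω => H (t j) a ω * H a (t k) ω * H (t l) a ω) _ (hu i)
          (((hl' i j (Ne.symm hij)).mul (hu' i k (Ne.symm hik))).mul (hl' i l (Ne.symm hil)))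
          (hu0 i) fun ω => by ring]
        simp [hij, hil]

end Moments

end IsWignerArray

/-! ### Recursions obtained by splitting off the border -/

namespace IsWignerArray

lemma det_shifted_succ {Ω : Type*} (H : ℕ → ℕ → Ω → ℂ) {n : ℕ} (s : Fin (n + 1) → ℕ)
    (x : ℂ) (ω : Ω) :
    (shifted H s x ω).det =
      (H (s 0) (s 0) ω - x) * (shifted H (s ∘ Fin.succ) x ω).det -
      ∑ i, ∑ j, H (s 0) (s i.succ) ω * H (s j.succ) (s 0) ω *
        (shifted H (s ∘ Fin.succ) x ω).adjugate i j := by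
  rw [Matrix.det_bordered, shifted_submatrix _ _ _ _ (Fin.succ_injective n)]
  congr 1
  · simp [shifted]
  · refine Finset.sum_congr rfl fun i _ => Finset.sum_congr rfl fun j _ => ?_
    have h1 : shifted H s x ω 0 i.succ = H (s 0) (s i.succ) ω := by
      simp [shifted, (Fin.succ_ne_zero i).symm]
    have h2 : shifted H s x ω j.succ 0 = H (s j.succ) (s 0) ω := by
      simp [shifted, Fin.succ_ne_zero j]
    rw [h1, h2]
    ring

variable {Ω : Type*} [MeasurableSpace Ω] {P : Measure Ω} {κ : ℂ} {H : ℕ → ℕ → Ω → ℂ}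

section Border

variable {n : ℕ} {a : ℕ} {t : Fin n → ℕ}

/-- The pairs with first index `a`. -/
def rowPairs (a : ℕ) : Set UpperPair := {p | p.1.1 = a}

/-- The pairs with first index larger than `a`. -/
def laterPairs (a : ℕ) : Set UpperPair := {p | a < p.1.1}

lemma disjoint_rowPairs (a : ℕ) : Disjoint (rowPairs a) (laterPairs a) := by
  rw [Set.disjoint_left]
  rintro p hp hp'
  simp only [rowPairs, laterPairs, Set.mem_ofPred_eq] at hp hp'
  omega

lemma measurable_later (hH : IsWignerArray P κ H) (ha : ∀ i, a < t i) (x : ℂ) (i j : Fin n) :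
    Measurable[sigma H (laterPairs a)] fun ω => shifted H t x ω i j :=
  (hH.measurable_sigma (fun _ => ha i) fun _ => ha j).sub_const _

lemma measurable_row (hH : IsWignerArray P κ H) (ha : ∀ i, a < t i) (i j : Fin n) :
    Measurable[sigma H (rowPairs a)] fun ω => H a (t i) ω * H (t j) a ω :=
  (hH.measurable_upper ha (by simp [rowPairs])).1.mul
    (hH.measurable_upper ha (by simp [rowPairs])).2

lemma measurable_diag (hH : IsWignerArray P κ H) (a : ℕ) :
    Measurable[sigma H (rowPairs a)] (H a a) :=
  hH.measurable_sigma (fun _ => rfl) fun _ => rfl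

lemma memLp_mul (hH : IsWignerArray P κ H) (i j k l : ℕ) :
    MemLp (fun ω => H i j ω * H k l ω) 2 P := by
  have : ENNReal.HolderTriple 4 4 2 := ⟨by
    rw [← ENNReal.toReal_eq_toReal_iff' (by simp) (by simp)]
    simp [ENNReal.toReal_add]
    norm_num⟩
  exact (hH.memLp k l).mul' (hH.memLp i j)

lemma memLp_diag_sub (hH : IsWignerArray P κ H) (a : ℕ) (x : ℂ) :
    MemLp (fun ω => H a a ω - x) 2 P := by
  have := hH.indep.isProbabilityMeasure
  exact ((hH.memLp a a).mono_exponent (by norm_num)).sub (memLp_const x)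

lemma integral_diag_sub (hH : IsWignerArray P κ H) (a : ℕ) (x : ℂ) :
    ∫ ω, (H a a ω - x) ∂P = -x := by
  have := hH.indep.isProbabilityMeasure
  rw [integral_sub ((hH.memLp a a).integrable (by norm_num)) (integrable_const _),
    hH.integral_diag]
  simp

lemma integral_diag_sub_mul (hH : IsWignerArray P κ H) (a : ℕ) (x y : ℂ) :
    ∫ ω, (H a a ω - x) * (H a a ω - y) ∂P = 1 + x * y := by
  have := hH.indep.isProbabilityMeasure
  have h1 : Integrable (H a a) P := (hH.memLp a a).integrable (by norm_num)
  have h2 : Integrable (fun ω => H a a ω * H a a ω) P :=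
    (hH.memLp_mul a a a a).integrable (by norm_num)
  have h3 : Integrable (fun ω => H a a ω * H a a ω - (x + y) * H a a ω) P :=
    h2.sub (h1.const_mul _)
  have he : ∀ ω, (H a a ω - x) * (H a a ω - y) =
      H a a ω * H a a ω - (x + y) * H a a ω + x * y := fun ω => by ring
  simp only [he]
  rw [integral_add h3 (integrable_const _),
    integral_sub h2 (h1.const_mul _), integral_const_mul, hH.integral_diag, hH.integral_diag_sq]
  simp

lemma integral_diag_sub_mul_border (hH : IsWignerArray P κ H) (ha : ∀ i, a < t i)
    (ht : t.Injective) (x : ℂ) (i j : Fin n) :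
    ∫ ω, (H a a ω - x) * (H a (t i) ω * H (t j) a ω) ∂P = -x * if i = j then 1 else 0 := by
  have hdis : Disjoint ({⟨(a, a), le_rfl⟩} : Set UpperPair) {⟨(a, a), le_rfl⟩}ᶜ :=
    disjoint_compl_right
  have hdm : Measurable[sigma H {⟨(a, a), le_rfl⟩}] (H a a) :=
    hH.measurable_sigma (fun _ => rfl) fun _ => rfl
  have hne : ∀ i, (⟨(a, t i), (ha i).le⟩ : UpperPair) ∈ ({⟨(a, a), le_rfl⟩}ᶜ : Set UpperPair) :=
    fun i => by simpa using (ha i).ne'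
  rw [hH.integral_mul (f := fun ω => H a a ω - x) (g := fun ω => H a (t i) ω * H (t j) a ω) hdis
    (hdm.sub_const x)
    ((hH.measurable_upper ha (hne i)).1.mul (hH.measurable_upper ha (hne j)).2),
    hH.integral_diag_sub, hH.integral_border_sq ha ht]

lemma measurable_det_later (hH : IsWignerArray P κ H) (ha : ∀ i, a < t i) (x : ℂ) :
    Measurable[sigma H (laterPairs a)] fun ω => (shifted H t x ω).det :=
  Matrix.measurable_det_of_entries fun i j => hH.measurable_later ha x i j

lemma measurable_adjugate_later (hH : IsWignerArray P κ H) (ha : ∀ i, a < t i) (x : ℂ)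
    (i j : Fin n) : Measurable[sigma H (laterPairs a)] fun ω => (shifted H t x ω).adjugate i j :=
  Matrix.measurable_adjugate_of_entries (fun i j => hH.measurable_later ha x i j) i j

lemma border_integral (hH : IsWignerArray P κ H) {f g : Ω → ℂ}
    (hf : Measurable[sigma H (rowPairs a)] f) (hg : Measurable[sigma H (laterPairs a)] g)
    (hf' : Integrable f P) (hg' : Integrable g P) :
    Integrable (fun ω => f ω * g ω) P ∧
      ∫ ω, f ω * g ω ∂P = (∫ ω, f ω ∂P) * ∫ ω, g ω ∂P :=
  ⟨hH.integrable_mul (disjoint_rowPairs a) hf hg hf' hg',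
    hH.integral_mul (disjoint_rowPairs a) hf hg⟩

end Border

/-- The border is independent of the minor, and its second moments keep only i = j, so the double
sum in the bordered expansion collapses to the trace of the adjugate. -/
lemma integral_det_succ (hH : IsWignerArray P κ H) {n : ℕ} {s : Fin (n + 1) → ℕ}
    (hs : StrictMono s) (x : ℂ) :
    ∫ ω, (shifted H s x ω).det ∂P =
      -x * (∫ ω, (shifted H (s ∘ Fin.succ) x ω).det ∂P) -
        ∫ ω, (shifted H (s ∘ Fin.succ) x ω).adjugate.trace ∂P := by
  have := hH.indep.isProbabilityMeasure
  have ht : StrictMono (s ∘ Fin.succ) := hs.comp (Fin.strictMono_succ)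
  have ha : ∀ i, s 0 < (s ∘ Fin.succ) i := fun i => hs (Fin.succ_pos i)
  have hint : ∀ {f : Ω → ℂ}, Dominated H (s ∘ Fin.succ) f → Integrable f P := fun hf => by
    simpa using hf.integrable_mul hH ht (dominated_one _)
  have h1 := hH.border_integral ((hH.measurable_diag (s 0)).sub_const x)
    (hH.measurable_det_later ha x) ((hH.memLp_diag_sub (s 0) x).integrable (by norm_num))
    (hint (hH.dominated_det _ x))
  have h2 := fun i j => hH.border_integral (hH.measurable_row ha i j)
    (hH.measurable_adjugate_later ha x i j) ((hH.memLp_mul _ _ _ _).integrable (by norm_num))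
    (hint (hH.dominated_adjugate _ x i j))
  simp only [Function.comp_apply] at h2
  simp only [det_shifted_succ]
  rw [integral_sub h1.1 (integrable_finsetSum _ fun i _ => integrable_finsetSum _ fun j _ =>
    (h2 i j).1), h1.2, hH.integral_diag_sub]
  congr 1
  rw [integral_finsetSum _ fun i _ => integrable_finsetSum _ fun j _ => (h2 i j).1]
  simp only [Matrix.trace, Matrix.diag_apply]
  rw [integral_finsetSum _ fun i _ => hint (hH.dominated_adjugate _ x i i)]
  refine Finset.sum_congr rfl fun i _ => ?_
  rw [integral_finsetSum _ fun j _ => (h2 i j).1]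
  have hb : ∀ j, ∫ ω, H (s 0) (s i.succ) ω * H (s j.succ) (s 0) ω ∂P = if i = j then 1 else 0 :=
    fun j => hH.integral_border_sq ha ht.injective i j
  simp only [(h2 i _).2, hb]
  simp

/-- Multiply two bordered expansions and average over the border first. The diagonal entry gives 1 +
xy, the cross terms see it only through its mean -x or -y, and the quadruple sum is governed by the
fourth moments of the border. -/
lemma integral_det_mul_det_succ (hH : IsWignerArray P κ H) {n : ℕ} {s : Fin (n + 1) → ℕ}
    (hs : StrictMono s) (x y : ℂ) :
    ∫ ω, (shifted H s x ω).det * (shifted H s y ω).det ∂P =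
      (1 + x * y) *
        (∫ ω, (shifted H (s ∘ Fin.succ) x ω).det * (shifted H (s ∘ Fin.succ) y ω).det ∂P)
      + x * (∫ ω, (shifted H (s ∘ Fin.succ) x ω).det *
          (shifted H (s ∘ Fin.succ) y ω).adjugate.trace ∂P)
      + y * (∫ ω, (shifted H (s ∘ Fin.succ) x ω).adjugate.trace *
          (shifted H (s ∘ Fin.succ) y ω).det ∂P)
      + (∫ ω, (shifted H (s ∘ Fin.succ) x ω).adjugate.trace *
          (shifted H (s ∘ Fin.succ) y ω).adjugate.trace ∂P)
      + (∫ ω, ((shifted H (s ∘ Fin.succ) x ω).adjugate *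
          (shifted H (s ∘ Fin.succ) y ω).adjugate).trace ∂P)
      + κ * ∑ i, ∫ ω, (shifted H (s ∘ Fin.succ) x ω).adjugate i i *
          (shifted H (s ∘ Fin.succ) y ω).adjugate i i ∂P := by
  have := hH.indep.isProbabilityMeasure
  set t := s ∘ Fin.succ with htdef
  have ht : StrictMono t := hs.comp (Fin.strictMono_succ)
  have ha : ∀ i, s 0 < t i := fun i => hs (Fin.succ_pos i)
  set a := s 0
  let D := fun x ω => (shifted H t x ω).det
  let B := fun x i j ω => (shifted H t x ω).adjugate i j
  let V := fun i j ω => H a (t i) ω * H (t j) a ω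
  have hDd : ∀ x, Dominated H t (D x) := hH.dominated_det t
  have hBd : ∀ x i j, Dominated H t (B x i j) := hH.dominated_adjugate t
  have hDm : ∀ x, Measurable[sigma H (laterPairs a)] (D x) := hH.measurable_det_later ha
  have hBm : ∀ x i j, Measurable[sigma H (laterPairs a)] (B x i j) :=
    hH.measurable_adjugate_later ha
  have hVm : ∀ i j, Measurable[sigma H (rowPairs a)] (V i j) := hH.measurable_row ha
  have hV2 : ∀ i j, MemLp (V i j) 2 P := fun i j => hH.memLp_mul _ _ _ _
  have hdm : ∀ x, Measurable[sigma H (rowPairs a)] fun ω => H a a ω - x :=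
    (hH.measurable_diag a).sub_const
  have hd2 := hH.memLp_diag_sub a
  have h1 := hH.border_integral ((hdm x).mul (hdm y)) ((hDm x).mul (hDm y))
    ((hd2 x).integrable_mul (hd2 y)) ((hDd x).integrable_mul hH ht (hDd y))
  have h2 := fun x y i j => hH.border_integral ((hdm x).mul (hVm i j)) ((hDm x).mul (hBm y i j))
    ((hd2 x).integrable_mul (hV2 i j)) ((hDd x).integrable_mul hH ht (hBd y i j))
  have h3 := fun i j k l => hH.border_integral ((hVm i j).mul (hVm k l))
    ((hBm x i j).mul (hBm y k l)) ((hV2 i j).integrable_mul (hV2 k l))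
    ((hBd x i j).integrable_mul hH ht (hBd y k l))
  simp only [Pi.mul_apply] at h1 h2 h3
  have hexp : ∀ ω, (shifted H s x ω).det * (shifted H s y ω).det =
      (H a a ω - x) * (H a a ω - y) * (D x ω * D y ω)
      - (∑ i, ∑ j, (H a a ω - x) * V i j ω * (D x ω * B y i j ω))
      - (∑ i, ∑ j, (H a a ω - y) * V i j ω * (D y ω * B x i j ω))
      + ∑ i, ∑ j, ∑ k, ∑ l, V i j ω * V k l ω * (B x i j ω * B y k l ω) := fun ω => by
    rw [det_shifted_succ, det_shifted_succ]
    have e1 : ∀ x y, (∑ i, ∑ j, (H a a ω - x) * V i j ω * (D x ω * B y i j ω)) =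
        (H a a ω - x) * D x ω * ∑ i, ∑ j, V i j ω * B y i j ω := fun x y => by
      simp only [Finset.mul_sum]
      refine Finset.sum_congr rfl fun i _ => Finset.sum_congr rfl fun j _ => ?_
      ring
    have e2 : ∑ i, ∑ j, ∑ k, ∑ l, V i j ω * V k l ω * (B x i j ω * B y k l ω) =
        (∑ i, ∑ j, V i j ω * B y i j ω) * ∑ i, ∑ j, V i j ω * B x i j ω := by
      simp only [Finset.sum_mul, Finset.mul_sum]
      refine Finset.sum_congr rfl fun i _ => Finset.sum_congr rfl fun j _ =>
        Finset.sum_congr rfl fun k _ => Finset.sum_congr rfl fun l _ => ?_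
      ring
    rw [e1, e1, e2]
    simp only [V, D, B, htdef, Function.comp_apply]
    ring
  have i2 : ∀ x y, Integrable (fun ω => ∑ i, ∑ j, (H a a ω - x) * V i j ω *
      (D x ω * B y i j ω)) P := fun x y => integrable_finsetSum _ fun i _ =>
    integrable_finsetSum _ fun j _ => (h2 x y i j).1
  have s2 : ∀ x y, ∫ ω, ∑ i, ∑ j, (H a a ω - x) * V i j ω * (D x ω * B y i j ω) ∂P =
      -x * ∫ ω, D x ω * ∑ i, B y i i ω ∂P := fun x y => by
    simp only [Finset.mul_sum]
    rw [integral_finsetSum _ fun i _ => integrable_finsetSum _ fun j _ => (h2 x y i j).1,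
      integral_finsetSum _ fun i _ => (hDd x).integrable_mul hH ht (hBd y i i), Finset.mul_sum]
    refine Finset.sum_congr rfl fun i _ => ?_
    rw [integral_finsetSum _ fun j _ => (h2 x y i j).1]
    simp only [(h2 x y i _).2, V, hH.integral_diag_sub_mul_border ha ht.injective]
    simp
  have i4 : Integrable (fun ω => ∑ i, ∑ j, ∑ k, ∑ l, V i j ω * V k l ω *
      (B x i j ω * B y k l ω)) P := integrable_finsetSum _ fun i _ => integrable_finsetSum _
    fun j _ => integrable_finsetSum _ fun k _ => integrable_finsetSum _ fun l _ => (h3 i j k l).1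
  -- The three index patterns of the fourth moments give, in this order, the product of the traces,
  -- the trace of the product, and the diagonal cofactors.
  have s4 : ∫ ω, ∑ i, ∑ j, ∑ k, ∑ l, V i j ω * V k l ω * (B x i j ω * B y k l ω) ∂P =
      (∫ ω, (∑ i, B x i i ω) * ∑ k, B y k k ω ∂P) + (∫ ω, ∑ i, ∑ j, B x i j ω * B y j i ω ∂P)
      + κ * ∑ i, ∫ ω, B x i i ω * B y i i ω ∂P := by
    have hBB : ∀ i j k l, Integrable (fun ω => B x i j ω * B y k l ω) P := fun i j k l =>
      (hBd x i j).integrable_mul hH ht (hBd y k l)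
    simp only [Finset.sum_mul_sum]
    rw [integral_finsetSum _ fun i _ => integrable_finsetSum _ fun j _ =>
        integrable_finsetSum _ fun k _ => integrable_finsetSum _ fun l _ => (h3 i j k l).1,
      integral_finsetSum _ fun i _ => integrable_finsetSum _ fun k _ => hBB i i k k,
      integral_finsetSum _ fun i _ => integrable_finsetSum _ fun j _ => hBB i j j i,
      Finset.mul_sum, ← Finset.sum_add_distrib, ← Finset.sum_add_distrib]
    refine Finset.sum_congr rfl fun i _ => ?_
    rw [integral_finsetSum _ fun j _ =>
        integrable_finsetSum _ fun k _ => integrable_finsetSum _ fun l _ => (h3 i j k l).1,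
      integral_finsetSum _ fun k _ => hBB i i k k, integral_finsetSum _ fun j _ => hBB i j j i]
    have hj : ∀ j, ∫ ω, ∑ k, ∑ l, V i j ω * V k l ω * (B x i j ω * B y k l ω) ∂P =
        (if i = j then ∑ k, ∫ ω, B x i j ω * B y k k ω ∂P else 0)
        + (∫ ω, B x i j ω * B y j i ω ∂P)
        + (if i = j then κ * ∫ ω, B x i j ω * B y i i ω ∂P else 0) := fun j => by
      rw [integral_finsetSum _ fun k _ => integrable_finsetSum _ fun l _ => (h3 i j k l).1]
      have hk : ∀ k, ∫ ω, ∑ l, V i j ω * V k l ω * (B x i j ω * B y k l ω) ∂P =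
          (if i = j then ∫ ω, B x i j ω * B y k k ω ∂P else 0)
          + (if k = j then ∫ ω, B x i j ω * B y k i ω ∂P else 0)
          + (if i = j then (if i = k then κ * ∫ ω, B x i j ω * B y k k ω ∂P else 0) else 0) :=
          fun k => by
        rw [integral_finsetSum _ fun l _ => (h3 i j k l).1]
        simp only [(h3 i j k _).2, V, hH.integral_border_four ha ht.injective, add_mul,
          Finset.sum_add_distrib]
        congr 1
        · congr 1
          · split_ifs <;> simp
          · split_ifs <;> simp
        · split_ifs <;> simp
      simp only [hk, Finset.sum_add_distrib]
      congr 1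
      · congr 1
        · split_ifs <;> simp
        · simp
      · split_ifs <;> simp
    simp only [hj, Finset.sum_add_distrib]
    simp
  have i3 : Integrable (fun ω => (H a a ω - x) * (H a a ω - y) * (D x ω * D y ω)
      - ∑ i, ∑ j, (H a a ω - x) * V i j ω * (D x ω * B y i j ω)) P := h1.1.sub (i2 x y)
  have i3' : Integrable (fun ω => (H a a ω - x) * (H a a ω - y) * (D x ω * D y ω)
      - (∑ i, ∑ j, (H a a ω - x) * V i j ω * (D x ω * B y i j ω))
      - ∑ i, ∑ j, (H a a ω - y) * V i j ω * (D y ω * B x i j ω)) P := i3.sub (i2 y x)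
  simp only [hexp]
  rw [integral_add i3' i4, integral_sub i3 (i2 y x), integral_sub h1.1 (i2 x y), h1.2, s2, s2, s4,
    hH.integral_diag_sub_mul]
  simp only [Matrix.trace, Matrix.diag_apply, Matrix.mul_apply, D, B]
  simp only [mul_comm (shifted H t y _).det]
  ring

end IsWignerArray

/-! ### Solving the recursions -/

lemma hasDerivAt_expConv_left (c : ℂ) (n : ℕ) (x y : ℂ) :
    HasDerivAt (fun x => expConv c (fun m => hermiteKernel m x y) n)
      (expConv c (fun m => hermiteKernelX m x y) n) x :=
  hasDerivAt_expConv c (fun m x => hermiteKernel m x y) (fun m x => hermiteKernelX m x y) x n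
    fun m => hasDerivAt_hermiteKernel_left m x y

lemma hasDerivAt_expConv_right (c : ℂ) (n : ℕ) (x y : ℂ) :
    HasDerivAt (fun y => expConv c (fun m => hermiteKernel m x y) n)
      (expConv c (fun m => hermiteKernelY m x y) n) y :=
  hasDerivAt_expConv c (fun m y => hermiteKernel m x y) (fun m y => hermiteKernelY m x y) y n
    fun m => hasDerivAt_hermiteKernel_right m x y

lemma hasDerivAt_expConv_mixed (c : ℂ) (n : ℕ) (x y : ℂ) :
    HasDerivAt (fun x => expConv c (fun m => hermiteKernelY m x y) n)
      (expConv c (fun m => hermiteKernelXY m x y) n) x :=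
  hasDerivAt_expConv c (fun m x => hermiteKernelY m x y) (fun m x => hermiteKernelXY m x y) x n
    fun m => hasDerivAt_hermiteKernelY_left m x y

namespace IsWignerArray

variable {Ω : Type*} [MeasurableSpace Ω] {P : Measure Ω} {κ : ℂ} {H : ℕ → ℕ → Ω → ℂ}

/-- The expected characteristic polynomial is a Hermite polynomial. -/
theorem integral_det (hH : IsWignerArray P κ H) (n : ℕ) {s : Fin n → ℕ} (hs : StrictMono s)
    (x : ℂ) : ∫ ω, (shifted H s x ω).det ∂P = (-1) ^ n * hermiteFun n x := by
  have := hH.indep.isProbabilityMeasure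
  induction n generalizing x with
  | zero => simp
  | succ n ih =>
    have ht : StrictMono (s ∘ Fin.succ) := hs.comp (Fin.strictMono_succ)
    -- The trace of the adjugate is minus the derivative of the determinant, so differentiating the
    -- induction hypothesis evaluates its mean.
    have h := hH.hasDerivAt_integral_det_mul ht (dominated_one _) x
    simp only [mul_one, ih ht] at h
    have h' := h.unique ((hasDerivAt_hermiteFun n x).const_mul ((-1) ^ n))
    rw [hH.integral_det_succ hs, ih ht, hermiteFun_succ]
    linear_combination h'

/-- The second moment of the characteristic polynomial. -/
theorem integral_det_mul_det (hH : IsWignerArray P κ H) (n : ℕ) {s : Fin n → ℕ}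
    (hs : StrictMono s) (x y : ℂ) :
    ∫ ω, (shifted H s x ω).det * (shifted H s y ω).det ∂P =
      n.factorial * expConv (κ / 2) (fun m => hermiteKernel m x y) n := by
  have := hH.indep.isProbabilityMeasure
  -- The κ term reaches two sizes down, hence strong induction. The index selection `s` and the
  -- points x, y vary along with it.
  induction n using Nat.strong_induction_on generalizing x y with
  | _ n ih =>
  cases n with
  | zero => simp [expConv, hermiteKernel, hermiteTerm]
  | succ n =>
    have hcont : ∀ y, Continuous fun x =>
        ∫ ω, (shifted H s x ω).det * (shifted H s y ω).det ∂P := fun y =>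
      continuous_iff_continuousAt.2 fun x =>
        (hH.hasDerivAt_integral_det_mul hs (hH.dominated_det s y) x).continuousAt
    have hcont' : ∀ y, Continuous fun x => ((n + 1).factorial : ℂ) *
        expConv (κ / 2) (fun m => hermiteKernel m x y) (n + 1) := fun y =>
      continuous_iff_continuousAt.2 fun x =>
        ((hasDerivAt_expConv_left _ _ x y).const_mul _).continuousAt
    -- The trace of the product of adjugates is accessible only after multiplication by x - y; the
    -- value at x = y is recovered by continuity.
    refine congrFun ((hcont y).ext_on (dense_compl_singleton y) (hcont' y) fun x hx => ?_) x
    have hxy : x - y ≠ 0 := sub_ne_zero.2 hx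
    refine mul_left_cancel₀ hxy ?_
    set t := s ∘ Fin.succ
    have ht : StrictMono t := hs.comp (Fin.strictMono_succ)
    have h0 := fun x y => ih n (Nat.lt_succ_self n) ht x y
    have hX : ∀ x y, ∫ ω, (shifted H t x ω).adjugate.trace * (shifted H t y ω).det ∂P =
        -(n.factorial * expConv (κ / 2) (fun m => hermiteKernelX m x y) n) := fun x y => by
      have h := hH.hasDerivAt_integral_det_mul ht (hH.dominated_det t y) x
      simp only [h0] at h
      rw [← h.unique ((hasDerivAt_expConv_left _ _ x y).const_mul _), neg_neg]
    have hY : ∀ x y, ∫ ω, (shifted H t x ω).det * (shifted H t y ω).adjugate.trace ∂P =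
        -(n.factorial * expConv (κ / 2) (fun m => hermiteKernelY m x y) n) := fun x y => by
      have h := hH.hasDerivAt_integral_det_mul ht (hH.dominated_det t x) y
      simp only [mul_comm _ (shifted H t x _).det, h0] at h
      rw [← h.unique ((hasDerivAt_expConv_right _ _ x y).const_mul _), neg_neg]
    have hXY : ∫ ω, (shifted H t x ω).adjugate.trace * (shifted H t y ω).adjugate.trace ∂P =
        n.factorial * expConv (κ / 2) (fun m => hermiteKernelXY m x y) n := by
      have h := hH.hasDerivAt_integral_det_mul ht (hH.dominated_trace t y) x
      simp only [hY] at h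
      have h' := h.unique ((hasDerivAt_expConv_mixed _ _ x y).const_mul _).neg
      exact neg_injective h'
    have hT : (x - y) * ∫ ω, ((shifted H t x ω).adjugate * (shifted H t y ω).adjugate).trace ∂P =
        n.factorial * (expConv (κ / 2) (fun m => hermiteKernelY m x y) n -
          expConv (κ / 2) (fun m => hermiteKernelX m x y) n) := by
      have i1 := (hH.dominated_det t y).integrable_mul hH ht (hH.dominated_trace t x)
      have i2 := (hH.dominated_det t x).integrable_mul hH ht (hH.dominated_trace t y)
      rw [← integral_const_mul]
      simp only [shifted, Matrix.sub_smul_one_adjugate_trace] at i1 i2 ⊢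
      rw [integral_sub i1 i2]
      have e1 := hX x y
      have e2 := hY x y
      simp only [shifted, mul_comm (Matrix.trace _)] at e1 e2
      rw [e1, e2]
      ring
    have hS : ∑ i, ∫ ω, (shifted H t x ω).adjugate i i * (shifted H t y ω).adjugate i i ∂P =
        n.factorial * (if n = 0 then 0 else
          expConv (κ / 2) (fun m => hermiteKernel m x y) (n - 1)) := by
      cases n with
      | zero => simp
      | succ m =>
        -- Diagonal cofactors are principal minors, hence shifted matrices for a smaller increasing
        -- selection. Their second moments depend only on the size, so the m + 1 summands are equal
        -- and m! becomes (m + 1)!.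
        have he : ∀ (x : ℂ) ω i, (shifted H t x ω).adjugate i i =
            (shifted H (t ∘ i.succAbove) x ω).det := fun x ω i => by
          rw [Matrix.adjugate_apply_self,
            shifted_submatrix _ _ _ _ Fin.succAbove_right_injective]
        simp only [he, fun i : Fin (m + 1) => ih m (by omega)
          (ht.comp (Fin.strictMono_succAbove i)) x y]
        simp [Nat.factorial_succ]
        ring
    beta_reduce
    have hrec := expConv_hermiteKernel_recursion (κ / 2) n x y
    rw [hH.integral_det_mul_det_succ hs, h0, hX, hY, hXY, hS, Nat.factorial_succ]
    push_cast
    linear_combination hT - n.factorial * hrec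

end IsWignerArray

/-! ### The array built from `Q` and its exact covariance -/

/-- The fourth moment parameter of a complex entry whose real and imaginary parts have variance
`1/2` and fourth moment `b`. -/
lemma isWignerArray_wignerEntry {Q : Measure ℝ} [IsProbabilityMeasure Q]
    (hmean : ∫ x, x ∂Q = 0) (hvar : ∫ x, x ^ 2 ∂Q = 1 / 2)
    (hfour : Integrable (fun x : ℝ => x ^ 4) Q)
    {Ω : Type*} [MeasurableSpace Ω] {P : Measure Ω} [IsProbabilityMeasure P]
    {D : ℕ → Ω → ℝ} {R J : UpperIndex → Ω → ℝ}
    (hD : ∀ i, HasLaw (D i) Q P) (hR : ∀ p, HasLaw (R p) Q P) (hJ : ∀ p, HasLaw (J p) Q P)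
    (mD : ∀ i, Measurable (D i)) (mR : ∀ p, Measurable (R p)) (mJ : ∀ p, Measurable (J p))
    (hindep : iIndepFun (Sum.elim D (Sum.elim R J)) P) :
    IsWignerArray P ((2 * (∫ x, x ^ 4 ∂Q) - 3 / 2 : ℝ) : ℂ) (wignerEntry D R J) := by
  have hQ4 : MemLp (fun x : ℝ => x) 4 Q := by
    rw [← integrable_norm_rpow_iff (by fun_prop) (by norm_num) (by norm_num)]
    refine hfour.congr (ae_of_all _ fun x => ?_)
    simp only [Real.norm_eq_abs, ENNReal.toReal_ofNat]
    rw [show (4 : ℝ) = ((4 : ℕ) : ℝ) by norm_num, Real.rpow_natCast, Even.pow_abs (by decide)]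
  have memLp : ∀ {Y : Ω → ℝ}, HasLaw Y Q P → MemLp Y 4 P := fun {Y} hY => by
    have h := hQ4
    rw [← hY.map_eq, memLp_map_measure_iff (by fun_prop) hY.aemeasurable] at h
    exact h
  have pow_int : ∀ {Y : Ω → ℝ}, HasLaw Y Q P → ∀ k : ℕ, ∫ ω, Y ω ^ k ∂P = ∫ x, x ^ k ∂Q :=
    fun {Y} hY k => hY.integral_comp (f := fun x => x ^ k) (by fun_prop)
  have int1 : ∀ {Y : Ω → ℝ}, HasLaw Y Q P → ∫ ω, Y ω ∂P = 0 := fun {Y} hY => by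
    simpa [hmean] using pow_int hY 1
  have hlaw4 : ∀ {Y : Ω → ℝ}, HasLaw Y Q P → Integrable (fun ω => Y ω ^ 4) P := fun {Y} hY => by
    have h := hfour
    rw [← hY.map_eq, integrable_map_measure (by fun_prop) hY.aemeasurable] at h
    exact h
  have hlaw2 : ∀ {Y : Ω → ℝ}, HasLaw Y Q P → MemLp Y 2 P := fun {Y} hY =>
    (memLp hY).mono_exponent (by norm_num)
  have memLpC : ∀ {Y : Ω → ℝ}, HasLaw Y Q P → MemLp (fun ω => (Y ω : ℂ)) 4 P := fun {Y} hY =>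
    (memLp hY).ofReal
  have hRJ : ∀ p, IndepFun (R p) (J p) P := fun p =>
    hindep.indepFun (i := Sum.inr (Sum.inl p)) (j := Sum.inr (Sum.inr p)) (by simp)
  have hup : ∀ i j (h : i < j), wignerEntry D R J i j =
      fun ω => (R ⟨(i, j), h⟩ ω : ℂ) + Complex.I * (J ⟨(i, j), h⟩ ω : ℂ) := fun i j h => by
    funext ω
    simp [wignerEntry, h]
  have hlow : ∀ i j (h : i < j), wignerEntry D R J j i =
      fun ω => (R ⟨(i, j), h⟩ ω : ℂ) - Complex.I * (J ⟨(i, j), h⟩ ω : ℂ) := fun i j h => by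
    funext ω
    simp [wignerEntry, h, h.not_gt]
  have hdiag : ∀ i, wignerEntry D R J i i = fun ω => ((Real.sqrt 2 * D i ω : ℝ) : ℂ) := fun i => by
    funext ω
    simp [wignerEntry]
  have hmeas : ∀ i j, Measurable (wignerEntry D R J i j) := fun i j => by
    rcases lt_trichotomy i j with h | h | h
    · rw [hup i j h]
      have := mR ⟨(i, j), h⟩
      have := mJ ⟨(i, j), h⟩
      fun_prop
    · subst h
      rw [hdiag]
      have := mD i
      fun_prop
    · rw [hlow j i h]
      have := mR ⟨(j, i), h⟩
      have := mJ ⟨(j, i), h⟩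
      fun_prop
  refine ⟨hmeas, ?_, ?_, ?_, ?_, ?_, ?_, ?_, ?_, ?_⟩
  · intro i j ω
    rcases lt_trichotomy i j with h | h | h
    · simp [hup i j h, hlow i j h, sub_eq_add_neg]
    · subst h
      simp [hdiag]
    · simp [hup j i h, hlow j i h]
  · let b : ℕ ⊕ UpperIndex ⊕ UpperIndex → UpperPair :=
      Sum.elim (fun i => ⟨(i, i), le_rfl⟩)
        (Sum.elim (fun p => ⟨p.1, p.2.le⟩) fun p => ⟨p.1, p.2.le⟩)
    have hm : ∀ i, Measurable (Sum.elim D (Sum.elim R J) i) := by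
      rintro (i | p | p)
      exacts [mD i, mR p, mJ p]
    refine hindep.of_blocks hm b ?_
    rintro ⟨⟨i, j⟩, hij⟩
    have key : ∀ k, b k = ⟨(i, j), hij⟩ →
        Measurable[⨆ k ∈ b ⁻¹' {⟨(i, j), hij⟩},
          MeasurableSpace.comap (Sum.elim D (Sum.elim R J) k) inferInstance]
          (Sum.elim D (Sum.elim R J) k) := fun k hk =>
      Measurable.of_comap_le (le_biSup (fun k =>
        MeasurableSpace.comap (Sum.elim D (Sum.elim R J) k) inferInstance) hk)
    rcases (show i ≤ j from hij).lt_or_eq with h | h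
    · have h1 := key (Sum.inr (Sum.inl ⟨(i, j), h⟩)) rfl
      have h2 := key (Sum.inr (Sum.inr ⟨(i, j), h⟩)) rfl
      simp only [Sum.elim_inr, Sum.elim_inl] at h1 h2
      rw [hup i j h]
      exact (Complex.measurable_ofReal.comp h1).add
        ((Complex.measurable_ofReal.comp h2).const_mul Complex.I)
    · subst h
      have h1 := key (Sum.inl i) rfl
      simp only [Sum.elim_inl] at h1
      rw [hdiag]
      exact Complex.measurable_ofReal.comp (h1.const_mul (Real.sqrt 2))
  · intro i j
    rcases lt_trichotomy i j with h | h | h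
    · rw [hup i j h]
      exact (memLpC (hR _)).add ((memLpC (hJ _)).const_mul Complex.I)
    · subst h
      rw [hdiag]
      have h := (memLp (hD i)).const_mul (Real.sqrt 2)
      exact h.ofReal
    · rw [hlow j i h]
      exact (memLpC (hR _)).sub ((memLpC (hJ _)).const_mul Complex.I)
  · intro i
    rw [hdiag, integral_complex_ofReal, integral_const_mul, int1 (hD i)]
    simp
  · intro i
    rw [hdiag]
    have he : ∀ ω, ((Real.sqrt 2 * D i ω : ℝ) : ℂ) * ((Real.sqrt 2 * D i ω : ℝ) : ℂ) =
        ((2 * D i ω ^ 2 : ℝ) : ℂ) := fun ω => by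
      rw [← Complex.ofReal_mul]
      congr 1
      have := Real.mul_self_sqrt (show (0 : ℝ) ≤ 2 by norm_num)
      linear_combination D i ω ^ 2 * this
    simp only [he]
    rw [integral_complex_ofReal, integral_const_mul, pow_int (hD i), hvar]
    norm_num
  · intro i j h
    have h1 : Integrable (fun ω => (R ⟨(i, j), h⟩ ω : ℂ)) P :=
      ((hlaw2 (hR _)).integrable (by norm_num)).ofReal
    have h2 : Integrable (fun ω => Complex.I * (J ⟨(i, j), h⟩ ω : ℂ)) P :=
      ((hlaw2 (hJ _)).integrable (by norm_num)).ofReal.const_mul _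
    simp only [hup i j h]
    rw [integral_add h1 h2, integral_const_mul, integral_complex_ofReal, integral_complex_ofReal,
      int1 (hR _),
      int1 (hJ _)]
    simp
  · intro i j h
    obtain ⟨p, hp⟩ : ∃ p : UpperIndex, p = ⟨(i, j), h⟩ := ⟨_, rfl⟩
    have h1 : Integrable (fun ω => R p ω ^ 2 - J p ω ^ 2) P :=
      (hlaw2 (hR p)).integrable_sq.sub (hlaw2 (hJ p)).integrable_sq
    have h2 : Integrable (fun ω => R p ω * J p ω) P := (hlaw2 (hR p)).integrable_mul (hlaw2 (hJ p))
    have he : ∀ ω, ((R p ω : ℂ) + Complex.I * (J p ω : ℂ)) * ((R p ω : ℂ) + Complex.I * (J p ω : ℂ))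
        = ((R p ω ^ 2 - J p ω ^ 2 : ℝ) : ℂ) + 2 * Complex.I * ((R p ω * J p ω : ℝ) : ℂ) :=
      fun ω => by
        push_cast
        linear_combination (J p ω : ℂ) ^ 2 * Complex.I_sq
    simp only [hup i j h, ← hp, he]
    have h1' : Integrable (fun ω => ((R p ω ^ 2 - J p ω ^ 2 : ℝ) : ℂ)) P := h1.ofReal
    have h2' : Integrable (fun ω => ((R p ω * J p ω : ℝ) : ℂ)) P := h2.ofReal
    rw [integral_add h1' (h2'.const_mul _), integral_const_mul, integral_complex_ofReal,
      integral_complex_ofReal,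
      integral_sub (hlaw2 (hR p)).integrable_sq (hlaw2 (hJ p)).integrable_sq,
      pow_int (hR p), pow_int (hJ p), (hRJ p).integral_fun_mul_eq_mul_integral
        (mR p).aestronglyMeasurable (mJ p).aestronglyMeasurable, int1 (hR p)]
    simp
  · intro i j h
    obtain ⟨p, hp⟩ : ∃ p : UpperIndex, p = ⟨(i, j), h⟩ := ⟨_, rfl⟩
    have he : ∀ ω, ((R p ω : ℂ) + Complex.I * (J p ω : ℂ)) * ((R p ω : ℂ) - Complex.I * (J p ω : ℂ))
        = ((R p ω ^ 2 + J p ω ^ 2 : ℝ) : ℂ) := fun ω => by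
      push_cast
      linear_combination -(J p ω : ℂ) ^ 2 * Complex.I_sq
    simp only [hup i j h, hlow i j h, ← hp, he]
    rw [integral_complex_ofReal,
      integral_add (hlaw2 (hR p)).integrable_sq (hlaw2 (hJ p)).integrable_sq,
      pow_int (hR p), pow_int (hJ p), hvar]
    norm_num
  -- The fourth absolute moment is 2b + 2 (1/2)^2 = 2b + 1/2, which is 2 + κ for κ = 2b - 3/2.
  · intro i j h
    obtain ⟨p, hp⟩ : ∃ p : UpperIndex, p = ⟨(i, j), h⟩ := ⟨_, rfl⟩
    have he : ∀ ω, ((R p ω : ℂ) + Complex.I * (J p ω : ℂ)) * ((R p ω : ℂ) - Complex.I * (J p ω : ℂ))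
        * (((R p ω : ℂ) + Complex.I * (J p ω : ℂ)) * ((R p ω : ℂ) - Complex.I * (J p ω : ℂ)))
        = ((R p ω ^ 4 + J p ω ^ 4 + 2 * (R p ω ^ 2 * J p ω ^ 2) : ℝ) : ℂ) := fun ω => by
      have : ((R p ω : ℂ) + Complex.I * (J p ω : ℂ)) * ((R p ω : ℂ) - Complex.I * (J p ω : ℂ))
          = R p ω ^ 2 + J p ω ^ 2 := by linear_combination -(J p ω : ℂ) ^ 2 * Complex.I_sq
      rw [this]
      push_cast
      ring
    have hind : IndepFun (fun ω => R p ω ^ 2) (fun ω => J p ω ^ 2) P :=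
      (hRJ p).comp (φ := fun x => x ^ 2) (ψ := fun x => x ^ 2) (by fun_prop) (by fun_prop)
    have h2 : Integrable (fun ω => R p ω ^ 2 * J p ω ^ 2) P :=
      hind.integrable_mul (hlaw2 (hR p)).integrable_sq (hlaw2 (hJ p)).integrable_sq
    have h4 : Integrable (fun ω => R p ω ^ 4 + J p ω ^ 4) P := (hlaw4 (hR p)).add (hlaw4 (hJ p))
    simp only [hup i j h, hlow i j h, ← hp, he]
    rw [integral_complex_ofReal, integral_add h4 (h2.const_mul _), integral_add (hlaw4 (hR p))
      (hlaw4 (hJ p)), integral_const_mul, hind.integral_fun_mul_eq_mul_integral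
        ((mR p).pow_const 2).aestronglyMeasurable ((mJ p).pow_const 2).aestronglyMeasurable,
      pow_int (hR p), pow_int (hJ p), pow_int (hR p), pow_int (hJ p), hvar]
    push_cast
    ring

/-- Square integrability of the characteristic polynomial, and its exact covariance. -/
theorem memLp_wignerCharDet_and_cov {Q : Measure ℝ} [IsProbabilityMeasure Q]
    (hmean : ∫ x, x ∂Q = 0) (hvar : ∫ x, x ^ 2 ∂Q = 1 / 2)
    (hfour : Integrable (fun x : ℝ => x ^ 4) Q)
    {Ω : Type*} [MeasurableSpace Ω] {P : Measure Ω} [IsProbabilityMeasure P]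
    {D : ℕ → Ω → ℝ} {R J : UpperIndex → Ω → ℝ}
    (hD : ∀ i, HasLaw (D i) Q P) (hR : ∀ p, HasLaw (R p) Q P) (hJ : ∀ p, HasLaw (J p) Q P)
    (hindep : iIndepFun (Sum.elim D (Sum.elim R J)) P) (N : ℕ) :
    (∀ x, MemLp (wignerCharDet D R J N x) 2 P) ∧
    ∀ x y : ℝ, wignerDetCov P D R J N x y = N.factorial *
      (expConv (((∫ x, x ^ 4 ∂Q) - 3 / 4 : ℝ) : ℂ) (fun m => hermiteKernel m x y) N -
        hermiteTerm N x y) := by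
  -- A law gives measurability only up to null sets, whereas generated σ-algebras need measurable
  -- variables. Countably many modifications change all determinants on one common null set, for
  -- every x at once.
  let D' := fun i => (hD i).aemeasurable.mk (D i)
  let R' := fun p => (hR p).aemeasurable.mk (R p)
  let J' := fun p => (hJ p).aemeasurable.mk (J p)
  have eD : ∀ i, D i =ᵐ[P] D' i := fun i => (hD i).aemeasurable.ae_eq_mk
  have eR : ∀ p, R p =ᵐ[P] R' p := fun p => (hR p).aemeasurable.ae_eq_mk
  have eJ : ∀ p, J p =ᵐ[P] J' p := fun p => (hJ p).aemeasurable.ae_eq_mk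
  have hH := isWignerArray_wignerEntry hmean hvar hfour
    (fun i => (hD i).congr (eD i).symm) (fun p => (hR p).congr (eR p).symm)
    (fun p => (hJ p).congr (eJ p).symm) (fun i => (hD i).aemeasurable.measurable_mk)
    (fun p => (hR p).aemeasurable.measurable_mk) (fun p => (hJ p).aemeasurable.measurable_mk)
    (hindep.congr (g := Sum.elim D' (Sum.elim R' J')) (by
      rintro (i | p | p)
      exacts [eD i, eR p, eJ p]))
  have hae : ∀ᵐ ω ∂P, ∀ x, wignerCharDet D R J N x ω = wignerCharDet D' R' J' N x ω := by
    filter_upwards [ae_all_iff.2 eD, ae_all_iff.2 eR, ae_all_iff.2 eJ] with ω h1 h2 h3 x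
    simp only [wignerCharDet, wignerMatrix, wignerEntry, h1, h2, h3]
  have hs : StrictMono fun i : Fin N => (i : ℕ) := fun _ _ h => h
  have hmem : ∀ x, MemLp (wignerCharDet D' R' J' N x) 2 P := fun x =>
    (hH.dominated_det (fun i : Fin N => (i : ℕ)) (x : ℂ)).memLp hH hs
  refine ⟨fun x => (memLp_congr_ae (hae.mono fun ω h => h x)).2 (hmem x), fun x y => ?_⟩
  have h1 : ∀ x, ∫ ω, wignerCharDet D R J N x ω ∂P = (-1) ^ N * hermiteFun N x := fun x => by
    rw [integral_congr_ae (hae.mono fun ω h => h x)]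
    exact hH.integral_det N hs x
  have h2 : ∫ ω, wignerCharDet D' R' J' N x ω * wignerCharDet D' R' J' N y ω ∂P =
      N.factorial * expConv (((∫ x, x ^ 4 ∂Q) - 3 / 4 : ℝ) : ℂ)
        (fun m => hermiteKernel m x y) N := by
    have h := hH.integral_det_mul_det N hs x y
    rw [show (((2 * (∫ x, x ^ 4 ∂Q) - 3 / 2 : ℝ) : ℂ)) / 2 = (((∫ x, x ^ 4 ∂Q) - 3 / 4 : ℝ) : ℂ) by
      push_cast; ring] at h
    exact h
  have h1' : ∀ x, ∫ ω, wignerCharDet D' R' J' N x ω ∂P = (-1) ^ N * hermiteFun N x := fun x =>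
    hH.integral_det N hs x
  have i1 : ∀ x, Integrable (wignerCharDet D' R' J' N x) P := fun x =>
    (hmem x).integrable (by norm_num)
  have i2 : Integrable (fun ω => wignerCharDet D' R' J' N x ω * wignerCharDet D' R' J' N y ω) P :=
    (hmem x).integrable_mul (hmem y)
  have he : ∫ ω, (wignerCharDet D R J N x ω - (-1) ^ N * hermiteFun N x) *
      (wignerCharDet D R J N y ω - (-1) ^ N * hermiteFun N y) ∂P =
      ∫ ω, (wignerCharDet D' R' J' N x ω * wignerCharDet D' R' J' N y ω
        - (-1) ^ N * hermiteFun N y * wignerCharDet D' R' J' N x ω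
        - (-1) ^ N * hermiteFun N x * wignerCharDet D' R' J' N y ω
        + (-1) ^ N * hermiteFun N x * ((-1) ^ N * hermiteFun N y)) ∂P := by
    refine integral_congr_ae (hae.mono fun ω h => ?_)
    simp only [h]
    ring
  have i3 : Integrable (fun ω => wignerCharDet D' R' J' N x ω * wignerCharDet D' R' J' N y ω
        - (-1) ^ N * hermiteFun N y * wignerCharDet D' R' J' N x ω) P :=
    i2.sub ((i1 x).const_mul _)
  have i4 : Integrable (fun ω => wignerCharDet D' R' J' N x ω * wignerCharDet D' R' J' N y ω
        - (-1) ^ N * hermiteFun N y * wignerCharDet D' R' J' N x ω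
        - (-1) ^ N * hermiteFun N x * wignerCharDet D' R' J' N y ω) P :=
    i3.sub ((i1 y).const_mul _)
  unfold wignerDetCov
  rw [h1, h1, he, integral_add i4 (integrable_const _), integral_sub i3 ((i1 y).const_mul _),
    integral_sub i2 ((i1 x).const_mul _), integral_const_mul, integral_const_mul, h2, h1', h1',
    hermiteTerm]
  have hN : (N.factorial : ℂ) ≠ 0 := by exact_mod_cast N.factorial_ne_zero
  have hsq : ((-1 : ℂ) ^ N) * (-1) ^ N = 1 := by rw [← mul_pow]; simp
  simp
  field_simp
  linear_combination -hermiteFun N x * hermiteFun N y * hsq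

/-! ### Laurent coefficients on a circle -/

/-- The Laurent coefficient of index `n` of `F` on the circle of radius `r`. -/
noncomputable def circleCoeff (r : ℝ) (F : ℂ → ℂ) (n : ℤ) : ℂ :=
  (2 * Real.pi * Complex.I)⁻¹ * ∮ z in C(0, r), F z * z ^ (-n - 1)

section CircleCoeff

variable {r : ℝ} {F G : ℂ → ℂ}

lemma circleCoeff_congr (hr : 0 < r) {n m : ℤ}
    (h : ∀ z ∈ Metric.sphere (0 : ℂ) r, z ≠ 0 → F z * z ^ (-n - 1) = G z * z ^ (-m - 1)) :
    circleCoeff r F n = circleCoeff r G m := by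
  unfold circleCoeff
  rw [circleIntegral.integral_congr hr.le fun z hz => h z hz (by
    rintro rfl
    simp [hr.ne] at hz)]

lemma circleIntegrable_mul_zpow (hr : 0 < r) (hF : ContinuousOn F (Metric.sphere 0 r)) (n : ℤ) :
    CircleIntegrable (fun z => F z * z ^ n) 0 r := by
  refine ContinuousOn.circleIntegrable hr.le (hF.mul fun z hz => ?_)
  refine (continuousAt_zpow₀ z n (Or.inl ?_)).continuousWithinAt
  rintro rfl
  simp [hr.ne] at hz

lemma circleCoeff_add (hr : 0 < r) (hF : ContinuousOn F (Metric.sphere 0 r))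
    (hG : ContinuousOn G (Metric.sphere 0 r)) (n : ℤ) :
    circleCoeff r (fun z => F z + G z) n = circleCoeff r F n + circleCoeff r G n := by
  unfold circleCoeff
  simp only [add_mul]
  rw [circleIntegral.integral_add (circleIntegrable_mul_zpow hr hF _)
    (circleIntegrable_mul_zpow hr hG _), mul_add]

lemma circleCoeff_const_mul (a : ℂ) (F : ℂ → ℂ) (n : ℤ) :
    circleCoeff r (fun z => a * F z) n = a * circleCoeff r F n := by
  unfold circleCoeff
  simp only [mul_assoc a]
  rw [circleIntegral.integral_const_mul]
  ring

lemma circleCoeff_sum {ι : Type*} (s : Finset ι) {F : ι → ℂ → ℂ} (hr : 0 < r)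
    (hF : ∀ i ∈ s, ContinuousOn (F i) (Metric.sphere 0 r)) (n : ℤ) :
    circleCoeff r (fun z => ∑ i ∈ s, F i z) n = ∑ i ∈ s, circleCoeff r (F i) n := by
  unfold circleCoeff
  simp only [Finset.sum_mul]
  rw [circleIntegral.integral_fun_sum fun i hi => circleIntegrable_mul_zpow hr (hF i hi) _,
    Finset.mul_sum]

lemma circleCoeff_pow_mul (hr : 0 < r) (F : ℂ → ℂ) (k : ℕ) (n : ℤ) :
    circleCoeff r (fun z => z ^ k * F z) n = circleCoeff r F (n - k) := by
  refine circleCoeff_congr hr fun z _ hz => ?_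
  rw [show -(n - k) - 1 = (-n - 1) + (k : ℤ) by ring, zpow_add₀ hz, zpow_natCast]
  ring

lemma circleCoeff_of_neg (hr : 0 < r) (hF : DifferentiableOn ℂ F (Metric.closedBall 0 r))
    {n : ℤ} (hn : n < 0) : circleCoeff r F n = 0 := by
  obtain ⟨k, hk⟩ : ∃ k : ℕ, -n - 1 = k := ⟨(-n - 1).toNat, by omega⟩
  unfold circleCoeff
  simp only [hk, zpow_natCast]
  rw [Complex.circleIntegral_eq_zero_of_differentiable_on_off_countable hr.le Set.countable_empty
    (f := fun z => F z * z ^ k) (hF.continuousOn.mul (by fun_prop)), mul_zero]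
  intro z hz
  exact ((hF.differentiableAt (Metric.closedBall_mem_nhds_of_mem hz.1))).mul (by fun_prop)

lemma circleCoeff_zero (hr : 0 < r) (hF : DifferentiableOn ℂ F (Metric.closedBall 0 r)) :
    circleCoeff r F 0 = F 0 := by
  have h := Complex.circleIntegral_sub_inv_smul_of_differentiable_on_off_countable (f := F)
    Set.countable_empty (Metric.mem_ball_self (x := (0 : ℂ)) hr) hF.continuousOn fun z hz =>
      hF.differentiableAt (Metric.closedBall_mem_nhds_of_mem hz.1)
  unfold circleCoeff
  simp only [sub_zero, smul_eq_mul] at h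
  have he : ∀ z : ℂ, F z * z ^ (-(0 : ℤ) - 1) = z⁻¹ * F z := fun z => by
    simp [mul_comm]
  simp only [he]
  rw [h, ← mul_assoc, inv_mul_cancel₀ (by simp [Real.pi_ne_zero]), one_mul]

/-- The derivative of F(z) z^(-n) integrates to zero over the closed circle; differentiability is
needed only at points of the circle. -/
lemma circleCoeff_deriv (hr : 0 < r) {F' : ℂ → ℂ}
    (hF : ∀ z ∈ Metric.sphere (0 : ℂ) r, HasDerivAt F (F' z) z)
    (hF' : ContinuousOn F' (Metric.sphere 0 r)) (n : ℤ) :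
    circleCoeff r F' (n - 1) = n * circleCoeff r F n := by
  have hFc : ContinuousOn F (Metric.sphere 0 r) := fun z hz =>
    (hF z hz).continuousAt.continuousWithinAt
  have h := circleIntegral.integral_eq_zero_of_hasDerivWithinAt (c := 0) hr.le
    (f := fun z => F z * z ^ (-n))
    (f' := fun z => F' z * z ^ (-(n - 1) - 1) + -n * (F z * z ^ (-n - 1))) fun z hz => by
      have hz0 : z ≠ 0 := by
        rintro rfl
        simp [hr.ne] at hz
      have h1 := (hF z hz).mul (hasDerivAt_zpow (-n) z (Or.inl hz0))
      refine (h1.congr_deriv ?_).hasDerivWithinAt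
      rw [show -(n - 1) - 1 = -n by ring]
      push_cast
      ring
  have hi : CircleIntegrable (fun z => -n * (F z * z ^ (-n - 1))) 0 r :=
    (circleIntegrable_mul_zpow hr hFc (-n - 1)).const_smul (a := (-n : ℂ))
  rw [circleIntegral.integral_add (circleIntegrable_mul_zpow hr hF' _) hi,
    circleIntegral.integral_const_mul] at h
  unfold circleCoeff
  linear_combination (2 * Real.pi * Complex.I)⁻¹ * h

lemma circleCoeff_eq_intervalIntegral (r : ℝ) (F : ℂ → ℂ) (n : ℤ) (hr : 0 < r) :
    circleCoeff r F n = (2 * Real.pi : ℂ)⁻¹ *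
      ∫ θ in -Real.pi..Real.pi, F (circleMap 0 r θ) * circleMap 0 r θ ^ (-n) := by
  unfold circleCoeff circleIntegral
  have he : ∀ θ : ℝ, deriv (circleMap 0 r) θ • (F (circleMap 0 r θ) * circleMap 0 r θ ^ (-n - 1)) =
      Complex.I * (F (circleMap 0 r θ) * circleMap 0 r θ ^ (-n)) := fun θ => by
    have h0 : circleMap 0 r θ ≠ 0 := circleMap_ne_center hr.ne'
    rw [deriv_circleMap, smul_eq_mul, zpow_sub₀ h0, zpow_one]
    field_simp
  have hper : Function.Periodic (fun θ => F (circleMap 0 r θ) * circleMap 0 r θ ^ (-n))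
      (2 * Real.pi) := fun θ => by simp only [periodic_circleMap 0 r θ]
  have h := hper.intervalIntegral_add_eq 0 (-Real.pi)
  rw [zero_add, show -Real.pi + 2 * Real.pi = Real.pi by ring] at h
  simp only [he]
  rw [intervalIntegral.integral_const_mul, h, ← mul_assoc, mul_inv, mul_assoc _ _ Complex.I,
    inv_mul_cancel₀ Complex.I_ne_zero, mul_one]

lemma ContinuousOn.const_mul_fun {s : Set ℂ} (hG : ContinuousOn G s) (a : ℂ) :
    ContinuousOn (fun z => a * G z) s :=
  continuousOn_const.mul hG

lemma ContinuousOn.pow_mul_fun {s : Set ℂ} (hG : ContinuousOn G s) (k : ℕ) :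
    ContinuousOn (fun z => z ^ k * G z) s :=
  (continuousOn_pow k).mul hG

lemma ContinuousOn.add_fun {s : Set ℂ} (hF : ContinuousOn F s) (hG : ContinuousOn G s) :
    ContinuousOn (fun z => F z + G z) s :=
  hF.add hG

end CircleCoeff

/-! ### Mehler's formula and contour integrals for the moments -/

/-- The Mehler generating function. -/
noncomputable def mehler (x y z : ℂ) : ℂ :=
  (1 - z) ^ (-(1 / 2) : ℂ) * (1 + z) ^ (-(1 / 2) : ℂ) *
    Complex.exp ((x + y) ^ 2 / 4 * (z / (1 + z)) - (x - y) ^ 2 / 4 * (z / (1 - z)))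

/-- Both 1 - z and 1 + z have positive real part in the unit disc, so their principal powers are
holomorphic there. Keeping the two powers apart separates the singularities at 1 and -1. -/
lemma one_sub_mem_slitPlane {z : ℂ} (hz : ‖z‖ < 1) : 1 - z ∈ Complex.slitPlane := by
  refine Or.inl ?_
  have := (Complex.abs_re_le_norm z).trans_lt hz
  rw [abs_lt] at this
  simp
  linarith

lemma one_add_mem_slitPlane {z : ℂ} (hz : ‖z‖ < 1) : 1 + z ∈ Complex.slitPlane := by
  simpa using one_sub_mem_slitPlane (z := -z) (by simpa using hz)

lemma hasDerivAt_mehler (x y : ℂ) {z : ℂ} (hz : ‖z‖ < 1) :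
    HasDerivAt (mehler x y) (mehler x y z * (1 / (2 * (1 - z)) - 1 / (2 * (1 + z)) +
      (x + y) ^ 2 / 4 / (1 + z) ^ 2 - (x - y) ^ 2 / 4 / (1 - z) ^ 2)) z := by
  have hm := one_sub_mem_slitPlane hz
  have hp := one_add_mem_slitPlane hz
  have hm0 := Complex.slitPlane_ne_zero hm
  have hp0 := Complex.slitPlane_ne_zero hp
  have d1 : HasDerivAt (fun z : ℂ => 1 - z) (-1) z := by
    simpa using (hasDerivAt_id z).const_sub 1
  have d2 : HasDerivAt (fun z : ℂ => 1 + z) 1 z := by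
    simpa using (hasDerivAt_id z).const_add 1
  have e1 := (((hasDerivAt_id z).div d2 hp0).const_mul ((x + y) ^ 2 / 4)).sub
    (((hasDerivAt_id z).div d1 hm0).const_mul ((x - y) ^ 2 / 4))
  have h := ((d1.cpow_const (c := (-(1 / 2) : ℂ)) hm).mul
    (d2.cpow_const (c := (-(1 / 2) : ℂ)) hp)).mul e1.cexp
  refine h.congr_deriv ?_
  simp only [Pi.mul_apply, Pi.sub_apply, Pi.div_apply, id, Complex.cpow_sub _ _ hm0,
    Complex.cpow_sub _ _ hp0, Complex.cpow_one, mehler]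
  field_simp
  ring

/-- The logarithmic derivative has denominator dividing (1 - z^2)^2. Clearing it leaves a linear
equation with polynomial coefficients, that is, a finite recursion for the Taylor coefficients. -/
lemma mehler_ode (x y : ℂ) {z : ℂ} (hz : ‖z‖ < 1) :
    (1 + -2 * z ^ 2 + z ^ 4) * (mehler x y z * (1 / (2 * (1 - z)) - 1 / (2 * (1 + z)) +
      (x + y) ^ 2 / 4 / (1 + z) ^ 2 - (x - y) ^ 2 / 4 / (1 - z) ^ 2)) =
    (x * y + (1 - x ^ 2 - y ^ 2) * z + x * y * z ^ 2 + -1 * z ^ 3) * mehler x y z := by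
  have hm0 := Complex.slitPlane_ne_zero (one_sub_mem_slitPlane hz)
  have hp0 := Complex.slitPlane_ne_zero (one_add_mem_slitPlane hz)
  field_simp
  ring

lemma differentiableOn_mehler (x y : ℂ) : DifferentiableOn ℂ (mehler x y) (Metric.ball 0 1) :=
  fun _ hz => (hasDerivAt_mehler x y (by simpa using hz)).differentiableAt.differentiableWithinAt

/-- The same recursion as that of the Mehler coefficients with n = m + 3. By the three-term
recurrence in x and in y it becomes a polynomial identity in the values of He_m and He_{m+1} at both
points. -/
lemma hermiteTerm_recursion (m : ℕ) (x y : ℂ) :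
    (m + 4) * hermiteTerm (m + 4) x y = x * y * hermiteTerm (m + 3) x y +
      (2 * m + 5 - x ^ 2 - y ^ 2) * hermiteTerm (m + 2) x y + x * y * hermiteTerm (m + 1) x y
      - (m + 1) * hermiteTerm m x y := by
  have h1 : (m.factorial : ℂ) ≠ 0 := by exact_mod_cast m.factorial_ne_zero
  have h2 : (m + 1 : ℂ) ≠ 0 := by exact_mod_cast m.succ_ne_zero
  have h3 : (m + 2 : ℂ) ≠ 0 := by exact_mod_cast (m + 1).succ_ne_zero
  have h4 : (m + 3 : ℂ) ≠ 0 := by exact_mod_cast (m + 2).succ_ne_zero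
  have h5 : (m + 4 : ℂ) ≠ 0 := by exact_mod_cast (m + 3).succ_ne_zero
  have f1 : ((m + 1).factorial : ℂ) = (m + 1) * m.factorial := by
    rw [Nat.factorial_succ]; push_cast; ring
  have f2 : ((m + 2).factorial : ℂ) = (m + 2) * (m + 1) * m.factorial := by
    rw [Nat.factorial_succ, Nat.cast_mul, f1]; push_cast; ring
  have f3 : ((m + 3).factorial : ℂ) = (m + 3) * (m + 2) * (m + 1) * m.factorial := by
    rw [Nat.factorial_succ, Nat.cast_mul, f2]; push_cast; ring
  have f4 : ((m + 4).factorial : ℂ) = (m + 4) * (m + 3) * (m + 2) * (m + 1) * m.factorial := by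
    rw [Nat.factorial_succ, Nat.cast_mul, f3]; push_cast; ring
  have e4 : ∀ x, hermiteFun (m + 4) x = x * hermiteFun (m + 3) x - (m + 3) * hermiteFun (m + 2) x :=
    fun x => by rw [hermiteFun_add_two (m + 2) x]; push_cast; ring
  have e3 : ∀ x, hermiteFun (m + 3) x = x * hermiteFun (m + 2) x - (m + 2) * hermiteFun (m + 1) x :=
    fun x => by rw [hermiteFun_add_two (m + 1) x]; push_cast; ring
  have e2 := hermiteFun_add_two m
  simp only [hermiteTerm, e4, e3, e2, f1, f2, f3, f4]
  generalize (m.factorial : ℂ) = f at *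
  generalize (m : ℂ) = k at *
  field_simp
  ring

lemma circleCoeff_mehler_recursion {r : ℝ} (hr : 0 < r) (hr1 : r < 1) (x y : ℂ) (n : ℤ) :
    (n + 1) * circleCoeff r (mehler x y) (n + 1) =
      x * y * circleCoeff r (mehler x y) n +
      (2 * n - 1 - x ^ 2 - y ^ 2) * circleCoeff r (mehler x y) (n - 1) +
      x * y * circleCoeff r (mehler x y) (n - 2) -
        (n - 2) * circleCoeff r (mehler x y) (n - 3) := by
  set F := mehler x y with hFdef
  set F' := fun z => mehler x y z * (1 / (2 * (1 - z)) - 1 / (2 * (1 + z)) +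
      (x + y) ^ 2 / 4 / (1 + z) ^ 2 - (x - y) ^ 2 / 4 / (1 - z) ^ 2) with hF'def
  have hlt : ∀ z ∈ Metric.sphere (0 : ℂ) r, ‖z‖ < 1 := fun z hz => by
    rw [mem_sphere_zero_iff_norm] at hz
    linarith
  have hd : ∀ z ∈ Metric.sphere (0 : ℂ) r, HasDerivAt F (F' z) z := fun z hz =>
    hasDerivAt_mehler x y (hlt z hz)
  have hF : ContinuousOn F (Metric.sphere 0 r) := fun z hz =>
    (hd z hz).continuousAt.continuousWithinAt
  have hF' : ContinuousOn F' (Metric.sphere 0 r) := by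
    have hm0 : ∀ z ∈ Metric.sphere (0 : ℂ) r, 1 - z ≠ 0 := fun z hz =>
      Complex.slitPlane_ne_zero (one_sub_mem_slitPlane (hlt z hz))
    have hp0 : ∀ z ∈ Metric.sphere (0 : ℂ) r, 1 + z ≠ 0 := fun z hz =>
      Complex.slitPlane_ne_zero (one_add_mem_slitPlane (hlt z hz))
    refine hF.mul (((ContinuousOn.sub ?_ ?_).add ?_).sub ?_)
    · exact continuousOn_const.div (by fun_prop) fun z hz => by simpa using hm0 z hz
    · exact continuousOn_const.div (by fun_prop) fun z hz => by simpa using hp0 z hz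
    · exact continuousOn_const.div (by fun_prop) fun z hz => by simpa using hp0 z hz
    · exact continuousOn_const.div (by fun_prop) fun z hz => by simpa using hm0 z hz
  have hl : circleCoeff r (fun z => (F' z + -2 * (z ^ 2 * F' z)) + z ^ 4 * F' z) n =
      circleCoeff r (fun z => (x * y * F z + (1 - x ^ 2 - y ^ 2) * (z ^ 1 * F z)) +
        (x * y * (z ^ 2 * F z) + -1 * (z ^ 3 * F z))) n :=
    circleCoeff_congr hr fun z hz _ => by
      congr 1
      have := mehler_ode x y (hlt z hz)
      simp only [hF'def, hFdef]
      linear_combination this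
  have h1 := hF.pow_mul_fun 1
  have h2 := hF.pow_mul_fun 2
  have h3 := hF.pow_mul_fun 3
  have h2' := (hF'.pow_mul_fun 2).const_mul_fun (-2)
  rw [circleCoeff_add hr (hF'.add_fun h2') (hF'.pow_mul_fun 4),
    circleCoeff_add hr hF' h2', circleCoeff_const_mul,
    circleCoeff_pow_mul hr, circleCoeff_pow_mul hr,
    circleCoeff_add hr ((hF.const_mul_fun _).add_fun (h1.const_mul_fun _))
      ((h2.const_mul_fun _).add_fun (h3.const_mul_fun _)),
    circleCoeff_add hr (hF.const_mul_fun _) (h1.const_mul_fun _),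
    circleCoeff_add hr (h2.const_mul_fun _) (h3.const_mul_fun _),
    circleCoeff_const_mul, circleCoeff_const_mul, circleCoeff_const_mul, circleCoeff_const_mul,
    circleCoeff_pow_mul hr, circleCoeff_pow_mul hr, circleCoeff_pow_mul hr] at hl
  have d0 := circleCoeff_deriv hr hd hF' (n + 1)
  have d1 := circleCoeff_deriv hr hd hF' (n - 1)
  have d2 := circleCoeff_deriv hr hd hF' (n - 3)
  rw [show n + 1 - 1 = n by ring] at d0
  rw [show n - 1 - 1 = n - 2 by ring] at d1
  rw [show n - 3 - 1 = n - 4 by ring] at d2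
  push_cast at hl d0 d1 d2
  linear_combination hl - d0 + 2 * d1 - d2

/-- Mehler's formula: the coefficients of the Mehler function are the Hermite terms. -/
theorem circleCoeff_mehler {r : ℝ} (hr : 0 < r) (hr1 : r < 1) (x y : ℂ) (n : ℕ) :
    circleCoeff r (mehler x y) n = hermiteTerm n x y := by
  have hdiff : DifferentiableOn ℂ (mehler x y) (Metric.closedBall 0 r) :=
    (differentiableOn_mehler x y).mono (Metric.closedBall_subset_ball hr1)
  have hneg : ∀ {n : ℤ}, n < 0 → circleCoeff r (mehler x y) n = 0 := circleCoeff_of_neg hr hdiff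
  have h0 : circleCoeff r (mehler x y) 0 = 1 := by
    rw [circleCoeff_zero hr hdiff]
    simp [mehler]
  have hrec := circleCoeff_mehler_recursion hr hr1 x y
  -- At n = 0, 1, 2 the coefficients of negative index vanish, so the recursion itself supplies the
  -- starting values.
  have r0 := hrec 0
  have r1 := hrec 1
  have r2 := hrec 2
  norm_num [hneg, h0] at r0 r1 r2
  induction n using Nat.strong_induction_on with
  | _ n ih =>
  match n with
  | 0 => simpa [hermiteTerm] using h0
  | 1 => simpa [hermiteTerm] using r0
  | 2 =>
    rw [r0] at r1
    simp only [hermiteTerm, hermiteFun_add_two 0, Nat.factorial]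
    push_cast
    simp
    linear_combination r1 / 2
  | 3 =>
    rw [r0] at r1 r2
    simp only [hermiteTerm, hermiteFun_add_two 1, hermiteFun_add_two 0, Nat.factorial]
    push_cast
    simp
    linear_combination r2 / 3 + x * y * r1 / 6
  | m + 4 =>
    have h := hrec (m + 3)
    have e3 := ih (m + 3) (by omega)
    have e2 := ih (m + 2) (by omega)
    have e1 := ih (m + 1) (by omega)
    have e0 := ih m (by omega)
    rw [show (m : ℤ) + 3 + 1 = ((m + 4 : ℕ) : ℤ) by push_cast; ring,
      show (m : ℤ) + 3 - 1 = ((m + 2 : ℕ) : ℤ) by push_cast; ring,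
      show (m : ℤ) + 3 - 2 = ((m + 1 : ℕ) : ℤ) by push_cast; ring,
      show (m : ℤ) + 3 - 3 = (m : ℤ) by ring,
      show (m : ℤ) + 3 = ((m + 3 : ℕ) : ℤ) by push_cast; ring, e0, e1, e2, e3] at h
    have hm : (m + 4 : ℂ) ≠ 0 := by exact_mod_cast (m + 3).succ_ne_zero
    refine mul_left_cancel₀ hm ?_
    rw [hermiteTerm_recursion]
    push_cast at h ⊢
    linear_combination h

lemma differentiableOn_mehler_div (x y : ℂ) :
    DifferentiableOn ℂ (fun z => mehler x y z / (1 - z)) (Metric.ball 0 1) :=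
  (differentiableOn_mehler x y).div (by fun_prop) fun z hz =>
    Complex.slitPlane_ne_zero (one_sub_mem_slitPlane (by simpa using hz))

/-- Division by 1 - z turns coefficients into their partial sums. -/
lemma circleCoeff_mehler_div {r : ℝ} (hr : 0 < r) (hr1 : r < 1) (x y : ℂ) (n : ℕ) :
    circleCoeff r (fun z => mehler x y z / (1 - z)) n = hermiteKernel n x y := by
  have hdiff := (differentiableOn_mehler_div x y).mono (Metric.closedBall_subset_ball hr1)
  have hcont : ContinuousOn (fun z => mehler x y z / (1 - z)) (Metric.sphere 0 r) :=
    hdiff.continuousOn.mono Metric.sphere_subset_closedBall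
  have hstep : ∀ n : ℤ, circleCoeff r (mehler x y) n =
      circleCoeff r (fun z => mehler x y z / (1 - z)) n -
        circleCoeff r (fun z => mehler x y z / (1 - z)) (n - 1) := fun n => by
    have h1 := circleCoeff_pow_mul hr (fun z => mehler x y z / (1 - z)) 1 n
    push_cast at h1
    rw [← h1, sub_eq_add_neg, ← neg_one_mul, ← circleCoeff_const_mul, ← circleCoeff_add hr hcont
      ((hcont.pow_mul_fun 1).const_mul_fun _)]
    refine circleCoeff_congr hr fun z hz _ => ?_
    rw [mem_sphere_zero_iff_norm] at hz
    have := Complex.slitPlane_ne_zero (one_sub_mem_slitPlane (z := z) (by linarith))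
    field_simp
    ring
  induction n with
  | zero =>
    have h := hstep 0
    rw [circleCoeff_of_neg hr hdiff (by norm_num : (0 : ℤ) - 1 < 0), sub_zero] at h
    have h' := circleCoeff_mehler hr hr1 x y 0
    simp only [Nat.cast_zero] at h' ⊢
    rw [← h, h']
    simp [hermiteKernel]
  | succ n ih =>
    have h := hstep (n + 1)
    rw [add_sub_cancel_right, ih] at h
    have h' := circleCoeff_mehler hr hr1 x y (n + 1)
    push_cast at h' ⊢
    rw [hermiteKernel_succ, ← h', h]
    ring

/-- Truncating the exponential at order n is exact for this coefficient, as the omitted terms start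
at z^(2n+2), and it keeps the sum finite. -/
lemma circleCoeff_expConv {r : ℝ} (hr : 0 < r) (hr1 : r < 1) (c x y : ℂ) (n : ℕ) :
    circleCoeff r (fun z => mehler x y z / (1 - z) *
      ∑ j ∈ Finset.range (n + 1), (c * z ^ 2) ^ j / j.factorial) n =
      expConv c (fun m => hermiteKernel m x y) n := by
  have hdiff := (differentiableOn_mehler_div x y).mono (Metric.closedBall_subset_ball hr1)
  have hcont : ContinuousOn (fun z => mehler x y z / (1 - z)) (Metric.sphere 0 r) :=
    hdiff.continuousOn.mono Metric.sphere_subset_closedBall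
  have he : (fun z => mehler x y z / (1 - z) *
      ∑ j ∈ Finset.range (n + 1), (c * z ^ 2) ^ j / j.factorial) =
      fun z => ∑ j ∈ Finset.range (n + 1), (c ^ j / j.factorial) *
        (z ^ (2 * j) * (mehler x y z / (1 - z))) := by
    funext z
    rw [Finset.mul_sum]
    refine Finset.sum_congr rfl fun j _ => ?_
    rw [mul_pow, ← pow_mul]
    ring
  rw [he, circleCoeff_sum _ hr fun j _ => (hcont.pow_mul_fun _).const_mul_fun _,
    expConv]
  refine Finset.sum_congr rfl fun j _ => ?_
  rw [circleCoeff_const_mul, circleCoeff_pow_mul hr]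
  split_ifs with h
  · rw [← circleCoeff_mehler_div hr hr1]
    push_cast [h]
    rfl
  · rw [circleCoeff_of_neg hr hdiff (by push_cast; omega), mul_zero]

/-! ### A Laplace inversion leading to the sine kernel -/

/-- The function is sin(2κr)/κ, written so that κ = 0 is included. -/
theorem hasDerivAt_mul_sinc (κ r : ℝ) :
    HasDerivAt (fun r => 2 * r * Real.sinc (2 * κ * r)) (2 * Real.cos (2 * κ * r)) r := by
  rcases eq_or_ne κ 0 with rfl | hκ
  · simpa using (hasDerivAt_id r).const_mul 2
  · have h : (fun r => 2 * r * Real.sinc (2 * κ * r)) = fun r => Real.sin (2 * κ * r) / κ := by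
      funext r
      rcases eq_or_ne r 0 with rfl | hr
      · simp
      · rw [Real.sinc_of_ne_zero (by positivity)]
        field_simp
    rw [h]
    have h2 := ((Real.hasDerivAt_sin (2 * κ * r)).comp r
      ((hasDerivAt_id r).const_mul (2 * κ))).div_const κ
    convert! h2 using 1
    simp
    field_simp

theorem integral_cos_mul_cexp_neg_mul_sq (κ : ℝ) {W : ℂ} (hW : 0 < W.re) :
    Integrable (fun r : ℝ => (Real.cos (2 * κ * r) : ℂ) * Complex.exp (-W * (r : ℂ) ^ 2)) ∧
      ∫ r : ℝ, (Real.cos (2 * κ * r) : ℂ) * Complex.exp (-W * (r : ℂ) ^ 2) =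
      (Real.pi / W) ^ (1 / 2 : ℂ) * Complex.exp (-κ ^ 2 / W) := by
  have hI : Integrable
      (fun r : ℝ => (Real.cos (2 * κ * r) : ℂ) * Complex.exp (-W * (r : ℂ) ^ 2)) := by
    refine (integrable_cexp_neg_mul_sq hW).norm.mono' (by fun_prop) (ae_of_all _ fun r => ?_)
    rw [norm_mul, Complex.norm_real]
    exact mul_le_of_le_one_left (norm_nonneg _) (Real.abs_cos_le_one _)
  refine ⟨hI, ?_⟩
  have hE : ∀ t : ℝ, Integrable
      (fun r : ℝ => Complex.exp (Complex.I * t * r) * Complex.exp (-W * (r : ℂ) ^ 2)) := by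
    intro t
    refine (integrable_cexp_neg_mul_sq hW).norm.mono' (by fun_prop) (ae_of_all _ fun r => ?_)
    rw [norm_mul, Complex.norm_exp]
    simp
  have h1 := fourierIntegral_gaussian hW ((2 * κ : ℝ) : ℂ)
  have h2 := fourierIntegral_gaussian hW ((-(2 * κ) : ℝ) : ℂ)
  have h3 : ∀ r : ℝ, (Real.cos (2 * κ * r) : ℂ) * Complex.exp (-W * (r : ℂ) ^ 2) =
      (1 / 2) * (Complex.exp (Complex.I * (2 * κ : ℝ) * r) * Complex.exp (-W * (r : ℂ) ^ 2) +
        Complex.exp (Complex.I * (-(2 * κ) : ℝ) * r) * Complex.exp (-W * (r : ℂ) ^ 2)) := by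
    intro r
    rw [Complex.ofReal_cos, Complex.cos, ← add_mul]
    push_cast
    ring_nf
  simp_rw [h3]
  rw [integral_const_mul, integral_add (hE _) (hE _), h1, h2]
  push_cast
  ring_nf

/-- Integration by parts against exp(-W r^2) turns the sine into a cosine and reduces the integral
to the Fourier transform of a Gaussian. -/
theorem integral_mul_sinc_mul_cexp (κ : ℝ) {W : ℂ} (hW : 0 < W.re) :
    Integrable (fun r : ℝ => ((r * (2 * r * Real.sinc (2 * κ * r)) : ℝ) : ℂ) *
      Complex.exp (-W * (r : ℂ) ^ 2)) ∧
    ∫ r : ℝ, ((r * (2 * r * Real.sinc (2 * κ * r)) : ℝ) : ℂ) * Complex.exp (-W * (r : ℂ) ^ 2) =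
      W⁻¹ * ((Real.pi / W) ^ (1 / 2 : ℂ) * Complex.exp (-κ ^ 2 / W)) := by
  have hW0 : W ≠ 0 := by rintro rfl; simp at hW
  have hnorm : ∀ r : ℝ, ‖Complex.exp (-W * (r : ℂ) ^ 2)‖ = Real.exp (-W.re * r ^ 2) := by
    intro r
    rw [Complex.norm_exp, ← Complex.ofReal_pow, Complex.re_mul_ofReal, Complex.neg_re]
  have hbd : ∀ r : ℝ, |2 * r * Real.sinc (2 * κ * r)| ≤ 2 * |r| := by
    intro r
    rw [abs_mul, abs_mul, abs_two]
    exact mul_le_of_le_one_right (by positivity) (Real.abs_sinc_le_one _)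
  have hsinc := Real.continuous_sinc
  have hI1 : Integrable (fun r : ℝ => ((r * (2 * r * Real.sinc (2 * κ * r)) : ℝ) : ℂ) *
      Complex.exp (-W * (r : ℂ) ^ 2)) := by
    have h := (integrable_rpow_mul_exp_neg_mul_sq hW (s := 2) (by norm_num)).const_mul 2
    refine h.mono' (by fun_prop) (ae_of_all _ fun r => ?_)
    rw [norm_mul, hnorm, Complex.norm_real, Real.norm_eq_abs, abs_mul, Real.rpow_two, ← mul_assoc]
    refine mul_le_mul_of_nonneg_right ?_ (Real.exp_pos _).le
    calc |r| * |2 * r * Real.sinc (2 * κ * r)| ≤ |r| * (2 * |r|) := by gcongr; exact hbd r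
      _ = 2 * r ^ 2 := by rw [← sq_abs r]; ring
  refine ⟨hI1, ?_⟩
  obtain ⟨hI2, hc⟩ := integral_cos_mul_cexp_neg_mul_sq κ hW
  have hI3 : Integrable (fun r : ℝ => -(2 * W)⁻¹ * (((2 * r * Real.sinc (2 * κ * r) : ℝ) : ℂ) *
      Complex.exp (-W * (r : ℂ) ^ 2))) := by
    have h := (integrable_mul_exp_neg_mul_sq hW).norm.const_mul 2
    refine Integrable.const_mul (h.mono' (by fun_prop) (ae_of_all _ fun r => ?_)) _
    rw [norm_mul, hnorm, Complex.norm_real, Real.norm_eq_abs, Real.norm_eq_abs, abs_mul r,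
      Real.abs_exp, ← mul_assoc]
    exact mul_le_mul_of_nonneg_right (hbd r) (Real.exp_pos _).le
  have hderiv : ∀ r : ℝ, HasDerivAt
      (fun r : ℝ => -(2 * W)⁻¹ * (((2 * r * Real.sinc (2 * κ * r) : ℝ) : ℂ) *
        Complex.exp (-W * (r : ℂ) ^ 2)))
      (((r * (2 * r * Real.sinc (2 * κ * r)) : ℝ) : ℂ) * Complex.exp (-W * (r : ℂ) ^ 2) -
        W⁻¹ * ((Real.cos (2 * κ * r) : ℂ) * Complex.exp (-W * (r : ℂ) ^ 2))) r := by
    intro r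
    have h1 := (hasDerivAt_mul_sinc κ r).ofReal_comp
    have h2 : HasDerivAt (fun r : ℝ => Complex.exp (-W * (r : ℂ) ^ 2))
        (Complex.exp (-W * (r : ℂ) ^ 2) * (-W * (2 * r))) r := by
      have h3 : HasDerivAt (fun r : ℝ => (r : ℂ) ^ 2) (2 * r) r := by
        simpa using (hasDerivAt_id r).ofReal_comp.fun_pow 2
      exact (h3.const_mul (-W)).cexp
    convert! (h1.mul h2).const_mul (-(2 * W)⁻¹) using 1
    push_cast
    field_simp
    ring
  have hI4 := hI2.const_mul W⁻¹
  have h := integral_eq_zero_of_hasDerivAt_of_integrable hderiv (hI1.sub hI4) hI3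
  rw [integral_sub hI1 hI4, integral_const_mul, hc, sub_eq_zero] at h
  exact h

theorem integrableOn_exp_neg_mul_sqrt :
    IntegrableOn (fun u : ℝ => Real.exp (-u) * √u) (Set.Ioi 0) := by
  have h := Real.GammaIntegral_convergent (s := 3 / 2) (by norm_num)
  refine h.congr_fun (fun u _ => ?_) measurableSet_Ioi
  simp only [Real.sqrt_eq_rpow]
  norm_num

/-- The inverse Laplace transform of `w ^ (-3/2) * exp (-κ ^ 2 / w)`, damped by `exp (-u)`. -/
noncomputable def dampedSinc (κ u : ℝ) : ℝ :=
  Real.exp (-u) * (2 * √u / √Real.pi * Real.sinc (2 * κ * √u))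

theorem continuous_dampedSinc (κ : ℝ) : Continuous (dampedSinc κ) := by
  have := Real.continuous_sinc
  unfold dampedSinc
  fun_prop

/-- The square root of a negative number is 0 by convention, so the function on the half-line is
already extended by zero, and continuously. -/
theorem dampedSinc_of_nonpos (κ : ℝ) {u : ℝ} (hu : u ≤ 0) : dampedSinc κ u = 0 := by
  simp [dampedSinc, Real.sqrt_eq_zero_of_nonpos hu]

theorem integrable_dampedSinc (κ : ℝ) : Integrable (dampedSinc κ) := by
  have h : IntegrableOn (dampedSinc κ) (Set.Ioi 0) := by
    refine (integrableOn_exp_neg_mul_sqrt.const_mul (2 / √Real.pi)).mono'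
      (continuous_dampedSinc κ).aestronglyMeasurable (ae_of_all _ fun u => ?_)
    rw [dampedSinc, Real.norm_eq_abs, abs_mul, Real.abs_exp, abs_mul,
      abs_of_nonneg (show 0 ≤ 2 * √u / √Real.pi by positivity)]
    calc Real.exp (-u) * (2 * √u / √Real.pi * |Real.sinc (2 * κ * √u)|)
        ≤ Real.exp (-u) * (2 * √u / √Real.pi * 1) := by
          gcongr
          exact Real.abs_sinc_le_one _
      _ = _ := by ring
  refine (integrableOn_iff_integrable_of_support_subset fun u hu => ?_).1 h
  by_contra hu'
  exact hu (dampedSinc_of_nonpos κ (not_lt.1 hu'))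

/-- Since W lies in the right half-plane, its principal logarithm changes sign under inversion and
the exponents add. -/
theorem pi_div_cpow_half {W : ℂ} (hW : 0 < W.re) :
    W⁻¹ * (Real.pi / W) ^ (1 / 2 : ℂ) = (√Real.pi : ℂ) * W ^ (-(3 / 2) : ℂ) := by
  have hW0 : W ≠ 0 := by rintro rfl; simp at hW
  have harg : W.arg ≠ Real.pi := by
    have := (Complex.abs_arg_lt_pi_div_two_iff.2 (Or.inl hW))
    have hp := Real.pi_pos
    have := (abs_lt.1 this).2
    linarith
  rw [div_eq_mul_inv, Complex.cpow_def_of_ne_zero (by simp [Real.pi_ne_zero, hW0]),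
    Complex.cpow_def_of_ne_zero hW0, Complex.log_ofReal_mul Real.pi_pos (inv_ne_zero hW0),
    Complex.log_inv _ harg]
  have h1 : W⁻¹ = Complex.exp (-Complex.log W) := by rw [Complex.exp_neg, Complex.exp_log hW0]
  have h2 : (√Real.pi : ℂ) = Complex.exp (Real.log Real.pi * (1 / 2)) := by
    rw [Real.sqrt_eq_rpow, Real.rpow_def_of_pos Real.pi_pos]
    push_cast
    rfl
  rw [h1, h2, ← Complex.exp_add, ← Complex.exp_add]
  congr 1
  ring

theorem integral_dampedSinc_mul_cexp (κ : ℝ) {W : ℂ} (hW : 0 < W.re) :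
    ∫ u in Set.Ioi (0 : ℝ), Complex.exp (-(W - 1) * u) * (dampedSinc κ u : ℂ) =
      W ^ (-(3 / 2) : ℂ) * Complex.exp (-κ ^ 2 / W) := by
  -- The substitution u = r^2 removes the square roots; the new integrand is even, so the half-line
  -- integral is half of the Gaussian integral over the line.
  have hsub := integral_comp_rpow_Ioi_of_pos
    (g := fun u : ℝ => Complex.exp (-(W - 1) * u) * (dampedSinc κ u : ℂ)) zero_lt_two
  obtain ⟨hI, hf⟩ := integral_mul_sinc_mul_cexp κ hW
  obtain ⟨f, hfdef⟩ : ∃ f : ℝ → ℂ, f = fun r : ℝ =>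
      ((r * (2 * r * Real.sinc (2 * κ * r)) : ℝ) : ℂ) * Complex.exp (-W * (r : ℂ) ^ 2) := ⟨_, rfl⟩
  rw [← hfdef] at hI hf
  have hneg : ∫ x in Set.Iic 0, f x = ∫ x in Set.Ioi 0, f x := by
    calc ∫ x : ℝ in Set.Iic 0, f x = ∫ x : ℝ in Set.Ioi 0, f (-x) := by
          simp
      _ = ∫ x : ℝ in Set.Ioi 0, f x := by
          simp [hfdef, Real.sinc_neg]
  rw [← integral_add_compl (s := Set.Ioi 0) measurableSet_Ioi hI, Set.compl_Ioi, hneg,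
    ← two_mul] at hf
  have hpi : (√Real.pi : ℂ) ≠ 0 := by
    exact_mod_cast (Real.sqrt_pos.2 Real.pi_pos).ne'
  have hfull : ∫ u in Set.Ioi (0 : ℝ), Complex.exp (-(W - 1) * u) * (dampedSinc κ u : ℂ) =
      (√Real.pi : ℂ)⁻¹ * (2 * ∫ x in Set.Ioi 0, f x) := by
    rw [← hsub, ← integral_const_mul, ← integral_const_mul]
    refine setIntegral_congr_fun measurableSet_Ioi fun r hr => ?_
    have hr : 0 < r := hr
    have he : Complex.exp (-(W - 1) * ((r ^ 2 : ℝ) : ℂ)) * (Real.exp (-r ^ 2) : ℂ) =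
        Complex.exp (-W * (r : ℂ) ^ 2) := by
      rw [Complex.ofReal_exp, ← Complex.exp_add]
      congr 1
      push_cast
      ring
    simp only [hfdef, dampedSinc, Real.rpow_two, Real.sqrt_sq hr.le]
    rw [← he, Complex.real_smul, show (2 : ℝ) - 1 = 1 by norm_num, Real.rpow_one]
    push_cast
    ring
  rw [hfull, hf, ← mul_assoc W⁻¹, pi_div_cpow_half hW]
  field_simp

theorem norm_cpow_neg_three_half (t : ℝ) :
    ‖(1 - t * Complex.I : ℂ) ^ (-(3 / 2) : ℂ)‖ = (1 + ‖t‖ ^ 2) ^ (-(3 / 2 : ℝ) / 2) := by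
  have h : ‖(1 - t * Complex.I : ℂ)‖ = (1 + ‖t‖ ^ 2) ^ (1 / 2 : ℝ) := by
    rw [Complex.norm_def, Complex.normSq_apply, Real.sqrt_eq_rpow]
    simp [sq]
  rw [show (-(3 / 2) : ℂ) = ((-(3 / 2) : ℝ) : ℂ) by push_cast; ring, Complex.norm_cpow_of_ne_zero,
    h, ← Real.rpow_mul (by positivity)]
  · simp
    ring_nf
  · intro h0
    have := congrArg Complex.re h0
    simp at this

/-- The decay |t|^(-3/2) is integrable thanks to the extra factor 1/(1 - z) in the generating
function; the power 1/2 alone would not suffice. -/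
theorem integrable_one_add_sq_rpow :
    Integrable (fun t : ℝ => (1 + ‖t‖ ^ 2) ^ (-(3 / 2 : ℝ) / 2)) :=
  integrable_rpow_neg_one_add_norm_sq (by simp; norm_num)

theorem re_one_sub_mul_I (t : ℝ) : (1 - t * Complex.I : ℂ).re = 1 := by simp

theorem one_sub_mul_I_ne_zero (t : ℝ) : (1 - t * Complex.I : ℂ) ≠ 0 := fun h => by
  simpa using congrArg Complex.re h

theorem continuous_cpow_mul_cexp (κ : ℝ) :
    Continuous fun t : ℝ => (1 - t * Complex.I : ℂ) ^ (-(3 / 2) : ℂ) *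
      Complex.exp (-κ ^ 2 / (1 - t * Complex.I)) := by
  have h : Continuous fun t : ℝ => (1 - t * Complex.I : ℂ) := by fun_prop
  refine Continuous.mul ?_ (Complex.continuous_exp.comp
    (continuous_const.div h one_sub_mul_I_ne_zero))
  exact h.cpow continuous_const fun t => Or.inl (by simp)

theorem integrable_cpow_mul_cexp (κ : ℝ) :
    Integrable fun t : ℝ => (1 - t * Complex.I : ℂ) ^ (-(3 / 2) : ℂ) *
      Complex.exp (-κ ^ 2 / (1 - t * Complex.I)) := by
  refine integrable_one_add_sq_rpow.mono' (continuous_cpow_mul_cexp κ).aestronglyMeasurable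
    (ae_of_all _ fun t => ?_)
  rw [norm_mul, norm_cpow_neg_three_half, Complex.norm_exp]
  refine mul_le_of_le_one_right (by positivity) (Real.exp_le_one_iff.2 ?_)
  rw [← Complex.ofReal_pow, ← Complex.ofReal_neg, div_eq_mul_inv, Complex.re_ofReal_mul,
    Complex.inv_re, re_one_sub_mul_I]
  have : 0 ≤ 1 / Complex.normSq (1 - t * Complex.I) :=
    div_nonneg zero_le_one (Complex.normSq_nonneg _)
  nlinarith [sq_nonneg κ]

open scoped FourierTransform in
theorem fourier_dampedSinc (κ v : ℝ) :
    𝓕 (fun u => (dampedSinc κ u : ℂ)) v =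
      (1 - (-(2 * Real.pi) * v : ℝ) * Complex.I) ^ (-(3 / 2) : ℂ) *
        Complex.exp (-κ ^ 2 / (1 - (-(2 * Real.pi) * v : ℝ) * Complex.I)) := by
  rw [← integral_dampedSinc_mul_cexp κ (by rw [re_one_sub_mul_I]; norm_num),
    Real.fourier_real_eq_integral_exp_smul,
    setIntegral_eq_integral_of_forall_compl_eq_zero (fun u hu => ?_)]
  · refine integral_congr_ae (ae_of_all _ fun u => ?_)
    simp only [smul_eq_mul]
    push_cast
    ring_nf
  · simp [dampedSinc_of_nonpos κ (not_lt.1 hu)]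

open scoped FourierTransform in
-- Fourier inversion at the point a, with t = -2πv. The damping makes the original function
-- integrable, and the factor exp(a) undoes it.
theorem integral_cpow_mul_cexp (κ : ℝ) {a : ℝ} (ha : 0 < a) :
    (2 * Real.pi : ℂ)⁻¹ * ∫ t : ℝ, (1 - t * Complex.I : ℂ) ^ (-(3 / 2) : ℂ) *
      Complex.exp (a * (1 - t * Complex.I) - κ ^ 2 / (1 - t * Complex.I)) =
      ((2 * √(a / Real.pi) * Real.sinc (2 * κ * √a) : ℝ) : ℂ) := by
  have hpi := Real.pi_pos
  have hF : 𝓕 (fun u => (dampedSinc κ u : ℂ)) = fun v : ℝ =>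
      (1 - (-(2 * Real.pi) * v : ℝ) * Complex.I) ^ (-(3 / 2) : ℂ) *
        Complex.exp (-κ ^ 2 / (1 - (-(2 * Real.pi) * v : ℝ) * Complex.I)) :=
    funext (fourier_dampedSinc κ)
  have hinv := Continuous.fourierInv_fourier_eq
    (Complex.continuous_ofReal.comp (continuous_dampedSinc κ)) (integrable_dampedSinc κ).ofReal
    (by
      change Integrable (𝓕 (fun u => (dampedSinc κ u : ℂ)))
      rw [hF]
      exact (integrable_cpow_mul_cexp κ).comp_mul_left' (by simp [hpi.ne']))
  change 𝓕⁻ (𝓕 (fun u => (dampedSinc κ u : ℂ))) = fun u => (dampedSinc κ u : ℂ) at hinv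
  have h := congrFun hinv a
  rw [Real.fourierInv_eq', hF] at h
  have hsub := Measure.integral_comp_mul_left (fun t : ℝ => Complex.exp (-(a * t * Complex.I)) *
    ((1 - t * Complex.I : ℂ) ^ (-(3 / 2) : ℂ) * Complex.exp (-κ ^ 2 / (1 - t * Complex.I))))
    (-(2 * Real.pi))
  have h2 : ∫ v : ℝ, Complex.exp (((2 * Real.pi * inner ℝ v a : ℝ) : ℂ) * Complex.I) •
      ((1 - (-(2 * Real.pi) * v : ℝ) * Complex.I) ^ (-(3 / 2) : ℂ) *
        Complex.exp (-κ ^ 2 / (1 - (-(2 * Real.pi) * v : ℝ) * Complex.I))) =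
      |(-(2 * Real.pi))⁻¹| • ∫ t : ℝ, Complex.exp (-(a * t * Complex.I)) *
    ((1 - t * Complex.I : ℂ) ^ (-(3 / 2) : ℂ) * Complex.exp (-κ ^ 2 / (1 - t * Complex.I))) := by
    rw [← hsub]
    refine integral_congr_ae (ae_of_all _ fun v => ?_)
    simp only [smul_eq_mul, RCLike.inner_apply, conj_trivial]
    push_cast
    ring_nf
  have h3 : ∫ t : ℝ, (1 - t * Complex.I : ℂ) ^ (-(3 / 2) : ℂ) *
      Complex.exp (a * (1 - t * Complex.I) - κ ^ 2 / (1 - t * Complex.I)) =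
      Complex.exp a * ∫ t : ℝ, Complex.exp (-(a * t * Complex.I)) *
    ((1 - t * Complex.I : ℂ) ^ (-(3 / 2) : ℂ) * Complex.exp (-κ ^ 2 / (1 - t * Complex.I))) := by
    rw [← integral_const_mul]
    refine integral_congr_ae (ae_of_all _ fun t => ?_)
    have : Complex.exp (a * (1 - t * Complex.I) - κ ^ 2 / (1 - t * Complex.I)) =
        Complex.exp a * Complex.exp (-(a * t * Complex.I)) *
          Complex.exp (-κ ^ 2 / (1 - t * Complex.I)) := by
      rw [← Complex.exp_add, ← Complex.exp_add]
      ring_nf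
    simp only [this]
    ring
  rw [h2, abs_inv, abs_neg, abs_of_pos (by positivity), Complex.real_smul] at h
  push_cast at h
  rw [h3, mul_left_comm, h, dampedSinc, Real.exp_neg, Real.sqrt_div ha.le]
  have := Complex.exp_ne_zero a
  push_cast
  field_simp

/-! ### Uniform bounds on the contour -/

/-- The map z ↦ z/(1 + z) sends the unit disc to the half-plane of real part below 1/2. -/
theorem re_div_one_add_le {z : ℂ} (hz : ‖z‖ < 1) : (z / (1 + z)).re ≤ 1 / 2 := by
  have h1 : (1 + z : ℂ) ≠ 0 := Complex.slitPlane_ne_zero (one_add_mem_slitPlane hz)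
  have h2 : 0 < Complex.normSq (1 + z) := Complex.normSq_pos.2 h1
  have h3 : Complex.normSq z < 1 := by
    rw [Complex.normSq_eq_norm_sq]; nlinarith [norm_nonneg z]
  rw [Complex.div_re, ← add_div, div_le_iff₀ h2]
  simp only [Complex.normSq_apply, Complex.add_re, Complex.add_im, Complex.one_re,
    Complex.one_im] at *
  nlinarith

theorem neg_half_le_re_div_one_sub {z : ℂ} (hz : ‖z‖ < 1) : -(1 / 2) ≤ (z / (1 - z)).re := by
  have h := re_div_one_add_le (z := -z) (by simpa using hz)
  rw [← sub_eq_add_neg, neg_div, Complex.neg_re] at h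
  linarith

/-- The exponent has real part at most (x+y)^2/8 + (x-y)^2/8 = (x^2+y^2)/4, uniformly up to the unit
circle. -/
theorem norm_mehler_le {z : ℂ} (hz : ‖z‖ < 1) (x y : ℝ) :
    ‖mehler x y z‖ ≤ ‖1 - z‖ ^ (-(1 / 2) : ℝ) * ‖1 + z‖ ^ (-(1 / 2) : ℝ) *
      Real.exp ((x ^ 2 + y ^ 2) / 4) := by
  have hc : (-(1 / 2) : ℂ) = ((-(1 / 2) : ℝ) : ℂ) := by push_cast; ring
  rw [mehler, norm_mul, norm_mul, hc, Complex.norm_cpow_real, Complex.norm_cpow_real,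
    Complex.norm_exp]
  gcongr
  have e : ∀ u : ℝ, ∀ v : ℂ, ((u : ℂ) ^ 2 / 4 * v).re = u ^ 2 / 4 * v.re := by
    intro u v
    rw [show (u : ℂ) ^ 2 / 4 = ((u ^ 2 / 4 : ℝ) : ℂ) by push_cast; ring, Complex.re_ofReal_mul]
  rw [Complex.sub_re, ← Complex.ofReal_add, ← Complex.ofReal_sub, e, e]
  nlinarith [mul_le_mul_of_nonneg_left (re_div_one_add_le hz) (sq_nonneg (x + y)),
    mul_le_mul_of_nonneg_left (neg_half_le_re_div_one_sub hz) (sq_nonneg (x - y))]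

/-- The point at distance of order `1 / √N` from `√N * ξ` with offset parameter `α`. -/
noncomputable def scaledPoint (ξ α : ℝ) (N : ℕ) : ℝ := √N * ξ + α / √N

theorem scaledPoint_sq (ξ α : ℝ) {N : ℕ} (hN : 0 < N) :
    scaledPoint ξ α N ^ 2 = N * ξ ^ 2 + 2 * ξ * α + α ^ 2 / N := by
  have h : (0 : ℝ) < N := by exact_mod_cast hN
  have h2 := Real.sq_sqrt h.le
  have h3 := Real.sqrt_pos.2 h
  rw [scaledPoint, add_sq, mul_pow, div_pow, h2]
  field_simp

noncomputable def scaledMehler (ξ α β : ℝ) (N : ℕ) (z : ℂ) : ℂ :=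
  Real.exp (-(N * ξ ^ 2 / 2)) * mehler (scaledPoint ξ α N) (scaledPoint ξ β N) z

noncomputable def scaledMehlerBound (ξ α β : ℝ) : ℝ :=
  Real.exp (ξ * (α + β) / 2 + (α ^ 2 + β ^ 2) / 4)

/-- At the scaled points (x^2+y^2)/4 is Nξ^2/2 + ξ(α+β)/2 + (α^2+β^2)/(4N), so the prefactor
exp(-Nξ^2/2) cancels the growth exactly. -/
theorem norm_scaledMehler_le {z : ℂ} (hz : ‖z‖ < 1) (ξ α β : ℝ) {N : ℕ} (hN : 0 < N) :
    ‖scaledMehler ξ α β N z‖ ≤ ‖1 - z‖ ^ (-(1 / 2) : ℝ) * ‖1 + z‖ ^ (-(1 / 2) : ℝ) *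
      scaledMehlerBound ξ α β := by
  have h1 : (1 : ℝ) ≤ N := by exact_mod_cast hN
  rw [scaledMehler, norm_mul, Complex.norm_real, Real.norm_eq_abs, Real.abs_exp]
  calc _ ≤ Real.exp (-(N * ξ ^ 2 / 2)) * (‖1 - z‖ ^ (-(1 / 2) : ℝ) * ‖1 + z‖ ^ (-(1 / 2) : ℝ) *
      Real.exp ((scaledPoint ξ α N ^ 2 + scaledPoint ξ β N ^ 2) / 4)) := by
        gcongr; exact norm_mehler_le hz _ _
    _ = ‖1 - z‖ ^ (-(1 / 2) : ℝ) * ‖1 + z‖ ^ (-(1 / 2) : ℝ) * Real.exp (-(N * ξ ^ 2 / 2) +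
        (scaledPoint ξ α N ^ 2 + scaledPoint ξ β N ^ 2) / 4) := by rw [Real.exp_add]; ring
    _ ≤ _ := by
      unfold scaledMehlerBound
      refine mul_le_mul_of_nonneg_left (Real.exp_le_exp.2 ?_) (by positivity)
      rw [scaledPoint_sq _ _ hN, scaledPoint_sq _ _ hN]
      have h2 : α ^ 2 / N ≤ α ^ 2 := div_le_self (sq_nonneg _) h1
      have h3 : β ^ 2 / N ≤ β ^ 2 := div_le_self (sq_nonneg _) h1
      linarith

/-- The parametrized circle of radius `exp (-1 / N)`. -/
noncomputable def nearCircle (N : ℕ) (θ : ℝ) : ℂ := circleMap 0 (Real.exp (-(N : ℝ)⁻¹)) θ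

theorem nearCircle_eq (N : ℕ) (θ : ℝ) :
    nearCircle N θ = Real.exp (-(N : ℝ)⁻¹) * Complex.exp (θ * Complex.I) := by
  simp [nearCircle, circleMap]

theorem norm_nearCircle (N : ℕ) (θ : ℝ) : ‖nearCircle N θ‖ = Real.exp (-(N : ℝ)⁻¹) := by
  simp [nearCircle]

theorem continuous_nearCircle (N : ℕ) : Continuous (nearCircle N) := continuous_circleMap _ _

theorem norm_nearCircle_lt {N : ℕ} (hN : 0 < N) (θ : ℝ) : ‖nearCircle N θ‖ < 1 := by
  rw [norm_nearCircle, Real.exp_lt_one_iff, neg_lt_zero]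
  positivity

theorem norm_nearCircle_zpow {N : ℕ} (hN : 0 < N) (θ : ℝ) :
    ‖nearCircle N θ ^ (-(N : ℤ))‖ = Real.exp 1 := by
  have h : (N : ℝ) ≠ 0 := by positivity
  rw [norm_zpow, norm_nearCircle, zpow_neg, zpow_natCast, ← Real.exp_nat_mul, ← Real.exp_neg]
  congr 1
  field_simp

theorem nearCircle_div (N : ℕ) (t : ℝ) :
    nearCircle N (t / N) = Complex.exp (-(1 - t * Complex.I) * (N : ℂ)⁻¹) := by
  rw [nearCircle_eq, Complex.ofReal_exp, ← Complex.exp_add]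
  congr 1
  push_cast
  ring

theorem inv_two_mul_le_one_sub_exp {N : ℕ} (hN : 0 < N) :
    (2 * (N : ℝ))⁻¹ ≤ 1 - Real.exp (-(N : ℝ)⁻¹) := by
  have h1 : (1 : ℝ) ≤ N := by exact_mod_cast hN
  have h2 : 1 + (N : ℝ)⁻¹ ≤ Real.exp (N : ℝ)⁻¹ := by linarith [Real.add_one_le_exp (N : ℝ)⁻¹]
  have h3 : Real.exp (-(N : ℝ)⁻¹) ≤ (1 + (N : ℝ)⁻¹)⁻¹ := by
    rw [Real.exp_neg]; gcongr
  have h4 : (1 + (N : ℝ)⁻¹)⁻¹ = 1 - (N + 1 : ℝ)⁻¹ := by field_simp; ring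
  have h5 : (2 * (N : ℝ))⁻¹ ≤ (N + 1 : ℝ)⁻¹ := by gcongr; linarith
  linarith

theorem norm_one_sub_nearCircle_sq (N : ℕ) (θ : ℝ) :
    ‖1 - nearCircle N θ‖ ^ 2 = (1 - Real.exp (-(N : ℝ)⁻¹)) ^ 2 +
      2 * Real.exp (-(N : ℝ)⁻¹) * (1 - Real.cos θ) := by
  rw [nearCircle_eq, ← Complex.normSq_eq_norm_sq, Complex.normSq_apply, Complex.sub_re,
    Complex.sub_im, Complex.re_ofReal_mul, Complex.im_ofReal_mul, Complex.exp_ofReal_mul_I_re,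
    Complex.exp_ofReal_mul_I_im, Complex.one_re, Complex.one_im]
  linear_combination Real.exp (-(N : ℝ)⁻¹) ^ 2 * Real.sin_sq_add_cos_sq θ

/-- With r = exp(-1/N), |1 - z|^2 = (1 - r)^2 + 2r(1 - cos θ). Here 1 - r ≥ 1/(2N), r ≥ 1/3 and 1 -
cos θ ≥ θ^2/5, so the square is at least 1/4 + 2t^2/15, which exceeds (1 + t^2)/8. -/
theorem le_norm_one_sub_nearCircle {N : ℕ} (hN : 0 < N) {t : ℝ} (ht : |t / N| ≤ Real.pi) :
    (1 + ‖t‖ ^ 2) / 8 ≤ (N * ‖1 - nearCircle N (t / N)‖) ^ 2 := by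
  have h0 : (0 : ℝ) < N := by exact_mod_cast hN
  have h1 : (1 : ℝ) ≤ N := by exact_mod_cast hN
  rw [mul_pow, norm_one_sub_nearCircle_sq, Real.norm_eq_abs, sq_abs]
  have hcos := Real.cos_le_one_sub_mul_cos_sq ht
  have hr : (1 : ℝ) / 3 ≤ Real.exp (-(N : ℝ)⁻¹) := by
    have : Real.exp (-1) ≤ Real.exp (-(N : ℝ)⁻¹) := by
      gcongr; exact inv_le_one_of_one_le₀ h1
    have h3 : Real.exp 1 ≤ 3 := by linarith [Real.exp_one_lt_d9]
    rw [Real.exp_neg] at this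
    have h4 : (3 : ℝ)⁻¹ ≤ (Real.exp 1)⁻¹ := by gcongr
    linarith
  have hpi : 1 / 5 ≤ 2 / Real.pi ^ 2 := by
    rw [div_le_div_iff₀ (by norm_num) (by positivity)]
    nlinarith [Real.pi_lt_d2, Real.pi_pos]
  have ha : (2 * (N : ℝ))⁻¹ ^ 2 ≤ (1 - Real.exp (-(N : ℝ)⁻¹)) ^ 2 := by
    gcongr; exact inv_two_mul_le_one_sub_exp hN
  have hb : 2 * (1 / 3) * (1 / 5 * (t / N) ^ 2) ≤
      2 * Real.exp (-(N : ℝ)⁻¹) * (1 - Real.cos (t / N)) := by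
    gcongr
    nlinarith [mul_le_mul_of_nonneg_right hpi (sq_nonneg (t / N))]
  calc (1 + t ^ 2) / 8 ≤ (N : ℝ) ^ 2 * ((2 * (N : ℝ))⁻¹ ^ 2 +
      2 * (1 / 3) * (1 / 5 * (t / N) ^ 2)) := by
        field_simp; nlinarith [sq_nonneg t]
    _ ≤ _ := by gcongr

theorem one_le_norm_of_one_le_re {z : ℂ} (hz : 1 ≤ z.re) : 1 ≤ ‖z‖ :=
  hz.trans (Complex.re_le_norm z)

theorem re_nearCircle (N : ℕ) (θ : ℝ) :
    (nearCircle N θ).re = Real.exp (-(N : ℝ)⁻¹) * Real.cos θ := by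
  rw [nearCircle_eq, Complex.re_ofReal_mul, Complex.exp_ofReal_mul_I_re]

theorem inv_two_mul_le_norm_one_sub_sq {N : ℕ} (hN : 0 < N) (θ : ℝ) :
    (2 * (N : ℝ))⁻¹ ≤ ‖1 - nearCircle N θ ^ 2‖ := by
  refine (inv_two_mul_le_one_sub_exp hN).trans ?_
  have h1 := norm_sub_norm_le (1 : ℂ) (nearCircle N θ ^ 2)
  rw [norm_one, norm_pow] at h1
  have h2 := norm_nearCircle_lt hN θ
  rw [← norm_nearCircle N θ]
  nlinarith [norm_nonneg (nearCircle N θ)]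

theorem norm_one_sub_rpow_mul_norm_one_add_rpow (z : ℂ) (p : ℝ) :
    ‖1 - z‖ ^ p * ‖1 + z‖ ^ p = ‖1 - z ^ 2‖ ^ p := by
  rw [← Real.mul_rpow (norm_nonneg _) (norm_nonneg _), ← norm_mul]
  ring_nf

theorem tendsto_nearCircle (θ : ℝ) :
    Tendsto (fun N : ℕ => nearCircle N θ) atTop (𝓝 (Complex.exp (θ * Complex.I))) := by
  have h1 : Tendsto (fun N : ℕ => Real.exp (-(N : ℝ)⁻¹)) atTop (𝓝 1) := by
    have := (Real.continuous_exp.tendsto 0).comp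
      (by simpa using (tendsto_inv_atTop_nhds_zero_nat (𝕜 := ℝ)).neg)
    simpa [Function.comp_def] using this
  have h2 := ((Complex.continuous_ofReal.tendsto _).comp h1).mul_const
    (Complex.exp (θ * Complex.I))
  simpa [Function.comp_def, nearCircle_eq] using h2

theorem ae_one_sub_exp_sq_ne_zero :
    ∀ᵐ θ : ℝ, 1 - Complex.exp (θ * Complex.I) ^ 2 ≠ 0 := by
  have hc : (Set.range fun n : ℤ => (n : ℝ) * Real.pi).Countable := Set.countable_range _
  filter_upwards [hc.ae_notMem volume] with θ hθ h
  refine hθ ?_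
  rw [sub_eq_zero, ← Complex.exp_nat_mul, eq_comm, Complex.exp_eq_one_iff] at h
  obtain ⟨n, hn⟩ := h
  refine ⟨n, ?_⟩
  have h2 := congrArg Complex.im hn
  simp at h2
  simp
  linarith

/-! ### Negligible contributions and pointwise limits -/

theorem tendsto_rpow_neg_half_atTop :
    Tendsto (fun N : ℕ => (N : ℝ) ^ (-(1 / 2) : ℝ)) atTop (𝓝 0) :=
  (tendsto_rpow_neg_atTop (by norm_num)).comp tendsto_natCast_atTop_atTop

/-- Contributions bounded by `‖1 - z ^ 2‖ ^ (-1/2)` are negligible after scaling by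
`N ^ (-1/2)`. -/
theorem tendsto_integral_zero_of_norm_le {g : ℕ → ℝ → ℂ} {a b C : ℝ}
    (hg : ∀ N, 0 < N → Continuous (g N))
    (hC : ∀ N, 0 < N → ∀ θ ∈ Set.uIoc a b,
      ‖g N θ‖ ≤ C * ‖1 - nearCircle N θ ^ 2‖ ^ (-(1 / 2) : ℝ)) :
    Tendsto (fun N : ℕ => (((N : ℝ) ^ (-(1 / 2) : ℝ) : ℝ) : ℂ) * ∫ θ in a..b, g N θ) atTop
      (𝓝 0) := by
  have hbd : ∀ N : ℕ, 0 < N → ∀ θ ∈ Set.uIoc a b,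
      ‖(((N : ℝ) ^ (-(1 / 2) : ℝ) : ℝ) : ℂ) * g N θ‖ ≤
        |C| * ((N : ℝ) ^ (-(1 / 2) : ℝ) * ‖1 - nearCircle N θ ^ 2‖ ^ (-(1 / 2) : ℝ)) := by
    intro N hN θ hθ
    rw [norm_mul, Complex.norm_real, Real.norm_eq_abs, abs_of_nonneg (by positivity)]
    have h1 := hC N hN θ hθ
    have h2 : C * ‖1 - nearCircle N θ ^ 2‖ ^ (-(1 / 2) : ℝ) ≤
        |C| * ‖1 - nearCircle N θ ^ 2‖ ^ (-(1 / 2) : ℝ) := by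
      gcongr; exact le_abs_self C
    calc _ ≤ (N : ℝ) ^ (-(1 / 2) : ℝ) * (|C| * ‖1 - nearCircle N θ ^ 2‖ ^ (-(1 / 2) : ℝ)) := by
          gcongr; exact h1.trans h2
      _ = _ := by ring
  simp_rw [← intervalIntegral.integral_const_mul]
  have hlim : Tendsto (fun N : ℕ => ∫ θ in a..b, (((N : ℝ) ^ (-(1 / 2) : ℝ) : ℝ) : ℂ) * g N θ)
      atTop (𝓝 (∫ _ in a..b, (0 : ℂ))) := by
    -- On the contour N |1 - z^2| ≥ 1/2, so the scaled integrand is bounded by a constant. It tends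
    -- to zero wherever exp(2iθ) ≠ 1, hence almost everywhere.
    refine intervalIntegral.tendsto_integral_filter_of_dominated_convergence
      (fun _ => |C| * (1 / 2 : ℝ) ^ (-(1 / 2) : ℝ)) ?_ ?_ intervalIntegrable_const ?_
    · filter_upwards [eventually_gt_atTop 0] with N hN
      exact ((hg N hN).const_mul _).aestronglyMeasurable
    · filter_upwards [eventually_gt_atTop 0] with N hN
      refine ae_of_all _ fun θ hθ => (hbd N hN θ hθ).trans ?_
      have hN' : (0 : ℝ) < N := by exact_mod_cast hN
      rw [← Real.mul_rpow hN'.le (norm_nonneg _)]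
      gcongr ?_ * ?_
      refine Real.rpow_le_rpow_of_nonpos (by norm_num) ?_ (by norm_num)
      calc (1 / 2 : ℝ) = N * (2 * (N : ℝ))⁻¹ := by field_simp
        _ ≤ _ := by gcongr; exact inv_two_mul_le_norm_one_sub_sq hN θ
    · filter_upwards [ae_one_sub_exp_sq_ne_zero] with θ hθ hmem
      refine squeeze_zero_norm' ((eventually_gt_atTop 0).mono fun N hN => hbd N hN θ hmem) ?_
      have h1 := (tendsto_const_nhds.sub ((tendsto_nearCircle θ).pow 2)).norm.rpow_const
        (p := -(1 / 2)) (Or.inl (norm_ne_zero_iff.2 hθ))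
      simpa using (tendsto_rpow_neg_half_atTop.mul h1).const_mul |C|
  simpa using hlim

/-- The limit of `exp (c * z ^ 2)` truncated at order `N`, along a sequence tending to `1`. -/
theorem tendsto_truncatedExp {c : ℂ} {z : ℕ → ℂ} (hz : Tendsto z atTop (𝓝 1))
    (hz1 : ∀ᶠ N in atTop, ‖z N‖ ≤ 1) :
    Tendsto (fun N => ∑ j ∈ Finset.range (N + 1), (c * z N ^ 2) ^ j / j.factorial) atTop
      (𝓝 (Complex.exp c)) := by
  -- The truncation becomes an indicator inside a full series, so dominated convergence handles the
  -- varying order and the varying argument together.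
  have h1 : ∀ N, ∑ j ∈ Finset.range (N + 1), (c * z N ^ 2) ^ j / (j.factorial : ℂ) =
      ∑' j : ℕ, if j < N + 1 then (c * z N ^ 2) ^ j / (j.factorial : ℂ) else 0 := by
    intro N
    rw [tsum_eq_sum (s := Finset.range (N + 1))
      (fun j hj => if_neg (by simpa using hj))]
    exact Finset.sum_congr rfl fun j hj => (if_pos (Finset.mem_range.1 hj)).symm
  simp_rw [h1]
  rw [Complex.exp_eq_exp_ℂ, NormedSpace.exp_eq_tsum_div]
  refine tendsto_tsum_of_dominated_convergence (Real.summable_pow_div_factorial ‖c‖)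
    (fun j => ?_) ?_
  · have h2 : Tendsto (fun N => (c * z N ^ 2) ^ j / (j.factorial : ℂ)) atTop
        (𝓝 (c ^ j / j.factorial)) := by
      simpa using (((hz.pow 2).const_mul c).pow j).div_const (j.factorial : ℂ)
    refine h2.congr' ?_
    filter_upwards [eventually_ge_atTop j] with N hN
    rw [if_pos (by omega)]
  · filter_upwards [hz1] with N hN j
    split_ifs
    · rw [norm_div, norm_pow, norm_mul, norm_pow, Complex.norm_natCast]
      gcongr
      exact mul_le_of_le_one_right (norm_nonneg _) (pow_le_one₀ (norm_nonneg _) hN)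
    · simp only [norm_zero]; positivity

theorem norm_truncatedExp_le {c z : ℂ} (hz : ‖z‖ ≤ 1) (N : ℕ) :
    ‖∑ j ∈ Finset.range (N + 1), (c * z ^ 2) ^ j / (j.factorial : ℂ)‖ ≤ Real.exp ‖c‖ := by
  refine (norm_sum_le _ _).trans (le_trans (Finset.sum_le_sum fun j _ => ?_)
    (Real.sum_le_exp_of_nonneg (norm_nonneg c) (N + 1)))
  rw [norm_div, norm_pow, norm_mul, norm_pow, Complex.norm_natCast]
  gcongr
  exact mul_le_of_le_one_right (norm_nonneg _) (pow_le_one₀ (norm_nonneg _) hz)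

/-- The contour in its local variable near z = 1: w = 1 - it gives the point of angle t/N. -/
noncomputable def expCircle (w : ℂ) (N : ℕ) : ℂ := Complex.exp (-w * (N : ℂ)⁻¹)

theorem tendsto_expCircle (w : ℂ) : Tendsto (expCircle w) atTop (𝓝 1) := by
  have h := (tendsto_inv_atTop_nhds_zero_nat (𝕜 := ℂ)).const_mul (-w)
  change Tendsto (fun N : ℕ => Complex.exp (-w * (N : ℂ)⁻¹)) atTop (𝓝 1)
  simpa [Function.comp_def] using (Complex.continuous_exp.tendsto _).comp h

theorem tendsto_mul_one_sub_expCircle (w : ℂ) :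
    Tendsto (fun N : ℕ => (N : ℂ) * (1 - expCircle w N)) atTop (𝓝 w) := by
  have h1 : HasDerivAt (fun u : ℂ => Complex.exp (-w * u)) (-w) 0 := by
    simpa using ((hasDerivAt_id (0 : ℂ)).const_mul (-w)).cexp
  have h2 : Tendsto (fun N : ℕ => ((N : ℂ))⁻¹) atTop (𝓝[≠] 0) := by
    refine tendsto_nhdsWithin_iff.2 ⟨tendsto_inv_atTop_nhds_zero_nat, ?_⟩
    filter_upwards [eventually_gt_atTop 0] with N hN
    simpa using hN.ne'
  have h3 := (h1.tendsto_slope_zero.comp h2).neg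
  simp only [neg_neg] at h3
  refine h3.congr fun N => ?_
  simp [expCircle]
  ring

/-- The squared sum of the points grows like 4Nξ^2, so z/(1 + z) is needed to order 1/N; the squared
difference is of order 1/N and meets z/(1 - z), of order N. -/
theorem tendsto_scaledMehler_exponent (ξ α β : ℝ) {w : ℂ} (hw : w ≠ 0) :
    Tendsto (fun N : ℕ => -(N * ξ ^ 2 / 2) +
      ((scaledPoint ξ α N + scaledPoint ξ β N : ℂ) ^ 2 / 4 *
          (expCircle w N / (1 + expCircle w N)) -
        (scaledPoint ξ α N - scaledPoint ξ β N : ℂ) ^ 2 / 4 *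
          (expCircle w N / (1 - expCircle w N)))) atTop
      (𝓝 (-(ξ ^ 2 * w / 4) + ξ * (α + β) / 2 - ((α - β) / 2) ^ 2 / w)) := by
  have hz := tendsto_expCircle w
  have hN := tendsto_mul_one_sub_expCircle w
  have hz2 : Tendsto (fun N => 1 + expCircle w N) atTop (𝓝 2) := by
    convert hz.const_add 1 using 2; norm_num
  have hinv : Tendsto (fun N : ℕ => ((N : ℂ))⁻¹) atTop (𝓝 0) := tendsto_inv_atTop_nhds_zero_nat
  -- The divergent part cancels through z/(1+z) - 1/2 = -(1-z)/(2(1+z)); multiplied by Nξ^2 it tends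
  -- to -ξ^2 w/4.
  have hlim := (((hN.mul (hz2.inv₀ two_ne_zero)).const_mul (-((ξ : ℂ) ^ 2 / 2))).add
    (((hinv.const_mul (((α : ℂ) + β) ^ 2 / 4)).const_add (ξ * (α + β) : ℂ)).mul
      (hz.div hz2 two_ne_zero))).sub
    ((hz.div hN hw).const_mul (((α - β : ℂ) / 2) ^ 2))
  convert! hlim.congr' ?_ using 2
  · ring
  filter_upwards [eventually_gt_atTop 0, hz2.eventually_ne two_ne_zero,
    hN.eventually_ne hw] with N hN0 h2 h1
  have hNr : (0 : ℝ) < N := by exact_mod_cast hN0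
  have hNc : (N : ℂ) ≠ 0 := by exact_mod_cast hN0.ne'
  have h1' : 1 - expCircle w N ≠ 0 := right_ne_zero_of_mul h1
  have hs : (scaledPoint ξ α N + scaledPoint ξ β N : ℂ) ^ 2 =
      4 * N * ξ ^ 2 + 4 * ξ * (α + β) + (α + β) ^ 2 * (N : ℂ)⁻¹ := by
    have : (scaledPoint ξ α N + scaledPoint ξ β N) ^ 2 =
      4 * N * ξ ^ 2 + 4 * ξ * (α + β) + (α + β) ^ 2 * (N : ℝ)⁻¹ := by
      have h3 := Real.sqrt_pos.2 hNr
      have h4 := Real.sq_sqrt hNr.le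
      obtain ⟨q, hq⟩ : ∃ q, q = √(N : ℝ) := ⟨_, rfl⟩
      simp only [scaledPoint, ← hq] at *
      rw [← h4]
      field_simp
      ring
    simpa using congrArg Complex.ofReal this
  have hd : (scaledPoint ξ α N - scaledPoint ξ β N : ℂ) ^ 2 = (α - β) ^ 2 * (N : ℂ)⁻¹ := by
    have : (scaledPoint ξ α N - scaledPoint ξ β N) ^ 2 = (α - β) ^ 2 * (N : ℝ)⁻¹ := by
      have h3 := Real.sqrt_pos.2 hNr
      have h4 := Real.sq_sqrt hNr.le
      obtain ⟨q, hq⟩ : ∃ q, q = √(N : ℝ) := ⟨_, rfl⟩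
      simp only [scaledPoint, ← hq] at *
      rw [← h4]
      field_simp
      ring
    simpa using congrArg Complex.ofReal this
  rw [hs, hd]
  simp only [Pi.div_apply]
  clear hlim
  generalize expCircle w N = z at *
  field_simp
  ring

/-- A positive real factor leaves the argument unchanged, so the principal power is multiplicative
here. -/
theorem natCast_cpow_mul_cpow {N : ℕ} (hN : 0 < N) {u : ℂ} (hu : u ≠ 0) :
    (((N : ℝ) ^ (-(3 / 2) : ℝ) : ℝ) : ℂ) * (u ^ (-(1 / 2) : ℂ) / u) =
      (N * u) ^ (-(3 / 2) : ℂ) := by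
  have hNr : (0 : ℝ) < N := by exact_mod_cast hN
  have h1 : u ^ (-(1 / 2) : ℂ) / u = u ^ (-(3 / 2) : ℂ) := by
    nth_rw 2 [← Complex.cpow_one u]
    rw [← Complex.cpow_sub _ _ hu]
    norm_num
  have h3 : (N * u : ℂ) ≠ 0 := mul_ne_zero (by exact_mod_cast hN.ne') hu
  rw [h1, Complex.ofReal_cpow hNr.le, Complex.cpow_def_of_ne_zero hu,
    Complex.cpow_def_of_ne_zero h3, Complex.cpow_def_of_ne_zero (by exact_mod_cast hN.ne'),
    ← Complex.exp_add, ← Complex.ofReal_natCast, Complex.log_ofReal_mul hNr hu,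
    Complex.ofReal_log hNr.le]
  congr 1
  push_cast
  ring

/-- The integrand of the contour integral for the covariance. -/
noncomputable def covIntegrand (ξ α β : ℝ) (c : ℂ) (N : ℕ) (z : ℂ) : ℂ :=
  scaledMehler ξ α β N z / (1 - z) *
    (∑ j ∈ Finset.range (N + 1), (c * z ^ 2) ^ j / (j.factorial : ℂ)) * z ^ (-(N : ℤ))

theorem expCircle_zpow (w : ℂ) {N : ℕ} (hN : 0 < N) :
    expCircle w N ^ (-(N : ℤ)) = Complex.exp w := by
  have h : (N : ℂ) ≠ 0 := by exact_mod_cast hN.ne'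
  rw [expCircle, ← Complex.exp_int_mul]
  congr 1
  push_cast
  field_simp

theorem norm_expCircle_lt {w : ℂ} (hw : 0 < w.re) {N : ℕ} (hN : 0 < N) :
    ‖expCircle w N‖ < 1 := by
  have hNr : (0 : ℝ) < N := by exact_mod_cast hN
  rw [expCircle, Complex.norm_exp, Real.exp_lt_one_iff, ← Complex.ofReal_natCast,
    ← Complex.ofReal_inv, Complex.re_mul_ofReal, Complex.neg_re]
  have : 0 < w.re * (N : ℝ)⁻¹ := by positivity
  linarith

theorem tendsto_covIntegrand (ξ α β : ℝ) (c : ℂ) {w : ℂ} (hw : 0 < w.re) :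
    Tendsto (fun N : ℕ => (((N : ℝ) ^ (-(3 / 2) : ℝ) : ℝ) : ℂ) *
      covIntegrand ξ α β c N (expCircle w N)) atTop
      (𝓝 (w ^ (-(3 / 2) : ℂ) * 2 ^ (-(1 / 2) : ℂ) *
        Complex.exp (-(ξ ^ 2 * w / 4) + ξ * (α + β) / 2 - ((α - β) / 2) ^ 2 / w) *
        Complex.exp c * Complex.exp w)) := by
  have hw0 : w ≠ 0 := by rintro rfl; simp at hw
  have hz := tendsto_expCircle w
  have hN := tendsto_mul_one_sub_expCircle w
  have hz2 : Tendsto (fun N => 1 + expCircle w N) atTop (𝓝 2) := by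
    convert hz.const_add 1 using 2; norm_num
  have hlt : ∀ᶠ N : ℕ in atTop, ‖expCircle w N‖ < 1 :=
    (eventually_gt_atTop 0).mono fun N h => norm_expCircle_lt hw h
  have h1 := hN.cpow (tendsto_const_nhds (x := (-(3 / 2) : ℂ))) (Or.inl hw)
  have h2 := hz2.cpow (tendsto_const_nhds (x := (-(1 / 2) : ℂ))) (Or.inl (by simp))
  have h3 := (Complex.continuous_exp.tendsto _).comp (tendsto_scaledMehler_exponent ξ α β hw0)
  have h4 := tendsto_truncatedExp (c := c) hz (hlt.mono fun N h => h.le)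
  refine ((((h1.mul h2).mul h3).mul h4).mul_const (Complex.exp w)).congr' ?_
  filter_upwards [eventually_gt_atTop 0, hlt] with N hN0 hl
  have hu : 1 - expCircle w N ≠ 0 := Complex.slitPlane_ne_zero (one_sub_mem_slitPlane hl)
  rw [covIntegrand, scaledMehler, mehler, expCircle_zpow w hN0, ← natCast_cpow_mul_cpow hN0 hu,
    Function.comp_apply, Complex.exp_add, Complex.ofReal_exp]
  push_cast
  ring

theorem continuous_scaledMehler_nearCircle (ξ α β : ℝ) {N : ℕ} (hN : 0 < N) :
    Continuous fun θ => scaledMehler ξ α β N (nearCircle N θ) :=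
  continuous_const.mul ((differentiableOn_mehler _ _).continuousOn.comp_continuous
    (continuous_nearCircle N) fun θ => by simpa using norm_nearCircle_lt hN θ)

theorem nearCircle_ne_zero (N : ℕ) (θ : ℝ) : nearCircle N θ ≠ 0 := by
  rw [← norm_pos_iff, norm_nearCircle]
  exact Real.exp_pos _

theorem continuous_nearCircle_zpow (N : ℕ) (n : ℤ) : Continuous fun θ => nearCircle N θ ^ n :=
  (continuous_nearCircle N).zpow₀ n fun θ => Or.inl (nearCircle_ne_zero N θ)

theorem one_sub_nearCircle_ne_zero {N : ℕ} (hN : 0 < N) (θ : ℝ) : 1 - nearCircle N θ ≠ 0 :=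
  Complex.slitPlane_ne_zero (one_sub_mem_slitPlane (norm_nearCircle_lt hN θ))

theorem continuous_covIntegrand_nearCircle (ξ α β : ℝ) (c : ℂ) {N : ℕ} (hN : 0 < N) :
    Continuous fun θ => covIntegrand ξ α β c N (nearCircle N θ) := by
  have h1 := continuous_nearCircle N
  unfold covIntegrand
  exact (((continuous_scaledMehler_nearCircle ξ α β hN).div (continuous_const.sub h1)
    (one_sub_nearCircle_ne_zero hN)).mul (by fun_prop)).mul (continuous_nearCircle_zpow N _)

theorem norm_covIntegrand_le (ξ α β : ℝ) (c : ℂ) {N : ℕ} (hN : 0 < N) (θ : ℝ) :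
    ‖covIntegrand ξ α β c N (nearCircle N θ)‖ ≤
      ‖1 - nearCircle N θ‖ ^ (-(1 / 2) : ℝ) * ‖1 + nearCircle N θ‖ ^ (-(1 / 2) : ℝ) *
        scaledMehlerBound ξ α β / ‖1 - nearCircle N θ‖ * Real.exp ‖c‖ * Real.exp 1 := by
  have hz := norm_nearCircle_lt hN θ
  rw [covIntegrand, norm_mul, norm_mul, norm_div, norm_nearCircle_zpow hN]
  have hK : 0 ≤ scaledMehlerBound ξ α β := (Real.exp_pos _).le
  gcongr
  · exact norm_scaledMehler_le hz ξ α β hN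
  · exact norm_truncatedExp_le hz.le N

/-! ### Limits of the contour integrals -/

/-- The contribution of the product of the means: without the factor 1/(1 - z) both singularities
have order 1/2. -/
theorem tendsto_integral_scaledMehler (ξ α β : ℝ) :
    Tendsto (fun N : ℕ => (((N : ℝ) ^ (-(1 / 2) : ℝ) : ℝ) : ℂ) *
      ∫ θ in -Real.pi..Real.pi, scaledMehler ξ α β N (nearCircle N θ) *
        nearCircle N θ ^ (-(N : ℤ))) atTop (𝓝 0) := by
  refine tendsto_integral_zero_of_norm_le (C := scaledMehlerBound ξ α β * Real.exp 1)
    (fun N hN => (continuous_scaledMehler_nearCircle ξ α β hN).mul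
      (continuous_nearCircle_zpow N _)) fun N hN θ _ => ?_
  rw [norm_mul, norm_nearCircle_zpow hN, ← norm_one_sub_rpow_mul_norm_one_add_rpow]
  calc _ ≤ ‖1 - nearCircle N θ‖ ^ (-(1 / 2) : ℝ) * ‖1 + nearCircle N θ‖ ^ (-(1 / 2) : ℝ) *
      scaledMehlerBound ξ α β * Real.exp 1 := by
        gcongr; exact norm_scaledMehler_le (norm_nearCircle_lt hN θ) ξ α β hN
    _ = _ := by ring

/-- Where cos θ ≤ 0 one has |1 - z| ≥ 1, so the extra denominator is harmless and only the order 1/2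
singularity at -1 remains. -/
theorem tendsto_integral_covIntegrand_outer (ξ α β : ℝ) (c : ℂ) {a b : ℝ}
    (hab : ∀ θ ∈ Set.uIoc a b, Real.cos θ ≤ 0) :
    Tendsto (fun N : ℕ => (((N : ℝ) ^ (-(1 / 2) : ℝ) : ℝ) : ℂ) *
      ∫ θ in a..b, covIntegrand ξ α β c N (nearCircle N θ)) atTop (𝓝 0) := by
  refine tendsto_integral_zero_of_norm_le
    (C := scaledMehlerBound ξ α β * Real.exp ‖c‖ * Real.exp 1)
    (fun N hN => continuous_covIntegrand_nearCircle ξ α β c hN) fun N hN θ hθ => ?_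
  refine (norm_covIntegrand_le ξ α β c hN θ).trans ?_
  have h1 : 1 ≤ ‖1 - nearCircle N θ‖ := by
    refine one_le_norm_of_one_le_re ?_
    rw [Complex.sub_re, Complex.one_re, re_nearCircle]
    nlinarith [hab θ hθ, Real.exp_pos (-(N : ℝ)⁻¹)]
  have hK : 0 ≤ scaledMehlerBound ξ α β := (Real.exp_pos _).le
  rw [← norm_one_sub_rpow_mul_norm_one_add_rpow]
  calc _ ≤ ‖1 - nearCircle N θ‖ ^ (-(1 / 2) : ℝ) * ‖1 + nearCircle N θ‖ ^ (-(1 / 2) : ℝ) *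
      scaledMehlerBound ξ α β * Real.exp ‖c‖ * Real.exp 1 := by
        gcongr; exact div_le_self (by positivity) h1
    _ = _ := by ring

/-- On the right half of the contour |1 + z| ≥ 1, and the lower bound for N|1 - z| provides an
integrable majorant independent of N. -/
theorem rpow_mul_norm_le {N : ℕ} (hN : 0 < N) {t : ℝ} (ht : |t / N| ≤ Real.pi / 2) :
    (N : ℝ) ^ (-(3 / 2) : ℝ) * (‖1 - nearCircle N (t / N)‖ ^ (-(1 / 2) : ℝ) *
      ‖1 + nearCircle N (t / N)‖ ^ (-(1 / 2) : ℝ) / ‖1 - nearCircle N (t / N)‖) ≤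
      (1 / 8 : ℝ) ^ (-(3 / 2 : ℝ) / 2) * (1 + ‖t‖ ^ 2) ^ (-(3 / 2 : ℝ) / 2) := by
  have hNr : (0 : ℝ) < N := by exact_mod_cast hN
  have hpos : 0 < ‖1 - nearCircle N (t / N)‖ :=
    norm_pos_iff.2 (one_sub_nearCircle_ne_zero hN _)
  have hlow := le_norm_one_sub_nearCircle hN (ht.trans (by linarith [Real.pi_pos]))
  have h1 : 1 ≤ ‖1 + nearCircle N (t / N)‖ := by
    refine one_le_norm_of_one_le_re ?_
    rw [Complex.add_re, Complex.one_re, re_nearCircle]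
    have := Real.cos_nonneg_of_mem_Icc (abs_le.1 ht)
    have := mul_nonneg (Real.exp_pos (-(N : ℝ)⁻¹)).le this
    linarith
  generalize ‖1 - nearCircle N (t / N)‖ = p at *
  have h2 : ‖1 + nearCircle N (t / N)‖ ^ (-(1 / 2) : ℝ) ≤ 1 :=
    Real.rpow_le_one_of_one_le_of_nonpos h1 (by norm_num)
  calc _ ≤ (N : ℝ) ^ (-(3 / 2) : ℝ) * (p ^ (-(1 / 2) : ℝ) * 1 / p) := by gcongr
    _ = (N : ℝ) ^ (-(3 / 2) : ℝ) * p ^ (-(3 / 2) : ℝ) := by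
      rw [mul_one, show (-(3 / 2) : ℝ) = -(1 / 2) - 1 by norm_num, Real.rpow_sub_one hpos.ne']
    _ = ((N * p) ^ 2) ^ (-(3 / 2 : ℝ) / 2) := by
      rw [← Real.mul_rpow hNr.le hpos.le, ← Real.rpow_natCast, ← Real.rpow_mul (by positivity)]
      norm_num
    _ ≤ ((1 + ‖t‖ ^ 2) / 8) ^ (-(3 / 2 : ℝ) / 2) :=
      Real.rpow_le_rpow_of_nonpos (by positivity) hlow (by norm_num)
    _ = _ := by rw [← Real.mul_rpow (by norm_num) (by positivity)]; ring_nf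

theorem tendsto_integral_covIntegrand_central (ξ α β : ℝ) (c : ℂ) :
    Tendsto (fun N : ℕ => (((N : ℝ) ^ (-(1 / 2) : ℝ) : ℝ) : ℂ) *
      ∫ θ in -(Real.pi / 2)..Real.pi / 2, covIntegrand ξ α β c N (nearCircle N θ)) atTop
      (𝓝 (∫ t : ℝ, (1 - t * Complex.I : ℂ) ^ (-(3 / 2) : ℂ) * 2 ^ (-(1 / 2) : ℂ) *
        Complex.exp (-(ξ ^ 2 * (1 - t * Complex.I) / 4) + ξ * (α + β) / 2 -
          ((α - β) / 2) ^ 2 / (1 - t * Complex.I)) *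
        Complex.exp c * Complex.exp (1 - t * Complex.I))) := by
  have hpi := Real.pi_pos
  have hmem : ∀ N : ℕ, 0 < N → ∀ t : ℝ,
      t ∈ Set.Ioc (-(Real.pi / 2) * N) (Real.pi / 2 * N) → |t / N| ≤ Real.pi / 2 := by
    intro N hN t ht
    have hNr : (0 : ℝ) < N := by exact_mod_cast hN
    rw [abs_le, le_div_iff₀ hNr, div_le_iff₀ hNr]
    exact ⟨ht.1.le, ht.2⟩
  -- The substitution θ = t/N contributes a factor 1/N, turning N^(-1/2) into the N^(-3/2) that
  -- balances (1 - z)^(-3/2).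
  have hscale : ∀ N : ℕ, 0 < N → (((N : ℝ) ^ (-(1 / 2) : ℝ) : ℝ) : ℂ) *
      ∫ θ in -(Real.pi / 2)..Real.pi / 2, covIntegrand ξ α β c N (nearCircle N θ) =
      ∫ t : ℝ, (Set.Ioc (-(Real.pi / 2) * N) (Real.pi / 2 * N)).indicator
        (fun t => (((N : ℝ) ^ (-(3 / 2) : ℝ) : ℝ) : ℂ) *
          covIntegrand ξ α β c N (nearCircle N (t / N))) t := by
    intro N hN
    have hNr : (0 : ℝ) < N := by exact_mod_cast hN
    have h1 := intervalIntegral.integral_comp_div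
      (f := fun θ => covIntegrand ξ α β c N (nearCircle N θ))
      (a := -(Real.pi / 2) * N) (b := Real.pi / 2 * N) hNr.ne'
    rw [mul_div_cancel_right₀ _ hNr.ne', mul_div_cancel_right₀ _ hNr.ne'] at h1
    rw [integral_indicator measurableSet_Ioc, integral_const_mul,
      ← intervalIntegral.integral_of_le (by nlinarith), h1, Complex.real_smul, ← mul_assoc,
      ← Complex.ofReal_mul, show (-(1 / 2) : ℝ) = -(3 / 2) + 1 by norm_num,
      Real.rpow_add_one hNr.ne']
  refine Tendsto.congr' ((eventually_gt_atTop 0).mono fun N hN => (hscale N hN).symm) ?_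
  have hK : 0 ≤ scaledMehlerBound ξ α β := (Real.exp_pos _).le
  refine tendsto_integral_filter_of_dominated_convergence
    (fun t : ℝ => scaledMehlerBound ξ α β * Real.exp ‖c‖ * Real.exp 1 *
      ((1 / 8 : ℝ) ^ (-(3 / 2 : ℝ) / 2) * (1 + ‖t‖ ^ 2) ^ (-(3 / 2 : ℝ) / 2))) ?_ ?_
    ((integrable_one_add_sq_rpow.const_mul _).const_mul _) ?_
  · filter_upwards [eventually_gt_atTop 0] with N hN
    refine (Continuous.aestronglyMeasurable ?_).indicator measurableSet_Ioc
    exact continuous_const.mul ((continuous_covIntegrand_nearCircle ξ α β c hN).comp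
      (continuous_id.div_const _))
  · filter_upwards [eventually_gt_atTop 0] with N hN
    refine ae_of_all _ fun t => ?_
    by_cases ht : t ∈ Set.Ioc (-(Real.pi / 2) * N) (Real.pi / 2 * N)
    · rw [Set.indicator_of_mem ht, norm_mul, Complex.norm_real, Real.norm_eq_abs,
        abs_of_nonneg (by positivity)]
      calc _ ≤ (N : ℝ) ^ (-(3 / 2) : ℝ) * (‖1 - nearCircle N (t / N)‖ ^ (-(1 / 2) : ℝ) *
            ‖1 + nearCircle N (t / N)‖ ^ (-(1 / 2) : ℝ) * scaledMehlerBound ξ α β /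
            ‖1 - nearCircle N (t / N)‖ * Real.exp ‖c‖ * Real.exp 1) := by
              gcongr; exact norm_covIntegrand_le ξ α β c hN _
        _ = scaledMehlerBound ξ α β * Real.exp ‖c‖ * Real.exp 1 * ((N : ℝ) ^ (-(3 / 2) : ℝ) *
            (‖1 - nearCircle N (t / N)‖ ^ (-(1 / 2) : ℝ) *
            ‖1 + nearCircle N (t / N)‖ ^ (-(1 / 2) : ℝ) / ‖1 - nearCircle N (t / N)‖)) := by ring
        _ ≤ _ := by gcongr ?_ * ?_; exact rpow_mul_norm_le hN (hmem N hN t ht)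
    · rw [Set.indicator_of_notMem ht, norm_zero]
      positivity
  · refine ae_of_all _ fun t => ?_
    have hlim := tendsto_covIntegrand ξ α β c (w := 1 - t * Complex.I) (by simp)
    refine hlim.congr' ?_
    have hlarge : ∀ᶠ N : ℕ in atTop, |t| / (Real.pi / 2) < N :=
      (tendsto_natCast_atTop_atTop (R := ℝ)).eventually_gt_atTop _
    filter_upwards [hlarge] with N hN
    rw [div_lt_iff₀ (by positivity), mul_comm, abs_lt] at hN
    have hmem : t ∈ Set.Ioc (-(Real.pi / 2) * N) (Real.pi / 2 * N) :=
      ⟨by linarith [hN.1], hN.2.le⟩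
    rw [Set.indicator_of_mem hmem, nearCircle_div, expCircle]

/-- The factor exp(w) from z^(-N) combines with exp(-ξ^2 w/4) into exp(a w), a = 1 - ξ^2/4; this is
positive exactly because ξ lies in the bulk. -/
theorem integral_limit_eq {ξ : ℝ} (hξ : ξ ∈ Set.Ioo (-2 : ℝ) 2) (α β c : ℝ) :
    (2 * Real.pi : ℂ)⁻¹ * ∫ t : ℝ, (1 - t * Complex.I : ℂ) ^ (-(3 / 2) : ℂ) *
        2 ^ (-(1 / 2) : ℂ) *
        Complex.exp (-(ξ ^ 2 * (1 - t * Complex.I) / 4) + ξ * (α + β) / 2 -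
          ((α - β) / 2) ^ 2 / (1 - t * Complex.I)) *
        Complex.exp c * Complex.exp (1 - t * Complex.I) =
      ((√2)⁻¹ * Real.exp (ξ * (α + β) / 2) * Real.exp c * (2 * √((1 - ξ ^ 2 / 4) / Real.pi) *
        Real.sinc ((α - β) * √(1 - ξ ^ 2 / 4))) : ℝ) := by
  have ha : 0 < 1 - ξ ^ 2 / 4 := by nlinarith [hξ.1, hξ.2]
  have h := integral_cpow_mul_cexp ((α - β) / 2) ha
  rw [mul_div_cancel₀ (α - β) (two_ne_zero (α := ℝ))] at h
  have h2 : (2 : ℂ) ^ (-(1 / 2) : ℂ) = ((√2)⁻¹ : ℝ) := by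
    rw [Real.sqrt_eq_rpow, ← Real.rpow_neg zero_le_two, Complex.ofReal_cpow zero_le_two]
    push_cast
    rfl
  rw [Complex.ofReal_mul, ← h, mul_left_comm]
  congr 1
  rw [← integral_const_mul]
  refine integral_congr_ae (ae_of_all _ fun t => ?_)
  simp only [h2]
  have he : Complex.exp (-(ξ ^ 2 * (1 - t * Complex.I) / 4) + ξ * (α + β) / 2 -
        ((α - β) / 2) ^ 2 / (1 - t * Complex.I)) * Complex.exp (1 - t * Complex.I) =
      Complex.exp (ξ * (α + β) / 2) * Complex.exp ((1 - ξ ^ 2 / 4 : ℝ) * (1 - t * Complex.I) -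
        ((α - β) / 2 : ℝ) ^ 2 / (1 - t * Complex.I)) := by
    rw [← Complex.exp_add, ← Complex.exp_add]
    congr 1
    push_cast
    ring
  push_cast at he ⊢
  linear_combination ((1 - t * Complex.I : ℂ) ^ (-(3 / 2) : ℂ) * (√2 : ℂ)⁻¹ *
    Complex.exp c) * he

/-- Everything rests on √(1 - ξ^2/4) = π ϱ(ξ): it cancels the density in the offsets and leaves one
factor ϱ(ξ) outside. -/
theorem limit_constant_eq {ξ : ℝ} (hξ : ξ ∈ Set.Ioo (-2 : ℝ) 2) (μ ν c : ℝ) :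
    (√(2 * Real.pi))⁻¹ * ((√2)⁻¹ *
      Real.exp (ξ * (μ / semicircleDensity ξ + ν / semicircleDensity ξ) / 2) *
      Real.exp c * (2 * √((1 - ξ ^ 2 / 4) / Real.pi) *
        Real.sinc ((μ / semicircleDensity ξ - ν / semicircleDensity ξ) *
          √(1 - ξ ^ 2 / 4)))) =
      Real.exp c * Real.exp (ξ * (μ + ν) / (2 * semicircleDensity ξ)) * semicircleDensity ξ *
        Real.sinc (Real.pi * (μ - ν)) := by
  have hpi := Real.pi_pos
  have ha : 0 < 1 - ξ ^ 2 / 4 := by nlinarith [hξ.1, hξ.2]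
  have hs := Real.sqrt_pos.2 ha
  have hρ : semicircleDensity ξ = √(1 - ξ ^ 2 / 4) / Real.pi := by
    rw [semicircleDensity, show 4 - ξ ^ 2 = 2 ^ 2 * (1 - ξ ^ 2 / 4) by ring,
      Real.sqrt_mul (by norm_num), Real.sqrt_sq zero_le_two]
    field_simp
  rw [hρ, Real.sqrt_div ha.le, Real.sqrt_mul zero_le_two]
  clear hρ
  generalize √(1 - ξ ^ 2 / 4) = s at *
  have h1 : (μ / (s / Real.pi) - ν / (s / Real.pi)) * s = Real.pi * (μ - ν) := by field_simp
  have h2 : ξ * (μ / (s / Real.pi) + ν / (s / Real.pi)) / 2 =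
      ξ * (μ + ν) / (2 * (s / Real.pi)) := by field_simp
  have h3 : (√2 * √Real.pi)⁻¹ * ((√2)⁻¹ * (2 * (s / √Real.pi))) = s / Real.pi := by
    have h4 := Real.sq_sqrt hpi.le
    have h5 := Real.sq_sqrt (zero_le_two (α := ℝ))
    have h6 := Real.sqrt_pos.2 hpi
    field_simp
    rw [h4, h5]
  rw [h1, h2, ← h3]
  ring

theorem tendsto_integral_covIntegrand (ξ α β : ℝ) (c : ℂ) :
    Tendsto (fun N : ℕ => (((N : ℝ) ^ (-(1 / 2) : ℝ) : ℝ) : ℂ) *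
      ∫ θ in -Real.pi..Real.pi, covIntegrand ξ α β c N (nearCircle N θ)) atTop
      (𝓝 (∫ t : ℝ, (1 - t * Complex.I : ℂ) ^ (-(3 / 2) : ℂ) * 2 ^ (-(1 / 2) : ℂ) *
        Complex.exp (-(ξ ^ 2 * (1 - t * Complex.I) / 4) + ξ * (α + β) / 2 -
          ((α - β) / 2) ^ 2 / (1 - t * Complex.I)) *
        Complex.exp c * Complex.exp (1 - t * Complex.I))) := by
  have hpi := Real.pi_pos
  have hright := tendsto_integral_covIntegrand_outer ξ α β c (a := Real.pi / 2) (b := Real.pi)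
    fun θ hθ => by
      rw [Set.uIoc_of_le (by linarith)] at hθ
      exact Real.cos_nonpos_of_pi_div_two_le_of_le hθ.1.le (by linarith [hθ.2])
  have hleft := tendsto_integral_covIntegrand_outer ξ α β c (a := -Real.pi) (b := -(Real.pi / 2))
    fun θ hθ => by
      rw [Set.uIoc_of_le (by linarith)] at hθ
      rw [← Real.cos_neg]
      exact Real.cos_nonpos_of_pi_div_two_le_of_le (by linarith [hθ.2]) (by linarith [hθ.1])
  have h := (hleft.add (tendsto_integral_covIntegrand_central ξ α β c)).add hright
  rw [zero_add, add_zero] at h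
  refine h.congr' ?_
  filter_upwards [eventually_gt_atTop 0] with N hN
  have hc := continuous_covIntegrand_nearCircle ξ α β c hN
  rw [← mul_add, ← mul_add,
    intervalIntegral.integral_add_adjacent_intervals (hc.intervalIntegrable _ _)
      (hc.intervalIntegrable _ _),
    intervalIntegral.integral_add_adjacent_intervals (hc.intervalIntegrable _ _)
      (hc.intervalIntegrable _ _)]

/-! ### Assembly -/

/-- Exact for every N > 0: both coefficients are read off on the circle of radius exp(-1/N), and
√(1/(2πN)) splits into (2π)^(-1/2) N^(-1/2). -/
theorem scaled_cov_eq (ξ α β : ℝ) (c : ℂ) {N : ℕ} (hN : 0 < N) :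
    ((√(1 / (2 * Real.pi * N)) * (1 / (N.factorial : ℝ)) *
        Real.exp (-(N * ξ ^ 2 / 2)) : ℝ) : ℂ) *
      (N.factorial * (expConv c (fun m => hermiteKernel m (scaledPoint ξ α N)
        (scaledPoint ξ β N)) N - hermiteTerm N (scaledPoint ξ α N) (scaledPoint ξ β N))) =
    (((√(2 * Real.pi))⁻¹ : ℝ) : ℂ) * ((2 * Real.pi : ℂ)⁻¹ *
      ((((N : ℝ) ^ (-(1 / 2) : ℝ) : ℝ) : ℂ) *
        (∫ θ in -Real.pi..Real.pi, covIntegrand ξ α β c N (nearCircle N θ)) -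
      (((N : ℝ) ^ (-(1 / 2) : ℝ) : ℝ) : ℂ) *
        ∫ θ in -Real.pi..Real.pi, scaledMehler ξ α β N (nearCircle N θ) *
          nearCircle N θ ^ (-(N : ℤ)))) := by
  have hNr : (0 : ℝ) < N := by exact_mod_cast hN
  have hr := Real.exp_pos (-(N : ℝ)⁻¹)
  have hr1 : Real.exp (-(N : ℝ)⁻¹) < 1 := by
    rw [Real.exp_lt_one_iff, neg_lt_zero]; positivity
  have hfac : (N.factorial : ℂ) ≠ 0 := by exact_mod_cast N.factorial_ne_zero
  have hsqrt : √(1 / (2 * Real.pi * N)) = (√(2 * Real.pi))⁻¹ * (N : ℝ) ^ (-(1 / 2) : ℝ) := by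
    rw [one_div, Real.sqrt_inv, Real.sqrt_mul (by positivity), mul_inv,
      Real.rpow_neg hNr.le, ← Real.sqrt_eq_rpow]
  have h1 : ∫ θ in -Real.pi..Real.pi, covIntegrand ξ α β c N (nearCircle N θ) =
      Real.exp (-(N * ξ ^ 2 / 2)) * ∫ θ in -Real.pi..Real.pi,
        (fun z => mehler (scaledPoint ξ α N) (scaledPoint ξ β N) z / (1 - z) *
          ∑ j ∈ Finset.range (N + 1), (c * z ^ 2) ^ j / (j.factorial : ℂ)) (nearCircle N θ) *
        nearCircle N θ ^ (-(N : ℤ)) := by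
    rw [← intervalIntegral.integral_const_mul]
    simp only [covIntegrand, scaledMehler]
    congr 1
    funext θ
    ring
  have h2 : ∫ θ in -Real.pi..Real.pi, scaledMehler ξ α β N (nearCircle N θ) *
          nearCircle N θ ^ (-(N : ℤ)) =
      Real.exp (-(N * ξ ^ 2 / 2)) * ∫ θ in -Real.pi..Real.pi,
        mehler (scaledPoint ξ α N) (scaledPoint ξ β N) (nearCircle N θ) *
        nearCircle N θ ^ (-(N : ℤ)) := by
    rw [← intervalIntegral.integral_const_mul]
    simp only [scaledMehler]
    congr 1
    funext θ
    ring
  rw [← circleCoeff_expConv hr hr1, ← circleCoeff_mehler hr hr1,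
    circleCoeff_eq_intervalIntegral _ _ _ hr, circleCoeff_eq_intervalIntegral _ _ _ hr, h1, h2,
    hsqrt]
  simp only [nearCircle]
  generalize (∫ θ in -Real.pi..Real.pi, _ : ℂ) = I₁
  generalize (∫ θ in -Real.pi..Real.pi, _ : ℂ) = I₂
  push_cast
  field_simp

theorem proposition2
    (Q : Measure ℝ) [IsProbabilityMeasure Q]
    (hmean : ∫ x, x ∂Q = 0)
    (hvar : ∫ x, x ^ 2 ∂Q = 1 / 2)
    (hfour : Integrable (fun x : ℝ => x ^ 4) Q)
    {Ω : Type*} [MeasurableSpace Ω] (P : Measure Ω) [IsProbabilityMeasure P]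
    (D : ℕ → Ω → ℝ) (R J : UpperIndex → Ω → ℝ)
    (hD : ∀ i, HasLaw (D i) Q P)
    (hR : ∀ p, HasLaw (R p) Q P)
    (hJ : ∀ p, HasLaw (J p) Q P)
    (hindep : iIndepFun (Sum.elim D (Sum.elim R J)) P)
    (ξ : ℝ) (hξ : ξ ∈ Set.Ioo (-2 : ℝ) 2) (μ ν : ℝ) :
    (∀ (N : ℕ) (x : ℝ), MemLp (wignerCharDet D R J N x) 2 P) ∧
    Tendsto
      (fun N : ℕ =>
        ((Real.sqrt (1 / (2 * Real.pi * N)) * (1 / (N.factorial : ℝ)) *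
            Real.exp (-(N * ξ ^ 2 / 2)) : ℝ) : ℂ) *
          wignerDetCov P D R J N
            (Real.sqrt N * ξ + μ / (Real.sqrt N * semicircleDensity ξ))
            (Real.sqrt N * ξ + ν / (Real.sqrt N * semicircleDensity ξ)))
      atTop
      (𝓝 ((Real.exp ((∫ x, x ^ 4 ∂Q) - 3 / 4) *
            Real.exp (ξ * (μ + ν) / (2 * semicircleDensity ξ)) *
            semicircleDensity ξ * Real.sinc (Real.pi * (μ - ν)) : ℝ) : ℂ)) := by
  have key := memLp_wignerCharDet_and_cov hmean hvar hfour hD hR hJ hindep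
  refine ⟨fun N => (key N).1, ?_⟩
  have hpt : ∀ (η : ℝ) (N : ℕ), √N * ξ + η / (√N * semicircleDensity ξ) =
      scaledPoint ξ (η / semicircleDensity ξ) N := fun η N => by
    rw [scaledPoint, div_div, mul_comm (√(N : ℝ)) (semicircleDensity ξ)]
  rw [← limit_constant_eq hξ, Complex.ofReal_mul, ← integral_limit_eq hξ]
  have hlim := (((tendsto_integral_covIntegrand ξ (μ / semicircleDensity ξ)
    (ν / semicircleDensity ξ) (((∫ x, x ^ 4 ∂Q) - 3 / 4 : ℝ) : ℂ)).sub
    (tendsto_integral_scaledMehler ξ (μ / semicircleDensity ξ)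
    (ν / semicircleDensity ξ))).const_mul (2 * Real.pi : ℂ)⁻¹).const_mul
    (((√(2 * Real.pi))⁻¹ : ℝ) : ℂ)
  rw [sub_zero] at hlim
  refine hlim.congr' ?_
  filter_upwards [eventually_gt_atTop 0] with N hN
  rw [(key N).2, hpt, hpt, scaled_cov_eq _ _ _ _ hN]
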